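/- **Setting.** Let $k$ be a commutative ring; algebras are associative unital $k$-algebras. *Bialgebroids.* A left bialgebroid $\mathcal H_L=(H,L,s_L,t_L,\gamma_L,\pi_L)$ consists of algebras $H,L$, algebra maps $s_L:L\to H$, $t_L:L^{op}\to H$ with commuting images, and an $L$-coring structure $(\gamma_L,\pi_L)$ on $H$ for the bimodule structure $l\cdot h\cdot l'=s_L(l)t_L(l')h$, such that, writing $\gamma_L(h)=h_{(1)}\otimes_L h_{(2)}$, for all $l\in L$ and $h,h'\in H$: $h_{(1)}t_L(l)\otimes_L h_{(2)}=h_{(1)}\otimes_L h_{(2)}s_L(l)$, $\gamma_L(1)=1\otimes_L 1$, $\gamma_L(hh')=\gamma_L(h)\gamma_L(h')$, $\pi_L(1)=1$, and $\pi_L(h\,s_L(\pi_L(h')))=\pi_L(hh')=\pi_L(h\,t_L(\pi_L(h')))$. A right bialgebroid $\mathcal H_R=(H,R,s_R,t_R,\gamma_R,\pi_R)$ consists of algebras $H,R$, algebra maps $s_R:R\to H$, $t_R:R^{op}\to H$ with commuting images, and an $R$-coring structure $(\gamma_R,\pi_R)$ on $H$ for the bimodule structure $r\cdot h\cdot r'=h\,t_R(r)s_R(r')$,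 such that, writing $\gamma_R(h)=h^{(1)}\otimes_R h^{(2)}$: $s_R(r)h^{(1)}\otimes_R h^{(2)}=h^{(1)}\otimes_R t_R(r)h^{(2)}$, $\gamma_R$ is unital and multiplicative, $\pi_R(1)=1$, and $\pi_R(s_R(\pi_R(h))h')=\pi_R(hh')=\pi_R(t_R(\pi_R(h))h')$. *Hopf algebroids.* A Hopf algebroid $\mathcal H=(\mathcal H_L,\mathcal H_R,S)$ is a left and a right bialgebroid with the same total algebra $H$, together with a $k$-linear map $S:H\to H$, such that * $s_L\pi_Lt_R=t_R$, $t_L\pi_Ls_R=s_R$, $s_R\pi_Rt_L=t_L$, $t_R\pi_Rs_L=s_L$; * $(\gamma_L\otimes_R H)\gamma_R=(H\otimes_L\gamma_R)\gamma_L$ and $(\gamma_R\otimes_L H)\gamma_L=(H\otimes_R\gamma_L)\gamma_R$; * $S(t_L(l')\,h\,t_L(l))=s_L(l)S(h)s_L(l')$ and $S(t_R(r')\,h\,t_R(r))=s_R(r)S(h)s_R(r')$; * $S(h_{(1)})h_{(2)}=s_R(\pi_R(h))$ and $h^{(1)}S(h^{(2)})=s_L(\pi_L(h))$. It is *finitely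 generated projective* if $H$ is a finitely generated projective module for each of the four module structures $h\cdot r=h\,s_R(r)$, $r\cdot h=h\,t_R(r)$, $h\cdot l=t_L(l)h$, $l\cdot h=s_L(l)h$. *Comodule algebras.* A right $\mathcal H_R$-comodule algebra is an algebra $A$ with an algebra map $\eta_R:R\to A$ (which makes $A$ an $R$-$R$ bimodule) and a coassociative and counital right coaction $A\to A\otimes_R H$, $a\mapsto a^{\langle0\rangle}\otimes_R a^{\langle1\rangle}$, that is unital and multiplicative and satisfies, for $r\in R$ and $a\in A$, the following identities in $A\otimes_R H$: $\eta_R(r)a^{\langle0\rangle}\otimes a^{\langle1\rangle}=a^{\langle0\rangle}\otimes t_R(r)a^{\langle1\rangle}$, $(a\eta_R(r))^{\langle0\rangle}\otimes(a\eta_R(r))^{\langle1\rangle}=a^{\langle0\rangle}\otimes a^{\langle1\rangle}s_R(r)$, $(\eta_R(r)a)^{\langle0\rangle}\otimes(\eta_R(r)a)^{\langle1\rangle}=a^{\langle0\rangle}\otimes s_R(r)a^{\langle1\rangle}$. A right $\mathcal H_L$-comodule algebra is an algebra $A$ with an algebra map $\eta_L:L^{op}\to A$ (which makes $A$ an $L$-$L$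 bimodule by $l\cdot a\cdot l'=\eta_L(l')\,a\,\eta_L(l)$) and a coassociative and counital right coaction $A\to A\otimes_L H$, $a\mapsto a_{\langle0\rangle}\otimes_L a_{\langle1\rangle}$, that is unital and multiplicative and satisfies, in $A\otimes_L H$, $a_{\langle0\rangle}\eta_L(l)\otimes a_{\langle1\rangle}=a_{\langle0\rangle}\otimes a_{\langle1\rangle}s_L(l)$, $(\eta_L(l)a)_{\langle0\rangle}\otimes(\eta_L(l)a)_{\langle1\rangle}=a_{\langle0\rangle}\otimes t_L(l)a_{\langle1\rangle}$, $(a\eta_L(l))_{\langle0\rangle}\otimes(a\eta_L(l))_{\langle1\rangle}=a_{\langle0\rangle}\otimes a_{\langle1\rangle}t_L(l)$. A right $\mathcal H$-comodule algebra is an algebra $A$ with both structures, with coactions $\tau_R$, $\tau_L$, such that $\eta_L(l')\,a\,\eta_L(l)=\eta_R(\pi_Rt_L(l'))\,a\,\eta_R(\pi_Rt_L(l))$, $(\tau_R\otimes_L H)\tau_L=(A\otimes_R\gamma_L)\tau_R$ and $(\tau_L\otimes_R H)\tau_R=(A\otimes_L\gamma_R)\tau_L$. *Galois extensions.* The $\mathcal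 H_R$-coinvariants of $A$ are $\{a:\tau_R(a)=a\otimes_R 1\}$ and the $\mathcal H_L$-coinvariants are $\{a:\tau_L(a)=a\otimes_L 1\}$. A subalgebra $B\subset A$ is $\mathcal H_R$-Galois if $B$ is the subalgebra of $\mathcal H_R$-coinvariants and $\mathrm{can}_R:A\otimes_BA\to A\otimes_RH$, $a\otimes a'\mapsto aa'^{\langle0\rangle}\otimes a'^{\langle1\rangle}$, is bijective; it is $\mathcal H_L$-Galois if $B$ is the subalgebra of $\mathcal H_L$-coinvariants and $\mathrm{can}_L:A\otimes_BA\to A\otimes_LH$, $a\otimes a'\mapsto a_{\langle0\rangle}a'\otimes a_{\langle1\rangle}$, is bijective; it is $\mathcal H$-Galois if it is both. The coinvariants $(A\otimes_kA)^{co\mathcal H}$ are the elements $x\in A\otimes_k A$ whose image under $A\otimes_k\tau_R$ is their image under $A\otimes_k(a\mapsto a\otimes_R1)$, and the equality $(A\otimes_kA)^{co\mathcal H}=A\otimes_kB$ means that these coinvariants are exactly the image of $A\otimes_kB$ in $A\otimes_kA$. **Corollary.** Let $\mathcal H$ be a finitely generated projective Hopf algebroid with bijective antipode, let $A$ be a right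 $\mathcal H$-comodule algebra, and let $B\subset A$ be the subalgebra of $\mathcal H_R$-coinvariants. The extension $B\subset A$ is $\mathcal H_R$-Galois if and only if it is $\mathcal H_L$-Galois. Moreover: 1. If $(A\otimes_kA)^{co\mathcal H}=A\otimes_kB$ (which holds for example if $A$ is $k$-flat) and $\mathrm{can}_R$ is surjective, then $B\subset A$ is $\mathcal H_R$-Galois, and equivalently $\mathcal H_L$-Galois. 2. If $B\subset A$ is $\mathcal H$-Galois, then $A$ is projective both as a left and as a right $B$-module. -/

import Mathlib

open MulOpposite
open scoped TensorProduct

namespace HopfAlgebroidGalois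

noncomputable section

/-! ### Tensor products over noncommutative algebras

Everything lives over a commutative ring `k`.  A right action `act` of `X` on `M` and a left action
`act'` of `X` on `N` are given as functions, because one `k`-module will carry several module
structures over the same algebra. -/

/-- The relations `m · x ⊗ n = m ⊗ x · n`. -/
def balancedRel (k : Type*) [CommRing k] {X M N : Type*} [AddCommGroup M] [Module k M]
    [AddCommGroup N] [Module k N] (act : X → M → M) (act' : X → N → N) :
    Submodule k (M ⊗[k] N) :=
  Submodule.span k {z | ∃ (x : X) (m : M) (n : N), z = act x m ⊗ₜ[k] n - m ⊗ₜ[k] act' x n}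

/-- The balanced tensor product `M ⊗_X N`, as a quotient of `M ⊗_k N`. -/
abbrev BTensor (k : Type*) [CommRing k] {X M N : Type*} [AddCommGroup M] [Module k M]
    [AddCommGroup N] [Module k N] (act : X → M → M) (act' : X → N → N) : Type _ :=
  (M ⊗[k] N) ⧸ balancedRel k act act'

/-- The relations `m · x ⊗ n ⊗ p = m ⊗ x · n ⊗ p` and `m ⊗ n · y ⊗ p = m ⊗ n ⊗ y · p`. -/
def balancedRel₃ (k : Type*) [CommRing k] {X Y M N P : Type*} [AddCommGroup M] [Module k M]
    [AddCommGroup N] [Module k N] [AddCommGroup P] [Module k P]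
    (act : X → M → M) (act' : X → N → N) (bct : Y → N → N) (bct' : Y → P → P) :
    Submodule k ((M ⊗[k] N) ⊗[k] P) :=
  Submodule.span k
    ({z | ∃ (x : X) (m : M) (n : N) (p : P),
        z = (act x m ⊗ₜ[k] n) ⊗ₜ[k] p - (m ⊗ₜ[k] act' x n) ⊗ₜ[k] p} ∪
     {z | ∃ (y : Y) (m : M) (n : N) (p : P),
        z = (m ⊗ₜ[k] bct y n) ⊗ₜ[k] p - (m ⊗ₜ[k] n) ⊗ₜ[k] bct' y p})

/-- The double balanced tensor product `M ⊗_X N ⊗_Y P`, as a quotient of `M ⊗_k N ⊗_k P`. -/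
abbrev BTensor₃ (k : Type*) [CommRing k] {X Y M N P : Type*} [AddCommGroup M] [Module k M]
    [AddCommGroup N] [Module k N] [AddCommGroup P] [Module k P]
    (act : X → M → M) (act' : X → N → N) (bct : Y → N → N) (bct' : Y → P → P) : Type _ :=
  ((M ⊗[k] N) ⊗[k] P) ⧸ balancedRel₃ k act act' bct bct'

section Expand

variable {k : Type*} [CommRing k] {X Y M N P : Type*} [AddCommGroup M] [Module k M]
  [AddCommGroup N] [Module k N] [AddCommGroup P] [Module k P]

/-- The class in `M ⊗_X N` of an element of `M ⊗_k N`. -/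
abbrev cls (act : X → M → M) (act' : X → N → N) : (M ⊗[k] N) →ₗ[k] BTensor k act act' :=
  (balancedRel k act act').mkQ

/-- The canonical map `(M ⊗_X N) ⊗_k P → M ⊗_X N ⊗_Y P`. -/
def expandLeft (act : X → M → M) (act' : X → N → N) (bct : Y → N → N) (bct' : Y → P → P) :
    (BTensor k act act' ⊗[k] P) →ₗ[k] BTensor₃ k act act' bct bct' :=
  TensorProduct.lift <| (balancedRel k act act').liftQ
    (TensorProduct.curry (balancedRel₃ k act act' bct bct').mkQ) <| by
      refine Submodule.span_le.2 ?_
      rintro _ ⟨x, m, n, rfl⟩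
      simp only [SetLike.mem_coe, LinearMap.mem_ker, map_sub]
      ext p
      simp only [TensorProduct.curry_apply, LinearMap.zero_apply, ← map_sub]
      exact (Submodule.Quotient.mk_eq_zero _).2
        (Submodule.subset_span (Or.inl ⟨x, m, n, p, TensorProduct.sub_tmul _ _ _⟩))

/-- The canonical map `M ⊗_k (N ⊗_Y P) → M ⊗_X N ⊗_Y P`. -/
def expandRight (act : X → M → M) (act' : X → N → N) (bct : Y → N → N) (bct' : Y → P → P) :
    (M ⊗[k] BTensor k bct bct') →ₗ[k] BTensor₃ k act act' bct bct' :=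
  TensorProduct.lift <| LinearMap.flip <| (balancedRel k bct bct').liftQ
    (LinearMap.flip (TensorProduct.curry
      ((balancedRel₃ k act act' bct bct').mkQ ∘ₗ
        (TensorProduct.assoc k M N P).symm.toLinearMap))) <| by
      refine Submodule.span_le.2 ?_
      rintro _ ⟨y, n, p, rfl⟩
      simp only [SetLike.mem_coe, LinearMap.mem_ker, map_sub]
      ext m
      simp only [LinearMap.sub_apply, LinearMap.flip_apply, TensorProduct.curry_apply,
        LinearMap.zero_apply, LinearMap.comp_apply, LinearEquiv.coe_coe]
      rw [← map_sub]
      exact (Submodule.Quotient.mk_eq_zero _).2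
        (Submodule.subset_span (Or.inr ⟨y, m, n, p, rfl⟩))

end Expand

/-! ### Bialgebroids

In the structures below, a variable `x` with `cls _ _ x = γ h` is a representative of the coproduct
of `h` in the tensor product over `k` (Sweedler notation `x = h₁ ⊗ h₂`).  Identities are required
for all representatives; the two sides do not depend on the representative, by the linearity of the
maps involved (for the multiplicativity, by the Takeuchi condition). -/

/-- A left bialgebroid with total algebra `H` and base algebra `L`.  The `L`-`L` bimodule structure
on `H` is `l · h · l' = s(l) t(l') h`, so the coproduct takes values in the quotient of
`H ⊗_k H` by the relations `t(l) h ⊗ h' = h ⊗ s(l) h'`. -/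
structure LeftBialgebroid (k L H : Type*) [CommRing k] [Ring L] [Algebra k L]
    [Ring H] [Algebra k H] where
  s : L →ₐ[k] H
  t : Lᵐᵒᵖ →ₐ[k] H
  st_comm : ∀ l l' : L, s l * t (op l') = t (op l') * s l
  γ : H →ₗ[k] BTensor k (fun (l : L) (h : H) => t (op l) * h) (fun (l : L) (h : H) => s l * h)
  π : H →ₗ[k] L
  /-- `γ` is a bimodule map -/
  γ_bimod : ∀ (l l' : L) (h : H) (x : H ⊗[k] H), cls _ _ x = γ h →
    γ (s l * t (op l') * h) = cls _ _ ((s l ⊗ₜ[k] t (op l')) * x)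
  /-- `π` is a bimodule map -/
  π_bimod : ∀ (l l' : L) (h : H), π (s l * t (op l') * h) = l * π h * l'
  /-- `(γ ⊗ H) ∘ γ = (H ⊗ γ) ∘ γ` -/
  coassoc : ∀ (h : H) (x : H ⊗[k] H), cls _ _ x = γ h →
    expandLeft _ _ (fun (l : L) (h : H) => t (op l) * h) (fun (l : L) (h : H) => s l * h)
        (TensorProduct.map γ LinearMap.id x) =
      expandRight _ _ _ _ (TensorProduct.map LinearMap.id γ x)
  /-- `s(π(h₁)) h₂ = h` -/
  counit_left : ∀ (h : H) (x : H ⊗[k] H), cls _ _ x = γ h →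
    LinearMap.mul' k H (TensorProduct.map (s.toLinearMap ∘ₗ π) LinearMap.id x) = h
  /-- `t(π(h₂)) h₁ = h` -/
  counit_right : ∀ (h : H) (x : H ⊗[k] H), cls _ _ x = γ h →
    LinearMap.mul' k H (TensorProduct.map (t.toLinearMap ∘ₗ (opLinearEquiv k).toLinearMap ∘ₗ π)
      LinearMap.id (TensorProduct.comm k H H x)) = h
  /-- `h₁ t(l) ⊗ h₂ = h₁ ⊗ h₂ s(l)` -/
  takeuchi : ∀ (l : L) (h : H) (x : H ⊗[k] H), cls _ _ x = γ h →
    cls (fun (l : L) (h : H) => t (op l) * h) (fun (l : L) (h : H) => s l * h)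
        (x * (t (op l) ⊗ₜ[k] 1)) = cls _ _ (x * (1 ⊗ₜ[k] s l))
  γ_one : γ 1 = cls _ _ (1 ⊗ₜ[k] 1)
  γ_mul : ∀ (h h' : H) (x y : H ⊗[k] H), cls _ _ x = γ h → cls _ _ y = γ h' →
    γ (h * h') = cls _ _ (x * y)
  π_one : π 1 = 1
  π_mul_s : ∀ h h' : H, π (h * s (π h')) = π (h * h')
  π_mul_t : ∀ h h' : H, π (h * t (op (π h'))) = π (h * h')

/-- A right bialgebroid with total algebra `H` and base algebra `R`.  The `R`-`R` bimodule structure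
on `H` is `r · h · r' = h t(r) s(r')`, so the coproduct takes values in the quotient of
`H ⊗_k H` by the relations `h s(r) ⊗ h' = h ⊗ h' t(r)`. -/
structure RightBialgebroid (k R H : Type*) [CommRing k] [Ring R] [Algebra k R]
    [Ring H] [Algebra k H] where
  s : R →ₐ[k] H
  t : Rᵐᵒᵖ →ₐ[k] H
  st_comm : ∀ r r' : R, s r * t (op r') = t (op r') * s r
  γ : H →ₗ[k] BTensor k (fun (r : R) (h : H) => h * s r) (fun (r : R) (h : H) => h * t (op r))
  π : H →ₗ[k] R
  /-- `γ` is a bimodule map -/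
  γ_bimod : ∀ (r r' : R) (h : H) (x : H ⊗[k] H), cls _ _ x = γ h →
    γ (h * t (op r) * s r') = cls _ _ (x * (t (op r) ⊗ₜ[k] s r'))
  /-- `π` is a bimodule map -/
  π_bimod : ∀ (r r' : R) (h : H), π (h * t (op r) * s r') = r * π h * r'
  /-- `(γ ⊗ H) ∘ γ = (H ⊗ γ) ∘ γ` -/
  coassoc : ∀ (h : H) (x : H ⊗[k] H), cls _ _ x = γ h →
    expandLeft _ _ (fun (r : R) (h : H) => h * s r) (fun (r : R) (h : H) => h * t (op r))
        (TensorProduct.map γ LinearMap.id x) =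
      expandRight _ _ _ _ (TensorProduct.map LinearMap.id γ x)
  /-- `h₂ t(π(h₁)) = h` -/
  counit_left : ∀ (h : H) (x : H ⊗[k] H), cls _ _ x = γ h →
    LinearMap.mul' k H (TensorProduct.map LinearMap.id
      (t.toLinearMap ∘ₗ (opLinearEquiv k).toLinearMap ∘ₗ π) (TensorProduct.comm k H H x)) = h
  /-- `h₁ s(π(h₂)) = h` -/
  counit_right : ∀ (h : H) (x : H ⊗[k] H), cls _ _ x = γ h →
    LinearMap.mul' k H (TensorProduct.map LinearMap.id (s.toLinearMap ∘ₗ π) x) = h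
  /-- `s(r) h₁ ⊗ h₂ = h₁ ⊗ t(r) h₂` -/
  takeuchi : ∀ (r : R) (h : H) (x : H ⊗[k] H), cls _ _ x = γ h →
    cls (fun (r : R) (h : H) => h * s r) (fun (r : R) (h : H) => h * t (op r))
        ((s r ⊗ₜ[k] 1) * x) = cls _ _ ((1 ⊗ₜ[k] t (op r)) * x)
  γ_one : γ 1 = cls _ _ (1 ⊗ₜ[k] 1)
  γ_mul : ∀ (h h' : H) (x y : H ⊗[k] H), cls _ _ x = γ h → cls _ _ y = γ h' →
    γ (h * h') = cls _ _ (x * y)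
  π_one : π 1 = 1
  π_s_mul : ∀ h h' : H, π (s (π h) * h') = π (h * h')
  π_t_mul : ∀ h h' : H, π (t (op (π h)) * h') = π (h * h')

/-! ### Hopf algebroids -/

/-- A Hopf algebroid: a left bialgebroid `lb` over `L` and a right bialgebroid `rb` over `R` with
common total algebra `H`, and an antipode `S`. -/
structure HopfAlgebroid (k L R H : Type*) [CommRing k] [Ring L] [Algebra k L]
    [Ring R] [Algebra k R] [Ring H] [Algebra k H] where
  lb : LeftBialgebroid k L H
  rb : RightBialgebroid k R H
  S : H →ₗ[k] H
  sL_πL_tR : ∀ r : R, lb.s (lb.π (rb.t (op r))) = rb.t (op r)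
  tL_πL_sR : ∀ r : R, lb.t (op (lb.π (rb.s r))) = rb.s r
  sR_πR_tL : ∀ l : L, rb.s (rb.π (lb.t (op l))) = lb.t (op l)
  tR_πR_sL : ∀ l : L, rb.t (op (rb.π (lb.s l))) = lb.s l
  /-- `(γ_L ⊗ H) ∘ γ_R = (H ⊗ γ_R) ∘ γ_L` in `H ⊗_L H ⊗_R H` -/
  γL_γR : ∀ (h : H) (x y : H ⊗[k] H), cls _ _ x = rb.γ h → cls _ _ y = lb.γ h →
    expandLeft _ _ (fun (r : R) (h : H) => h * rb.s r) (fun (r : R) (h : H) => h * rb.t (op r))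
        (TensorProduct.map lb.γ LinearMap.id x) =
      expandRight _ _ _ _ (TensorProduct.map LinearMap.id rb.γ y)
  /-- `(γ_R ⊗ H) ∘ γ_L = (H ⊗ γ_L) ∘ γ_R` in `H ⊗_R H ⊗_L H` -/
  γR_γL : ∀ (h : H) (x y : H ⊗[k] H), cls _ _ x = lb.γ h → cls _ _ y = rb.γ h →
    expandLeft _ _ (fun (l : L) (h : H) => lb.t (op l) * h) (fun (l : L) (h : H) => lb.s l * h)
        (TensorProduct.map rb.γ LinearMap.id x) =
      expandRight _ _ _ _ (TensorProduct.map LinearMap.id lb.γ y)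
  S_bimod_L : ∀ (l l' : L) (h : H),
    S (lb.t (op l') * h * lb.t (op l)) = lb.s l * S h * lb.s l'
  S_bimod_R : ∀ (r r' : R) (h : H),
    S (rb.t (op r') * h * rb.t (op r)) = rb.s r * S h * rb.s r'
  /-- `S(h₁) h₂ = s_R(π_R(h))`, for the coproduct of `lb` -/
  S_left : ∀ (h : H) (x : H ⊗[k] H), cls _ _ x = lb.γ h →
    LinearMap.mul' k H (TensorProduct.map S LinearMap.id x) = rb.s (rb.π h)
  /-- `h₁ S(h₂) = s_L(π_L(h))`, for the coproduct of `rb` -/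
  S_right : ∀ (h : H) (x : H ⊗[k] H), cls _ _ x = rb.γ h →
    LinearMap.mul' k H (TensorProduct.map LinearMap.id S x) = lb.s (lb.π h)

/-- The `E`-module `M`, regarded as an `X`-module by restriction along `f : X → E`, is projective. -/
def ProjectiveVia {X E : Type*} [Ring X] [Ring E] (M : Type*) [AddCommGroup M] [Module E M]
    (f : X →+* E) : Prop :=
  @Module.Projective X _ M _ (Module.compHom M f)

/-- The `E`-module `M`, regarded as an `X`-module by restriction along `f : X → E`, is finitely
generated and projective. -/
def FGProjectiveVia {X E : Type*} [Ring X] [Ring E] (M : Type*) [AddCommGroup M] [Module E M]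
    (f : X →+* E) : Prop :=
  @Module.Finite X M _ _ (Module.compHom M f) ∧ ProjectiveVia M f

namespace HopfAlgebroid

variable {k L R H : Type*} [CommRing k] [Ring L] [Algebra k L] [Ring R] [Algebra k R]
  [Ring H] [Algebra k H]

/-- `H` is finitely generated and projective as a module for each of
`h · r = h s_R(r)`, `r · h = h t_R(r)`, `h · l = t_L(l) h` and `l · h = s_L(l) h`.
Right modules are modules over the opposite algebra; right multiplication is the canonical action of
the opposite algebra of `H` on `H`. -/
def IsFGProjective (𝓗 : HopfAlgebroid k L R H) : Prop :=
  FGProjectiveVia H (AlgHom.op 𝓗.rb.s).toRingHom ∧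
  FGProjectiveVia H (AlgHom.opComm.symm 𝓗.rb.t).toRingHom ∧
  FGProjectiveVia H 𝓗.lb.t.toRingHom ∧
  FGProjectiveVia H 𝓗.lb.s.toRingHom

end HopfAlgebroid

/-! ### Comodule algebras -/

/-- A right comodule algebra for a right bialgebroid.  `A` is an `R`-ring via `η`, and the coaction
takes values in the quotient of `A ⊗_k H` by the relations `a η(r) ⊗ h = a ⊗ h t(r)`. -/
structure RightBialgebroid.ComoduleAlgebra {k R H : Type*} [CommRing k] [Ring R] [Algebra k R]
    [Ring H] [Algebra k H] (rb : RightBialgebroid k R H) (A : Type*) [Ring A] [Algebra k A] where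
  η : R →ₐ[k] A
  τ : A →ₗ[k] BTensor k (fun (r : R) (a : A) => a * η r) (fun (r : R) (h : H) => h * rb.t (op r))
  /-- right `R`-linearity -/
  τ_right : ∀ (r : R) (a : A) (x : A ⊗[k] H), cls _ _ x = τ a →
    τ (a * η r) = cls _ _ (x * (1 ⊗ₜ[k] rb.s r))
  /-- left `R`-linearity -/
  τ_left : ∀ (r : R) (a : A) (x : A ⊗[k] H), cls _ _ x = τ a →
    τ (η r * a) = cls _ _ ((1 ⊗ₜ[k] rb.s r) * x)
  /-- `(τ ⊗ H) ∘ τ = (A ⊗ γ) ∘ τ` -/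
  coassoc : ∀ (a : A) (x : A ⊗[k] H), cls _ _ x = τ a →
    expandLeft _ _ (fun (r : R) (h : H) => h * rb.s r) (fun (r : R) (h : H) => h * rb.t (op r))
        (TensorProduct.map τ LinearMap.id x) =
      expandRight _ _ _ _ (TensorProduct.map LinearMap.id rb.γ x)
  /-- `a₀ η(π(a₁)) = a` -/
  counit : ∀ (a : A) (x : A ⊗[k] H), cls _ _ x = τ a →
    LinearMap.mul' k A (TensorProduct.map LinearMap.id (η.toLinearMap ∘ₗ rb.π) x) = a
  /-- `η(r) a₀ ⊗ a₁ = a₀ ⊗ t(r) a₁` -/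
  takeuchi : ∀ (r : R) (a : A) (x : A ⊗[k] H), cls _ _ x = τ a →
    cls (fun (r : R) (a : A) => a * η r) (fun (r : R) (h : H) => h * rb.t (op r))
        ((η r ⊗ₜ[k] 1) * x) = cls _ _ ((1 ⊗ₜ[k] rb.t (op r)) * x)
  τ_one : τ 1 = cls _ _ (1 ⊗ₜ[k] 1)
  τ_mul : ∀ (a a' : A) (x y : A ⊗[k] H), cls _ _ x = τ a → cls _ _ y = τ a' →
    τ (a * a') = cls _ _ (x * y)

/-- A right comodule algebra for a left bialgebroid.  `A` is an `Lᵒᵖ`-ring via `η`, that is, an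
`L`-`L` bimodule by `l · a · l' = η(l') a η(l)`; the coaction takes values in the quotient of
`A ⊗_k H` by the relations `η(l) a ⊗ h = a ⊗ s(l) h`. -/
structure LeftBialgebroid.ComoduleAlgebra {k L H : Type*} [CommRing k] [Ring L] [Algebra k L]
    [Ring H] [Algebra k H] (lb : LeftBialgebroid k L H) (A : Type*) [Ring A] [Algebra k A] where
  η : Lᵐᵒᵖ →ₐ[k] A
  τ : A →ₗ[k] BTensor k (fun (l : L) (a : A) => η (op l) * a) (fun (l : L) (h : H) => lb.s l * h)
  /-- right `L`-linearity -/
  τ_right : ∀ (l : L) (a : A) (x : A ⊗[k] H), cls _ _ x = τ a →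
    τ (η (op l) * a) = cls _ _ ((1 ⊗ₜ[k] lb.t (op l)) * x)
  /-- left `L`-linearity -/
  τ_left : ∀ (l : L) (a : A) (x : A ⊗[k] H), cls _ _ x = τ a →
    τ (a * η (op l)) = cls _ _ (x * (1 ⊗ₜ[k] lb.t (op l)))
  /-- `(τ ⊗ H) ∘ τ = (A ⊗ γ) ∘ τ` -/
  coassoc : ∀ (a : A) (x : A ⊗[k] H), cls _ _ x = τ a →
    expandLeft _ _ (fun (l : L) (h : H) => lb.t (op l) * h) (fun (l : L) (h : H) => lb.s l * h)
        (TensorProduct.map τ LinearMap.id x) =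
      expandRight _ _ _ _ (TensorProduct.map LinearMap.id lb.γ x)
  /-- `η(π(a₁)) a₀ = a` -/
  counit : ∀ (a : A) (x : A ⊗[k] H), cls _ _ x = τ a →
    LinearMap.mul' k A (TensorProduct.map (η.toLinearMap ∘ₗ (opLinearEquiv k).toLinearMap ∘ₗ lb.π)
      LinearMap.id (TensorProduct.comm k A H x)) = a
  /-- `a₀ η(l) ⊗ a₁ = a₀ ⊗ a₁ s(l)` -/
  takeuchi : ∀ (l : L) (a : A) (x : A ⊗[k] H), cls _ _ x = τ a →
    cls (fun (l : L) (a : A) => η (op l) * a) (fun (l : L) (h : H) => lb.s l * h)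
        (x * (η (op l) ⊗ₜ[k] 1)) = cls _ _ (x * (1 ⊗ₜ[k] lb.s l))
  τ_one : τ 1 = cls _ _ (1 ⊗ₜ[k] 1)
  τ_mul : ∀ (a a' : A) (x y : A ⊗[k] H), cls _ _ x = τ a → cls _ _ y = τ a' →
    τ (a * a') = cls _ _ (x * y)

/-- A right comodule algebra for a Hopf algebroid: compatible right comodule algebra structures for
both constituent bialgebroids. -/
structure HopfAlgebroid.ComoduleAlgebra {k L R H : Type*} [CommRing k] [Ring L] [Algebra k L]
    [Ring R] [Algebra k R] [Ring H] [Algebra k H] (𝓗 : HopfAlgebroid k L R H)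
    (A : Type*) [Ring A] [Algebra k A] where
  rc : 𝓗.rb.ComoduleAlgebra A
  lc : 𝓗.lb.ComoduleAlgebra A
  /-- `l · a · l' = π_R(t_L(l')) · a · π_R(t_L(l))` -/
  bimod : ∀ (l l' : L) (a : A), lc.η (op l') * a * lc.η (op l) =
    rc.η (𝓗.rb.π (𝓗.lb.t (op l'))) * a * rc.η (𝓗.rb.π (𝓗.lb.t (op l)))
  /-- `(τ_R ⊗ H) ∘ τ_L = (A ⊗ γ_L) ∘ τ_R` in `A ⊗_R H ⊗_L H` -/
  τR_τL : ∀ (a : A) (x y : A ⊗[k] H), cls _ _ x = lc.τ a → cls _ _ y = rc.τ a →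
    expandLeft _ _ (fun (l : L) (h : H) => 𝓗.lb.t (op l) * h)
        (fun (l : L) (h : H) => 𝓗.lb.s l * h) (TensorProduct.map rc.τ LinearMap.id x) =
      expandRight _ _ _ _ (TensorProduct.map LinearMap.id 𝓗.lb.γ y)
  /-- `(τ_L ⊗ H) ∘ τ_R = (A ⊗ γ_R) ∘ τ_L` in `A ⊗_L H ⊗_R H` -/
  τL_τR : ∀ (a : A) (x y : A ⊗[k] H), cls _ _ x = rc.τ a → cls _ _ y = lc.τ a →
    expandLeft _ _ (fun (r : R) (h : H) => h * 𝓗.rb.s r)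
        (fun (r : R) (h : H) => h * 𝓗.rb.t (op r)) (TensorProduct.map lc.τ LinearMap.id x) =
      expandRight _ _ _ _ (TensorProduct.map LinearMap.id 𝓗.rb.γ y)

/-- The tensor product `A ⊗_B A` for a subalgebra `B` of `A`. -/
abbrev TensorOver {k A : Type*} [CommRing k] [Ring A] [Algebra k A] (B : Subalgebra k A) : Type _ :=
  BTensor k (fun (b : B) (a : A) => a * (b : A)) (fun (b : B) (a : A) => (b : A) * a)

/-! ### Coinvariants and the canonical map, for a right bialgebroid -/

namespace RightBialgebroid.ComoduleAlgebra

variable {k R H A : Type*} [CommRing k] [Ring R] [Algebra k R] [Ring H] [Algebra k H]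
  [Ring A] [Algebra k A] {rb : RightBialgebroid k R H} (C : rb.ComoduleAlgebra A)

/-- The tensor product `A ⊗_R H`. -/
abbrev AH : Type _ :=
  BTensor k (fun (r : R) (a : A) => a * C.η r) (fun (r : R) (h : H) => h * rb.t (op r))

/-- The map `A → A ⊗_R H`, `a ↦ a ⊗ 1`. -/
def ι : A →ₗ[k] C.AH := cls _ _ ∘ₗ (TensorProduct.mk k A H).flip 1

/-- The subalgebra of coinvariants `{a | τ(a) = a ⊗ 1}`. -/
def coinv : Subalgebra k A where
  carrier := {a | C.τ a = C.ι a}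
  mul_mem' {a b} ha hb := by
    change C.τ (a * b) = cls _ _ ((a * b) ⊗ₜ[k] 1)
    rw [C.τ_mul a b (a ⊗ₜ[k] 1) (b ⊗ₜ[k] 1) (Eq.symm ha) (Eq.symm hb),
      Algebra.TensorProduct.tmul_mul_tmul, one_mul]
  add_mem' {a b} ha hb := by
    change C.τ (a + b) = C.ι (a + b)
    rw [map_add, map_add, show C.τ a = C.ι a from ha, show C.τ b = C.ι b from hb]
  algebraMap_mem' c := by
    change C.τ (algebraMap k A c) = C.ι (algebraMap k A c)
    rw [Algebra.algebraMap_eq_smul_one, map_smul, map_smul, C.τ_one]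
    rfl

/-- Left multiplication by `a` on the first factor of `A ⊗_R H`. -/
def leftMul : A →ₗ[k] C.AH →ₗ[k] C.AH where
  toFun a := (balancedRel k _ _).mapQ (balancedRel k _ _)
    (LinearMap.mulLeft k (a ⊗ₜ[k] (1 : H))) <| by
      refine Submodule.span_le.2 ?_
      rintro _ ⟨r, b, h, rfl⟩
      refine Submodule.subset_span ⟨r, a * b, h, ?_⟩
      simp [mul_sub, mul_assoc]
  map_add' a b := by
    refine Submodule.linearMap_qext _ (LinearMap.ext fun x => ?_)
    change cls _ _ (((a + b) ⊗ₜ[k] (1 : H)) * x) = cls _ _ ((a ⊗ₜ[k] (1 : H)) * x) + cls _ _ ((b ⊗ₜ[k] (1 : H)) * x)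
    rw [TensorProduct.add_tmul, add_mul, map_add]
  map_smul' c a := by
    refine Submodule.linearMap_qext _ (LinearMap.ext fun x => ?_)
    change cls _ _ (((c • a) ⊗ₜ[k] (1 : H)) * x) = c • cls _ _ ((a ⊗ₜ[k] (1 : H)) * x)
    rw [← TensorProduct.smul_tmul', smul_mul_assoc, map_smul]

/-- The canonical map `A ⊗_B A → A ⊗_R H`, `a ⊗ a' ↦ a a'₀ ⊗ a'₁`, for a subalgebra `B` of
coinvariants. -/
def can (B : Subalgebra k A) (hB : B ≤ C.coinv) : TensorOver B →ₗ[k] C.AH :=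
  (balancedRel k _ _).liftQ (TensorProduct.lift (C.leftMul.compl₂ C.τ)) <| by
    refine Submodule.span_le.2 ?_
    rintro _ ⟨b, a, a', rfl⟩
    obtain ⟨y, hy⟩ := Submodule.mkQ_surjective _ (C.τ a')
    have hb : cls _ _ ((b : A) ⊗ₜ[k] (1 : H)) = C.τ b := Eq.symm (hB b.2)
    simp only [SetLike.mem_coe, LinearMap.mem_ker, map_sub, TensorProduct.lift.tmul,
      LinearMap.compl₂_apply]
    rw [C.τ_mul b a' _ y hb hy, ← hy, sub_eq_zero]
    change cls _ _ (((a * b) ⊗ₜ[k] (1 : H)) * y) =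
      cls _ _ ((a ⊗ₜ[k] (1 : H)) * (((b : A) ⊗ₜ[k] (1 : H)) * y))
    rw [← mul_assoc, Algebra.TensorProduct.tmul_mul_tmul, one_mul]

/-- `B ⊆ A` is a Galois extension for the right bialgebroid: `B` is the subalgebra of coinvariants
and the canonical map is bijective. -/
def IsGalois (B : Subalgebra k A) : Prop :=
  ∃ hB : B = C.coinv, Function.Bijective (C.can B hB.le)

/-- The coinvariants of `A ⊗_k A`, with the coaction
`A ⊗_k τ : A ⊗_k A → A ⊗_k (A ⊗_R H) = (A ⊗_k A) ⊗_R H` on the second factor. -/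
def tensorCoinv : Submodule k (A ⊗[k] A) :=
  LinearMap.eqLocus (C.τ.lTensor A) (C.ι.lTensor A)

end RightBialgebroid.ComoduleAlgebra

/-! ### Coinvariants and the canonical map, for a left bialgebroid -/

namespace LeftBialgebroid.ComoduleAlgebra

variable {k L H A : Type*} [CommRing k] [Ring L] [Algebra k L] [Ring H] [Algebra k H]
  [Ring A] [Algebra k A] {lb : LeftBialgebroid k L H} (C : lb.ComoduleAlgebra A)

/-- The tensor product `A ⊗_L H`. -/
abbrev AH : Type _ :=
  BTensor k (fun (l : L) (a : A) => C.η (op l) * a) (fun (l : L) (h : H) => lb.s l * h)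

/-- The map `A → A ⊗_L H`, `a ↦ a ⊗ 1`. -/
def ι : A →ₗ[k] C.AH := cls _ _ ∘ₗ (TensorProduct.mk k A H).flip 1

/-- The subalgebra of coinvariants `{a | τ(a) = a ⊗ 1}`. -/
def coinv : Subalgebra k A where
  carrier := {a | C.τ a = C.ι a}
  mul_mem' {a b} ha hb := by
    change C.τ (a * b) = cls _ _ ((a * b) ⊗ₜ[k] 1)
    rw [C.τ_mul a b (a ⊗ₜ[k] 1) (b ⊗ₜ[k] 1) (Eq.symm ha) (Eq.symm hb),
      Algebra.TensorProduct.tmul_mul_tmul, one_mul]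
  add_mem' {a b} ha hb := by
    change C.τ (a + b) = C.ι (a + b)
    rw [map_add, map_add, show C.τ a = C.ι a from ha, show C.τ b = C.ι b from hb]
  algebraMap_mem' c := by
    change C.τ (algebraMap k A c) = C.ι (algebraMap k A c)
    rw [Algebra.algebraMap_eq_smul_one, map_smul, map_smul, C.τ_one]
    rfl

/-- Right multiplication by `a` on the first factor of `A ⊗_L H`. -/
def rightMul : A →ₗ[k] C.AH →ₗ[k] C.AH where
  toFun a := (balancedRel k _ _).mapQ (balancedRel k _ _)
    (LinearMap.mulRight k (a ⊗ₜ[k] (1 : H))) <| by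
      refine Submodule.span_le.2 ?_
      rintro _ ⟨l, b, h, rfl⟩
      refine Submodule.subset_span ⟨l, b * a, h, ?_⟩
      simp [sub_mul, mul_assoc]
  map_add' a b := by
    refine Submodule.linearMap_qext _ (LinearMap.ext fun x => ?_)
    change cls _ _ (x * ((a + b) ⊗ₜ[k] (1 : H))) = cls _ _ (x * (a ⊗ₜ[k] (1 : H))) + cls _ _ (x * (b ⊗ₜ[k] (1 : H)))
    rw [TensorProduct.add_tmul, mul_add, map_add]
  map_smul' c a := by
    refine Submodule.linearMap_qext _ (LinearMap.ext fun x => ?_)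
    change cls _ _ (x * ((c • a) ⊗ₜ[k] (1 : H))) = c • cls _ _ (x * (a ⊗ₜ[k] (1 : H)))
    rw [← TensorProduct.smul_tmul', mul_smul_comm, map_smul]

/-- The canonical map `A ⊗_B A → A ⊗_L H`, `a ⊗ a' ↦ a₀ a' ⊗ a₁`, for a subalgebra `B` of
coinvariants. -/
def can (B : Subalgebra k A) (hB : B ≤ C.coinv) : TensorOver B →ₗ[k] C.AH :=
  (balancedRel k _ _).liftQ (TensorProduct.lift (C.rightMul.compl₂ C.τ).flip) <| by
    refine Submodule.span_le.2 ?_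
    rintro _ ⟨b, a, a', rfl⟩
    obtain ⟨x, hx⟩ := Submodule.mkQ_surjective _ (C.τ a)
    have hb : cls _ _ ((b : A) ⊗ₜ[k] (1 : H)) = C.τ b := Eq.symm (hB b.2)
    simp only [SetLike.mem_coe, LinearMap.mem_ker, map_sub, TensorProduct.lift.tmul,
      LinearMap.flip_apply, LinearMap.compl₂_apply]
    rw [C.τ_mul a b x _ hx hb, ← hx, sub_eq_zero]
    change cls _ _ ((x * ((b : A) ⊗ₜ[k] (1 : H))) * (a' ⊗ₜ[k] (1 : H))) =
      cls _ _ (x * ((b * a') ⊗ₜ[k] (1 : H)))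
    rw [mul_assoc, Algebra.TensorProduct.tmul_mul_tmul, one_mul]

/-- `B ⊆ A` is a Galois extension for the left bialgebroid: `B` is the subalgebra of coinvariants
and the canonical map is bijective. -/
def IsGalois (B : Subalgebra k A) : Prop :=
  ∃ hB : B = C.coinv, Function.Bijective (C.can B hB.le)

end LeftBialgebroid.ComoduleAlgebra

namespace HopfAlgebroid.ComoduleAlgebra

variable {k L R H A : Type*} [CommRing k] [Ring L] [Algebra k L] [Ring R] [Algebra k R]
  [Ring H] [Algebra k H] [Ring A] [Algebra k A] {𝓗 : HopfAlgebroid k L R H}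
  (C : 𝓗.ComoduleAlgebra A)

/-- `B ⊆ A` is a Galois extension for the Hopf algebroid: it is one for both constituent
bialgebroids. -/
def IsGalois (B : Subalgebra k A) : Prop :=
  C.rc.IsGalois B ∧ C.lc.IsGalois B

end HopfAlgebroid.ComoduleAlgebra

end

end HopfAlgebroidGalois

/-!
The proof consists of explicit computations with Sweedler sums.  A Sweedler sum `sw x F` runs over a
chosen representative of `x ∈ M ⊗_X N`, and is independent of the choice if `F` is balanced (`Bal`).

*The antipode.*  As for Hopf algebras, `S` is anti-multiplicative (`S_mul`), and it exchanges the
two coproducts up to a flip (`sw_γR_S`, `sw_γL_S`).  Bijectivity of `S` gives the same for `S⁻¹`.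

*Comparison of the two canonical maps.*  The map `a ⊗ h ↦ a₀ ⊗ a₁ S(h)` from `A ⊗_R H` to `A ⊗_L H`
is bijective with inverse `a ⊗ h ↦ a₀ ⊗ S⁻¹(h) a₁`, and carries `can_R` to `can_L`
(`twist_bijective`, `twist_can`).  The coinvariants agree (`coinv_eq`).  So the two
Galois conditions are equivalent, and `can_L` is surjective if `can_R` is.

*Integrals.*  A functional `p : H → R` with `h₁ s_R(p(h₂)) = t_R(p(h))` (`IsIntegral`) gives a map
`T(a) = a₀ η_R(p(a₁))` from `A` to the coinvariants `B` that is linear on both sides over `B`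
(`trace`).  Because `H` is finitely generated and projective, there are many integrals: for a dual
basis `(eᵢ, εᵢ)` of `H` and a functional `g`, the trace-like expression `leftTrace` is one.  If `g`
runs through a second dual basis, they add up to the counit, `∑ⱼ qⱼ(h yⱼ) = π_L(h)`, where `qⱼ` is
the counterpart of the integral `pⱼ` with values in `L` (`exists_integrals_left`); by the mirror
construction there are integrals with `∑ⱼ pⱼ(yⱼ h) = π_R(h)` (`exists_integrals_right`).  This
replaces the structure theorem for Hopf modules over the dual of `H`.

*Dual bases.*  If `can_L` maps `∑ u ⊗ v` to `1 ⊗ yⱼ`, the first family of integrals gives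
`a = ∑ Tⱼ(a u) v`, a dual basis of the left `B`-module `A` (`sum_trace_mul`).  The same formula in
`a ⊗ a' = ∑ a Tⱼ(a' u) ⊗ v` expresses the left-hand side by `can_R(a ⊗ a')`, whence `can_R` is
injective as soon as it is surjective (`can_injective`).  The second family and `can_R` give
a dual basis of the right `B`-module `A` (`sum_mul_trace`).
-/

namespace HopfAlgebroidGalois

noncomputable section

/-! ### Sweedler sums -/

section Sweedler

variable {k : Type*} [CommRing k] {X M N V W : Type*} [AddCommGroup M] [Module k M]
  [AddCommGroup N] [Module k N] [AddCommGroup V] [AddCommGroup W]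
  {act : X → M → M} {act' : X → N → N}

lemma exists_rep (x : BTensor k act act') :
    ∃ s : Finset (M × N), cls act act' (∑ i ∈ s, i.1 ⊗ₜ[k] i.2) = x := by
  obtain ⟨z, rfl⟩ := Submodule.mkQ_surjective _ x
  obtain ⟨s, rfl⟩ := TensorProduct.exists_finset z
  exact ⟨s, rfl⟩

/-- A chosen finite family of pairs `(m, n)` such that the given element of `M ⊗_X N` is the sum of
the `m ⊗ n`. -/
def rep (x : BTensor k act act') : Finset (M × N) := (exists_rep x).choose

/-- The chosen representative in `M ⊗_k N` of an element of `M ⊗_X N`. -/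
def repT (x : BTensor k act act') : M ⊗[k] N := ∑ i ∈ rep x, i.1 ⊗ₜ[k] i.2

@[simp] lemma cls_repT (x : BTensor k act act') : cls act act' (repT x) = x :=
  (exists_rep x).choose_spec

/-- The Sweedler sum `∑ F(m, n)` over the chosen representative `∑ m ⊗ n` of an element of
`M ⊗_X N`.  It is defined for arbitrary `F`, and does not depend on the choice if `F` is
balanced. -/
def sw (x : BTensor k act act') (F : M → N → V) : V := ∑ i ∈ rep x, F i.1 i.2

lemma sw_fun_add (x : BTensor k act act') (F G : M → N → V) :
    sw x (fun m n => F m n + G m n) = sw x F + sw x G := Finset.sum_add_distrib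

lemma map_sw {Z : Type*} [FunLike Z V W] [AddMonoidHomClass Z V W] (φ : Z)
    (x : BTensor k act act') (F : M → N → V) :
    φ (sw x F) = sw x (fun m n => φ (F m n)) := map_sum φ _ _

lemma sw_fun_sum {ι : Type*} (s : Finset ι) (x : BTensor k act act') (F : ι → M → N → V) :
    sw x (fun m n => ∑ i ∈ s, F i m n) = ∑ i ∈ s, sw x (F i) := Finset.sum_comm

lemma sw_comm {X' M' N' : Type*} [AddCommGroup M'] [Module k M'] [AddCommGroup N'] [Module k N']
    {bct : X' → M' → M'} {bct' : X' → N' → N'} (x : BTensor k act act') (y : BTensor k bct bct')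
    (F : M → N → M' → N' → V) :
    sw x (fun m n => sw y (fun m' n' => F m n m' n')) =
      sw y (fun m' n' => sw x (fun m n => F m n m' n')) := Finset.sum_comm

lemma mul_sw {E : Type*} [Ring E] (a : E) (x : BTensor k act act') (F : M → N → E) :
    a * sw x F = sw x (fun m n => a * F m n) := Finset.mul_sum _ _ _

lemma sw_mul {E : Type*} [Ring E] (a : E) (x : BTensor k act act') (F : M → N → E) :
    sw x F * a = sw x (fun m n => F m n * a) := Finset.sum_mul _ _ _

end Sweedler

section Balanced

variable {k : Type*} [CommRing k] {X Y M N P V W : Type*} [AddCommGroup M] [Module k M]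
  [AddCommGroup N] [Module k N] [AddCommGroup P] [Module k P] [AddCommGroup V] [Module k V]
  [AddCommGroup W] [Module k W]

/-- `F : M → N → V` is `k`-bilinear and `X`-balanced, so that it factors through `M ⊗_X N`. -/
structure Bal (k : Type*) [CommRing k] {X M N V : Type*} [AddCommGroup M] [Module k M]
    [AddCommGroup N] [Module k N] [AddCommGroup V] [Module k V]
    (act : X → M → M) (act' : X → N → N) (F : M → N → V) : Prop where
  add_left : ∀ m m' n, F (m + m') n = F m n + F m' n
  add_right : ∀ m n n', F m (n + n') = F m n + F m n'
  smul_left : ∀ (c : k) m n, F (c • m) n = c • F m n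
  smul_right : ∀ (c : k) m n, F m (c • n) = c • F m n
  bal : ∀ x m n, F (act x m) n = F m (act' x n)

variable {act : X → M → M} {act' : X → N → N}

/-- The map on `M ⊗_X N` induced by a balanced map. -/
def Bal.lift {F : M → N → V} (hF : Bal k act act' F) : BTensor k act act' →ₗ[k] V :=
  (balancedRel k act act').liftQ
    (TensorProduct.lift
      (LinearMap.mk₂ k F hF.add_left hF.smul_left hF.add_right hF.smul_right)) <| by
      refine Submodule.span_le.2 ?_
      rintro _ ⟨x, m, n, rfl⟩
      simp [hF.bal]

@[simp] lemma Bal.lift_cls_tmul {F : M → N → V} (hF : Bal k act act' F) (m : M) (n : N) :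
    hF.lift (cls act act' (m ⊗ₜ[k] n)) = F m n := rfl

lemma sw_eq_lift {F : M → N → V} (hF : Bal k act act' F) (x : BTensor k act act') :
    sw x F = hF.lift x := by
  conv_rhs => rw [← cls_repT x, repT, map_sum, map_sum]
  rfl

lemma sw_cls_tmul {F : M → N → V} (hF : Bal k act act' F) (m : M) (n : N) :
    sw (cls act act' (m ⊗ₜ[k] n)) F = F m n := by
  rw [sw_eq_lift hF, hF.lift_cls_tmul]

lemma sw_add {F : M → N → V} (hF : Bal k act act' F) (x y : BTensor k act act') :
    sw (x + y) F = sw x F + sw y F := by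
  simp only [sw_eq_lift hF, map_add]

lemma sw_smul {F : M → N → V} (hF : Bal k act act' F) (c : k) (x : BTensor k act act') :
    sw (c • x) F = c • sw x F := by
  simp only [sw_eq_lift hF, map_smul]

lemma sw_fun_smul (x : BTensor k act act') (c : k) (F : M → N → V) :
    sw x (fun m n => c • F m n) = c • sw x F := Finset.smul_sum.symm

/-- `∑ m ⊗ n` recovers the element. -/
lemma sw_cls (x : BTensor k act act') : sw x (fun m n => cls act act' (m ⊗ₜ[k] n)) = x := by
  conv_rhs => rw [← cls_repT x, repT, map_sum]
  rfl

lemma btensor_hom_ext {f g : BTensor k act act' →ₗ[k] V}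
    (h : ∀ m n, f (cls act act' (m ⊗ₜ[k] n)) = g (cls act act' (m ⊗ₜ[k] n))) : f = g :=
  Submodule.linearMap_qext _ (TensorProduct.ext' h)

lemma bal_cls : Bal k act act' (fun m n => cls act act' (m ⊗ₜ[k] n)) where
  add_left m m' n := by rw [TensorProduct.add_tmul, map_add]
  add_right m n n' := by rw [TensorProduct.tmul_add, map_add]
  smul_left c m n := by rw [← TensorProduct.smul_tmul', map_smul]
  smul_right c m n := by rw [TensorProduct.tmul_smul, map_smul]
  bal x m n := by
    rw [← sub_eq_zero, ← map_sub]
    exact (Submodule.Quotient.mk_eq_zero _).2 (Submodule.subset_span ⟨x, m, n, rfl⟩)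

lemma Bal.map {F : M → N → V} (hF : Bal k act act' F) (φ : V →ₗ[k] W) :
    Bal k act act' (fun m n => φ (F m n)) where
  add_left m m' n := by rw [hF.add_left, map_add]
  add_right m n n' := by rw [hF.add_right, map_add]
  smul_left c m n := by rw [hF.smul_left, map_smul]
  smul_right c m n := by rw [hF.smul_right, map_smul]
  bal x m n := by rw [hF.bal]

lemma Bal.sw {X' M' N' : Type*} [AddCommGroup M'] [Module k M'] [AddCommGroup N'] [Module k N']
    {bct : X' → M' → M'} {bct' : X' → N' → N'} (y : BTensor k bct bct')
    {F : M' → N' → M → N → V} (hF : ∀ m' n', Bal k act act' (F m' n')) :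
    Bal k act act' (fun m n => sw y (fun m' n' => F m' n' m n)) where
  add_left m m' n := by simp only [(hF _ _).add_left, sw_fun_add]
  add_right m n n' := by simp only [(hF _ _).add_right, sw_fun_add]
  smul_left c m n := by simp only [(hF _ _).smul_left, sw_fun_smul]
  smul_right c m n := by simp only [(hF _ _).smul_right, sw_fun_smul]
  bal x m n := by simp only [(hF _ _).bal]

lemma Bal.sum {ι : Type*} (s : Finset ι) {F : ι → M → N → V} (hF : ∀ i, Bal k act act' (F i)) :
    Bal k act act' (fun m n => ∑ i ∈ s, F i m n) where
  add_left m m' n := by simp only [(hF _).add_left, Finset.sum_add_distrib]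
  add_right m n n' := by simp only [(hF _).add_right, Finset.sum_add_distrib]
  smul_left c m n := by simp only [(hF _).smul_left, Finset.smul_sum]
  smul_right c m n := by simp only [(hF _).smul_right, Finset.smul_sum]
  bal x m n := by simp only [(hF _).bal]

lemma Bal.apply_sum_right {ι : Type*} {F : M → N → V} (hF : Bal k act act' F) (m : M)
    (s : Finset ι) (f : ι → N) : F m (∑ i ∈ s, f i) = ∑ i ∈ s, F m (f i) :=
  map_sum (AddMonoidHom.mk' (fun n => F m n) (fun n n' => hF.add_right m n n')) f s

section

variable {X' M' N' : Type*} [AddCommGroup M'] [Module k M'] [AddCommGroup N'] [Module k N']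
    {bct : X' → M' → M'} {bct' : X' → N' → N'} {F : M → N → V}

lemma Bal.apply_sw_left (hF : Bal k act act' F) (x : BTensor k bct bct') (G : M' → N' → M) (n : N) :
    F (HopfAlgebroidGalois.sw x G) n = HopfAlgebroidGalois.sw x (fun a b => F (G a b) n) :=
  map_sw (AddMonoidHom.mk' (fun m => F m n) (fun m m' => hF.add_left m m' n)) x G

lemma Bal.apply_sw_right (hF : Bal k act act' F) (m : M) (x : BTensor k bct bct')
    (G : M' → N' → N) :
    F m (HopfAlgebroidGalois.sw x G) = HopfAlgebroidGalois.sw x (fun a b => F m (G a b)) :=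
  map_sw (AddMonoidHom.mk' (fun n => F m n) (fun n n' => hF.add_right m n n')) x G

end

variable {bct : Y → N → N} {bct' : Y → P → P}

/-- `G : M → N → P → V` is trilinear and balanced over `X` and `Y`, so that it factors through
`M ⊗_X N ⊗_Y P`. -/
structure Tri (k : Type*) [CommRing k] {X Y M N P V : Type*} [AddCommGroup M] [Module k M]
    [AddCommGroup N] [Module k N] [AddCommGroup P] [Module k P] [AddCommGroup V] [Module k V]
    (act : X → M → M) (act' : X → N → N) (bct : Y → N → N) (bct' : Y → P → P)
    (G : M → N → P → V) : Prop where
  left : ∀ p, Bal k act act' (fun m n => G m n p)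
  right : ∀ m, Bal k bct bct' (G m)

/-- The map on `M ⊗_X N ⊗_Y P` induced by a balanced trilinear map. -/
def Tri.lift {G : M → N → P → V} (hG : Tri k act act' bct bct' G) :
    BTensor₃ k act act' bct bct' →ₗ[k] V :=
  (balancedRel₃ k act act' bct bct').liftQ
    (TensorProduct.lift (TensorProduct.lift
      (LinearMap.mk₂ k
        (fun m n => ({ toFun := G m n
                       map_add' := (hG.right m).add_right n
                       map_smul' := fun c p => (hG.right m).smul_right c n p } : P →ₗ[k] V))
        (fun m m' n => LinearMap.ext fun p => (hG.left p).add_left m m' n)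
        (fun c m n => LinearMap.ext fun p => (hG.left p).smul_left c m n)
        (fun m n n' => LinearMap.ext fun p => (hG.left p).add_right m n n')
        (fun c m n => LinearMap.ext fun p => (hG.left p).smul_right c m n)))) <| by
      refine Submodule.span_le.2 ?_
      rintro _ (⟨x, m, n, p, rfl⟩ | ⟨y, m, n, p, rfl⟩)
      · simp [(hG.left p).bal]
      · simp [(hG.right m).bal]

lemma Tri.lift_expandLeft {G : M → N → P → V} (hG : Tri k act act' bct bct' G)
    (t : BTensor k act act') (p : P) :
    hG.lift (expandLeft act act' bct bct' (t ⊗ₜ[k] p)) = sw t (fun m n => G m n p) := by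
  conv_lhs => rw [← cls_repT t, repT]
  simp only [map_sum, TensorProduct.sum_tmul]
  rfl

lemma Tri.lift_expandRight {G : M → N → P → V} (hG : Tri k act act' bct bct' G)
    (m : M) (t : BTensor k bct bct') :
    hG.lift (expandRight act act' bct bct' (m ⊗ₜ[k] t)) = sw t (fun n p => G m n p) := by
  conv_lhs => rw [← cls_repT t, repT]
  simp only [map_sum, TensorProduct.tmul_sum]
  rfl

/-- Mixed coassociativity in terms of Sweedler sums: if `(f ⊗ P)(x) = (M ⊗ g)(y)` in
`M ⊗_X N ⊗_Y P`, then balanced trilinear sums agree. -/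
lemma Tri.sw_coassoc {X' Y' M' P' : Type*} [AddCommGroup M'] [Module k M'] [AddCommGroup P']
    [Module k P'] {cct : X' → M' → M'} {cct' : X' → P → P} {dct : Y' → M → M} {dct' : Y' → P' → P'}
    {G : M → N → P → V} (hG : Tri k act act' bct bct' G)
    (f : M' →ₗ[k] BTensor k act act') (g : P' →ₗ[k] BTensor k bct bct')
    (x : BTensor k cct cct') (y : BTensor k dct dct')
    (h : expandLeft act act' bct bct' (TensorProduct.map f LinearMap.id (repT x)) =
      expandRight act act' bct bct' (TensorProduct.map LinearMap.id g (repT y))) :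
    sw x (fun m p => sw (f m) (fun a b => G a b p)) =
      sw y (fun m p => sw (g p) (fun a b => G m a b)) := by
  have := congrArg hG.lift h
  simp only [repT, map_sum, TensorProduct.map_tmul, LinearMap.id_apply, hG.lift_expandLeft,
    hG.lift_expandRight] at this
  exact this

section Algebra

variable {E E' : Type*} [Ring E] [Algebra k E] [Ring E'] [Algebra k E']
  {act : X → E → E} {act' : X → E' → E'} {F : E → E' → V}

lemma sw_cls_repT_mul_repT {Y Z : Type*} {bct : Y → E → E} {bct' : Y → E' → E'} {cct : Z → E → E}
    {cct' : Z → E' → E'} (hF : Bal k act act' F) (u : BTensor k bct bct') (v : BTensor k cct cct') :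
    sw (cls act act' (repT u * repT v)) F =
      sw u (fun a b => sw v (fun a' b' => F (a * a') (b * b'))) := by
  simp only [sw_eq_lift hF, repT, Finset.sum_mul_sum, map_sum,
    Algebra.TensorProduct.tmul_mul_tmul, hF.lift_cls_tmul]
  rfl

lemma sw_cls_repT_mul {Y : Type*} {bct : Y → E → E} {bct' : Y → E' → E'}
    (hF : Bal k act act' F) (u : BTensor k bct bct') (c : E) (d : E') :
    sw (cls act act' (repT u * c ⊗ₜ[k] d)) F = sw u (fun a b => F (a * c) (b * d)) := by
  simp only [sw_eq_lift hF, repT, Finset.sum_mul, map_sum,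
    Algebra.TensorProduct.tmul_mul_tmul, hF.lift_cls_tmul]
  rfl

lemma sw_cls_mul_repT {Y : Type*} {bct : Y → E → E} {bct' : Y → E' → E'}
    (hF : Bal k act act' F) (u : BTensor k bct bct') (c : E) (d : E') :
    sw (cls act act' (c ⊗ₜ[k] d * repT u)) F = sw u (fun a b => F (c * a) (d * b)) := by
  simp only [sw_eq_lift hF, repT, Finset.mul_sum, map_sum,
    Algebra.TensorProduct.tmul_mul_tmul, hF.lift_cls_tmul]
  rfl

end Algebra

end Balanced

/-! ### Finite dual bases -/

section DualBasis

/-- A finitely generated projective module has a finite dual basis. -/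
lemma exists_finite_dualBasis {X M : Type*} [Ring X] [AddCommGroup M] [Module X M]
    (hfin : Module.Finite X M) (hproj : Module.Projective X M) :
    ∃ (n : ℕ) (e : Fin n → M) (f : Fin n → M →ₗ[X] X), ∀ m, ∑ i, f i m • e i = m := by
  obtain ⟨n, f, g, -, -, h⟩ := Module.Finite.exists_comp_eq_id_of_projective X M
  refine ⟨n, fun i => f (Pi.single i 1), fun i => LinearMap.proj i ∘ₗ g, fun m => ?_⟩
  have h1 : f (g m) = m := LinearMap.congr_fun h m
  conv_rhs => rw [← h1, ← Finset.univ_sum_single (g m), map_sum]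
  refine Finset.sum_congr rfl fun i _ => ?_
  simp only [LinearMap.comp_apply, LinearMap.proj_apply, ← map_smul]
  congr 1
  ext j
  by_cases hj : j = i
  · subst hj; simp
  · simp [hj]

/-- The dual basis of a finitely generated projective module in `FGProjectiveVia`, with `k`-linear
coordinate functionals. -/
lemma FGProjectiveVia.exists_dualBasis {k X E M : Type*} [CommRing k] [Ring X] [Algebra k X]
    [Ring E] [Algebra k E] [AddCommGroup M] [Module k M] [Module E M] [IsScalarTower k E M]
    {f : X →ₐ[k] E} (h : FGProjectiveVia M f.toRingHom) :
    ∃ (n : ℕ) (e : Fin n → M) (φ : Fin n → M →ₗ[k] X),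
      (∀ i x m, φ i (f x • m) = x * φ i m) ∧ ∀ m, ∑ i, f (φ i m) • e i = m := by
  let _ : Module X M := Module.compHom M f.toRingHom
  obtain ⟨n, e, φ, hφ⟩ := exists_finite_dualBasis (X := X) (M := M) h.1 h.2
  refine ⟨n, e, fun i => { toFun := φ i, map_add' := map_add (φ i), map_smul' := fun c m => ?_ },
    fun i x m => map_smul (φ i) x m, hφ⟩
  have h1 : c • m = (algebraMap k X c) • m := by
    change c • m = f (algebraMap k X c) • m
    rw [AlgHom.commutes, algebraMap_smul]
  rw [h1, map_smul, smul_eq_mul, RingHom.id_apply, Algebra.smul_def]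

/-- A module with a finite dual basis is projective. -/
lemma projective_of_dualBasis {X M ι : Type*} [Ring X] [AddCommGroup M] [Module X M] [Fintype ι]
    (e : ι → M) (f : ι → M →ₗ[X] X) (h : ∀ m, ∑ i, f i m • e i = m) : Module.Projective X M := by
  classical
  refine Module.Projective.of_split (LinearMap.pi f)
    (Fintype.linearCombination X e) ?_
  ext m
  simpa [Fintype.linearCombination_apply] using h m

end DualBasis

/-! ### Bialgebroids in terms of Sweedler sums -/

namespace LeftBialgebroid

variable {k L H V : Type*} [CommRing k] [Ring L] [Algebra k L] [Ring H] [Algebra k H]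
  [AddCommGroup V] [Module k V] (lb : LeftBialgebroid k L H)

/-- `F : H → H → V` is bilinear and balanced for the tensor product `H ⊗_L H`. -/
abbrev IsBal (F : H → H → V) : Prop :=
  Bal k (fun (l : L) (h : H) => lb.t (op l) * h) (fun (l : L) (h : H) => lb.s l * h) F

variable {lb} {F : H → H → V}

lemma sw_mul_of_eq_right (hF : lb.IsBal F) {g u v : H} (hg : lb.γ g = cls _ _ (u ⊗ₜ[k] v))
    (h : H) : sw (lb.γ (h * g)) F = sw (lb.γ h) (fun a b => F (a * u) (b * v)) := by
  rw [lb.γ_mul h g _ _ (cls_repT _) hg.symm, sw_cls_repT_mul hF]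

lemma sw_mul_of_eq_left (hF : lb.IsBal F) {g u v : H} (hg : lb.γ g = cls _ _ (u ⊗ₜ[k] v))
    (h : H) : sw (lb.γ (g * h)) F = sw (lb.γ h) (fun a b => F (u * a) (v * b)) := by
  rw [lb.γ_mul g h _ _ hg.symm (cls_repT _), sw_cls_mul_repT hF]

lemma sw_γ_mul (hF : lb.IsBal F) (g h : H) : sw (lb.γ (g * h)) F =
    sw (lb.γ g) (fun a b => sw (lb.γ h) (fun a' b' => F (a * a') (b * b'))) := by
  rw [lb.γ_mul g h _ _ (cls_repT _) (cls_repT _), sw_cls_repT_mul_repT hF]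

variable (lb) in
lemma γ_s (l : L) : lb.γ (lb.s l) = cls _ _ (lb.s l ⊗ₜ[k] 1) := by
  have := lb.γ_bimod l 1 1 _ lb.γ_one.symm
  simpa using this

variable (lb) in
lemma γ_t (l : L) : lb.γ (lb.t (op l)) = cls _ _ (1 ⊗ₜ[k] lb.t (op l)) := by
  have := lb.γ_bimod 1 l 1 _ lb.γ_one.symm
  simpa using this

/-- The Takeuchi condition `h₁ t(l) ⊗ h₂ = h₁ ⊗ h₂ s(l)`. -/
lemma sw_takeuchi (hF : lb.IsBal F) (h : H) (l : L) :
    sw (lb.γ h) (fun a b => F (a * lb.t (op l)) b) = sw (lb.γ h) (fun a b => F a (b * lb.s l)) := by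
  have := congrArg hF.lift (lb.takeuchi l h _ (cls_repT _))
  rw [← sw_eq_lift, ← sw_eq_lift, sw_cls_repT_mul hF, sw_cls_repT_mul hF] at this
  simpa using this

variable (lb)

lemma sw_counit_left (h : H) : sw (lb.γ h) (fun a b => lb.s (lb.π a) * b) = h := by
  have := lb.counit_left h _ (cls_repT _)
  simp only [repT, map_sum, TensorProduct.map_tmul, LinearMap.mul'_apply] at this
  exact this

lemma sw_counit_right (h : H) : sw (lb.γ h) (fun a b => lb.t (op (lb.π b)) * a) = h := by
  have := lb.counit_right h _ (cls_repT _)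
  simp only [repT, map_sum, TensorProduct.map_tmul, LinearMap.mul'_apply,
    TensorProduct.comm_tmul] at this
  exact this

lemma π_s_mul' (l : L) (h : H) : lb.π (lb.s l * h) = l * lb.π h := by
  simpa using lb.π_bimod l 1 h

lemma π_s (l : L) : lb.π (lb.s l) = l := by
  simpa [lb.π_one] using lb.π_s_mul' l 1

/-- `π (h s(l)) = π (h t(l))` -/
lemma π_mul_s_eq (l : L) (h : H) : lb.π (h * lb.s l) = lb.π (h * lb.t (op l)) := by
  have h1 := lb.π_mul_t h (lb.s l)
  rw [lb.π_s] at h1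
  exact h1.symm

lemma s_injective : Function.Injective lb.s := Function.LeftInverse.injective lb.π_s

end LeftBialgebroid

namespace RightBialgebroid

variable {k R H V : Type*} [CommRing k] [Ring R] [Algebra k R] [Ring H] [Algebra k H]
  [AddCommGroup V] [Module k V] (rb : RightBialgebroid k R H)

/-- `F : H → H → V` is bilinear and balanced for the tensor product `H ⊗_R H`. -/
abbrev IsBal (F : H → H → V) : Prop :=
  Bal k (fun (r : R) (h : H) => h * rb.s r) (fun (r : R) (h : H) => h * rb.t (op r)) F

variable {rb} {F : H → H → V}

lemma sw_mul_of_eq_right (hF : rb.IsBal F) {g u v : H} (hg : rb.γ g = cls _ _ (u ⊗ₜ[k] v))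
    (h : H) : sw (rb.γ (h * g)) F = sw (rb.γ h) (fun a b => F (a * u) (b * v)) := by
  rw [rb.γ_mul h g _ _ (cls_repT _) hg.symm, sw_cls_repT_mul hF]

lemma sw_mul_of_eq_left (hF : rb.IsBal F) {g u v : H} (hg : rb.γ g = cls _ _ (u ⊗ₜ[k] v))
    (h : H) : sw (rb.γ (g * h)) F = sw (rb.γ h) (fun a b => F (u * a) (v * b)) := by
  rw [rb.γ_mul g h _ _ hg.symm (cls_repT _), sw_cls_mul_repT hF]

lemma sw_γ_mul (hF : rb.IsBal F) (g h : H) : sw (rb.γ (g * h)) F =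
    sw (rb.γ g) (fun a b => sw (rb.γ h) (fun a' b' => F (a * a') (b * b'))) := by
  rw [rb.γ_mul g h _ _ (cls_repT _) (cls_repT _), sw_cls_repT_mul_repT hF]

variable (rb) in
lemma γ_s (r : R) : rb.γ (rb.s r) = cls _ _ (1 ⊗ₜ[k] rb.s r) := by
  have := rb.γ_bimod 1 r 1 _ rb.γ_one.symm
  simpa using this

variable (rb) in
lemma γ_t (r : R) : rb.γ (rb.t (op r)) = cls _ _ (rb.t (op r) ⊗ₜ[k] 1) := by
  have := rb.γ_bimod r 1 1 _ rb.γ_one.symm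
  simpa using this

/-- The Takeuchi condition `s(r) h₁ ⊗ h₂ = h₁ ⊗ t(r) h₂`. -/
lemma sw_takeuchi (hF : rb.IsBal F) (h : H) (r : R) :
    sw (rb.γ h) (fun a b => F (rb.s r * a) b) = sw (rb.γ h) (fun a b => F a (rb.t (op r) * b)) := by
  have := congrArg hF.lift (rb.takeuchi r h _ (cls_repT _))
  rw [← sw_eq_lift, ← sw_eq_lift, sw_cls_mul_repT hF, sw_cls_mul_repT hF] at this
  simpa using this

variable (rb)

lemma sw_counit_left (h : H) : sw (rb.γ h) (fun a b => b * rb.t (op (rb.π a))) = h := by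
  have := rb.counit_left h _ (cls_repT _)
  simp only [repT, map_sum, TensorProduct.map_tmul, LinearMap.mul'_apply,
    TensorProduct.comm_tmul] at this
  exact this

lemma sw_counit_right (h : H) : sw (rb.γ h) (fun a b => a * rb.s (rb.π b)) = h := by
  have := rb.counit_right h _ (cls_repT _)
  simp only [repT, map_sum, TensorProduct.map_tmul, LinearMap.mul'_apply] at this
  exact this

lemma π_mul_s' (r : R) (h : H) : rb.π (h * rb.s r) = rb.π h * r := by
  simpa using rb.π_bimod 1 r h

lemma π_mul_t' (r : R) (h : H) : rb.π (h * rb.t (op r)) = r * rb.π h := by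
  simpa using rb.π_bimod r 1 h

lemma π_s (r : R) : rb.π (rb.s r) = r := by
  simpa [rb.π_one] using rb.π_mul_s' r 1

lemma π_t (r : R) : rb.π (rb.t (op r)) = r := by
  simpa [rb.π_one] using rb.π_mul_t' r 1

/-- `π (s(r) h) = π (t(r) h)` -/
lemma π_s_mul_eq (r : R) (h : H) : rb.π (rb.s r * h) = rb.π (rb.t (op r) * h) := by
  have h1 := rb.π_t_mul (rb.s r) h
  rw [rb.π_s] at h1
  exact h1.symm

lemma t_op_injective {r r' : R} (h : rb.t (op r) = rb.t (op r')) : r = r' := by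
  rw [← rb.π_t r, h, rb.π_t]

end RightBialgebroid

/-! ### Base algebras of a Hopf algebroid -/

namespace HopfAlgebroid

variable {k L R H V : Type*} [CommRing k] [Ring L] [Algebra k L] [Ring R] [Algebra k R]
  [Ring H] [Algebra k H] [AddCommGroup V] [Module k V] (𝓗 : HopfAlgebroid k L R H)

lemma γL_tR (r : R) : 𝓗.lb.γ (𝓗.rb.t (op r)) = cls _ _ (𝓗.rb.t (op r) ⊗ₜ[k] 1) := by
  rw [← 𝓗.sL_πL_tR]; exact 𝓗.lb.γ_s _

lemma γL_sR (r : R) : 𝓗.lb.γ (𝓗.rb.s r) = cls _ _ (1 ⊗ₜ[k] 𝓗.rb.s r) := by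
  rw [← 𝓗.tL_πL_sR]; exact 𝓗.lb.γ_t _

lemma γR_tL (l : L) : 𝓗.rb.γ (𝓗.lb.t (op l)) = cls _ _ (1 ⊗ₜ[k] 𝓗.lb.t (op l)) := by
  rw [← 𝓗.sR_πR_tL]; exact 𝓗.rb.γ_s _

lemma γR_sL (l : L) : 𝓗.rb.γ (𝓗.lb.s l) = cls _ _ (𝓗.lb.s l ⊗ₜ[k] 1) := by
  rw [← 𝓗.tR_πR_sL]; exact 𝓗.rb.γ_t _

/-- The images of `s_L` and `s_R` commute. -/
lemma sL_sR_comm (l : L) (r : R) : 𝓗.lb.s l * 𝓗.rb.s r = 𝓗.rb.s r * 𝓗.lb.s l := by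
  rw [← 𝓗.tL_πL_sR, 𝓗.lb.st_comm]

/-- The images of `t_L` and `t_R` commute. -/
lemma tL_tR_comm (l : L) (r : R) :
    𝓗.lb.t (op l) * 𝓗.rb.t (op r) = 𝓗.rb.t (op r) * 𝓗.lb.t (op l) := by
  rw [← 𝓗.sL_πL_tR, 𝓗.lb.st_comm]

lemma S_tL_mul (l : L) (h : H) : 𝓗.S (𝓗.lb.t (op l) * h) = 𝓗.S h * 𝓗.lb.s l := by
  simpa using 𝓗.S_bimod_L 1 l h

lemma S_mul_tL (l : L) (h : H) : 𝓗.S (h * 𝓗.lb.t (op l)) = 𝓗.lb.s l * 𝓗.S h := by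
  simpa using 𝓗.S_bimod_L l 1 h

lemma S_tR_mul (r : R) (h : H) : 𝓗.S (𝓗.rb.t (op r) * h) = 𝓗.S h * 𝓗.rb.s r := by
  simpa using 𝓗.S_bimod_R 1 r h

lemma S_mul_tR (r : R) (h : H) : 𝓗.S (h * 𝓗.rb.t (op r)) = 𝓗.rb.s r * 𝓗.S h := by
  simpa using 𝓗.S_bimod_R r 1 h

lemma sw_S_left (h : H) : sw (𝓗.lb.γ h) (fun a b => 𝓗.S a * b) = 𝓗.rb.s (𝓗.rb.π h) := by
  have := 𝓗.S_left h _ (cls_repT _)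
  simp only [repT, map_sum, TensorProduct.map_tmul, LinearMap.mul'_apply] at this
  exact this

lemma sw_S_right (h : H) : sw (𝓗.rb.γ h) (fun a b => a * 𝓗.S b) = 𝓗.lb.s (𝓗.lb.π h) := by
  have := 𝓗.S_right h _ (cls_repT _)
  simp only [repT, map_sum, TensorProduct.map_tmul, LinearMap.mul'_apply] at this
  exact this

/-- `G : H → H → H → V` is balanced for `H ⊗_L H ⊗_R H`. -/
abbrev IsTriLR (G : H → H → H → V) : Prop :=
  Tri k (fun (l : L) (h : H) => 𝓗.lb.t (op l) * h) (fun (l : L) (h : H) => 𝓗.lb.s l * h)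
    (fun (r : R) (h : H) => h * 𝓗.rb.s r) (fun (r : R) (h : H) => h * 𝓗.rb.t (op r)) G

/-- `G : H → H → H → V` is balanced for `H ⊗_R H ⊗_L H`. -/
abbrev IsTriRL (G : H → H → H → V) : Prop :=
  Tri k (fun (r : R) (h : H) => h * 𝓗.rb.s r) (fun (r : R) (h : H) => h * 𝓗.rb.t (op r))
    (fun (l : L) (h : H) => 𝓗.lb.t (op l) * h) (fun (l : L) (h : H) => 𝓗.lb.s l * h) G

variable {𝓗}

/-- `(γ_L ⊗ H) γ_R = (H ⊗ γ_R) γ_L` for Sweedler sums. -/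
lemma sw_LR {G : H → H → H → V} (hG : 𝓗.IsTriLR G) (h : H) :
    sw (𝓗.rb.γ h) (fun x c => sw (𝓗.lb.γ x) (fun a b => G a b c)) =
      sw (𝓗.lb.γ h) (fun a y => sw (𝓗.rb.γ y) (fun b c => G a b c)) :=
  hG.sw_coassoc _ _ _ _ (𝓗.γL_γR h _ _ (cls_repT _) (cls_repT _))

/-- `(γ_R ⊗ H) γ_L = (H ⊗ γ_L) γ_R` for Sweedler sums. -/
lemma sw_RL {G : H → H → H → V} (hG : 𝓗.IsTriRL G) (h : H) :
    sw (𝓗.lb.γ h) (fun x c => sw (𝓗.rb.γ x) (fun a b => G a b c)) =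
      sw (𝓗.rb.γ h) (fun a y => sw (𝓗.lb.γ y) (fun b c => G a b c)) :=
  hG.sw_coassoc _ _ _ _ (𝓗.γR_γL h _ _ (cls_repT _) (cls_repT _))

end HopfAlgebroid

/-! ### The antipode is anti-multiplicative -/

namespace HopfAlgebroid

variable {k L R H V : Type*} [CommRing k] [Ring L] [Algebra k L] [Ring R] [Algebra k R]
  [Ring H] [Algebra k H] [AddCommGroup V] [Module k V] (𝓗 : HopfAlgebroid k L R H)

lemma S_one : 𝓗.S 1 = 1 := by
  have h := 𝓗.sw_S_left 1
  have hF : 𝓗.lb.IsBal (fun a b => 𝓗.S a * b) := by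
    constructor <;> intros <;> simp [mul_add, add_mul, mul_assoc, S_tL_mul]
  rw [𝓗.lb.γ_one, sw_cls_tmul hF, 𝓗.rb.π_one] at h
  simpa using h

lemma S_tL (l : L) : 𝓗.S (𝓗.lb.t (op l)) = 𝓗.lb.s l := by
  simpa [S_one] using 𝓗.S_tL_mul l 1

lemma S_tR (r : R) : 𝓗.S (𝓗.rb.t (op r)) = 𝓗.rb.s r := by
  simpa [S_one] using 𝓗.S_tR_mul r 1

/-- `S(h₁ g) h₂ = S(g) s_R(π_R(h))`, for the coproduct of the left bialgebroid.  This is shown by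
computing `S(h₁ g₁) h₂ g₂ S(g₃)` in two ways, with the second coproduct of `g` from the right
bialgebroid. -/
lemma sw_S_mul_right (g h : H) : sw (𝓗.lb.γ h) (fun a b => 𝓗.S (a * g) * b) =
    𝓗.S g * 𝓗.rb.s (𝓗.rb.π h) := by
  have hF : ∀ c e, 𝓗.lb.IsBal (fun a b => 𝓗.S (a * c) * b * e) := fun c e => by
    constructor <;> intros <;> simp [mul_add, add_mul, mul_assoc, S_tL_mul]
  have hG : 𝓗.IsTriLR (fun c d f => sw (𝓗.lb.γ h) (fun a b => 𝓗.S (a * c) * b * (d * 𝓗.S f))) := by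
    refine ⟨fun f => ?_, fun c => Bal.sw _ fun a b => ?_⟩
    · constructor <;> intros <;>
        try simp only [mul_add, add_mul, map_add, sw_fun_add, mul_smul_comm, smul_mul_assoc,
          map_smul, sw_fun_smul]
      rename_i l c d
      simpa only [mul_assoc] using 𝓗.lb.sw_takeuchi (hF c (d * 𝓗.S f)) h l
    · constructor <;> intros <;> simp [mul_add, add_mul, mul_assoc, S_mul_tR]
  have hP : 𝓗.rb.IsBal (fun x f => 𝓗.S (f * 𝓗.rb.t (op (𝓗.rb.π x)))) := by
    constructor <;> intros <;>
      simp [mul_add, add_mul, mul_assoc, RightBialgebroid.π_mul_s']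
  calc sw (𝓗.lb.γ h) (fun a b => 𝓗.S (a * g) * b)
      = sw (𝓗.lb.γ g) (fun c z => sw (𝓗.lb.γ h) (fun a b =>
          𝓗.S (a * c) * b * 𝓗.lb.s (𝓗.lb.π z))) := by
        have h1 : ∀ c z, sw (𝓗.lb.γ h) (fun a b => 𝓗.S (a * c) * b * 𝓗.lb.s (𝓗.lb.π z)) =
            sw (𝓗.lb.γ h) (fun a b => 𝓗.S (a * (𝓗.lb.t (op (𝓗.lb.π z)) * c)) * b) := fun c z => by
          have := 𝓗.lb.sw_takeuchi (hF c 1) h (𝓗.lb.π z)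
          simp only [mul_one, mul_assoc] at this
          simp only [mul_assoc, this]
        simp only [h1]
        rw [sw_comm]
        simp only [← sw_mul, ← map_sw, ← mul_sw, 𝓗.lb.sw_counit_right]
    _ = sw (𝓗.lb.γ g) (fun c z => sw (𝓗.rb.γ z) (fun d f => sw (𝓗.lb.γ h) (fun a b =>
          𝓗.S (a * c) * b * (d * 𝓗.S f)))) := by
        simp only [← 𝓗.sw_S_right, mul_sw]
        simp only [sw_comm (𝓗.lb.γ h)]
    _ = sw (𝓗.rb.γ g) (fun x f => sw (𝓗.lb.γ x) (fun c d => sw (𝓗.lb.γ h) (fun a b =>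
          𝓗.S (a * c) * b * (d * 𝓗.S f)))) := (sw_LR hG g).symm
    _ = sw (𝓗.rb.γ g) (fun x f => 𝓗.rb.s (𝓗.rb.π (h * x)) * 𝓗.S f) := by
        have hS : 𝓗.lb.IsBal (fun a b => 𝓗.S a * b) := by
          simpa using hF 1 1
        congr 1
        funext x f
        rw [← 𝓗.sw_S_left, LeftBialgebroid.sw_γ_mul hS, sw_comm]
        simp only [sw_mul, mul_assoc]
    _ = sw (𝓗.rb.γ g) (fun x f => 𝓗.S (f * 𝓗.rb.t (op (𝓗.rb.π
          (𝓗.rb.t (op (𝓗.rb.π h)) * x))))) := by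
        simp only [S_mul_tR, 𝓗.rb.π_t_mul]
    _ = 𝓗.S g * 𝓗.rb.s (𝓗.rb.π h) := by
        have := RightBialgebroid.sw_mul_of_eq_left hP (𝓗.rb.γ_t (𝓗.rb.π h)) g
        simp only [one_mul] at this
        rw [← this, ← map_sw, 𝓗.rb.sw_counit_left, S_tR_mul]

/-- The antipode is anti-multiplicative: both sides are equal to `S(h₁ g) h₂ S(h₃)`, with the second
coproduct of `h` from the right bialgebroid. -/
lemma S_mul (h g : H) : 𝓗.S (h * g) = 𝓗.S g * 𝓗.S h := by
  have hG : 𝓗.IsTriLR (fun a b c => 𝓗.S (a * g) * b * 𝓗.S c) := by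
    refine ⟨fun f => ?_, fun c => ?_⟩ <;> constructor <;> intros <;>
      simp [mul_add, add_mul, mul_assoc, S_tL_mul, S_mul_tR]
  symm
  calc 𝓗.S g * 𝓗.S h
      = 𝓗.S g * sw (𝓗.rb.γ h) (fun x c => 𝓗.rb.s (𝓗.rb.π x) * 𝓗.S c) := by
        simp only [← S_mul_tR]
        rw [← map_sw, 𝓗.rb.sw_counit_left]
    _ = sw (𝓗.rb.γ h) (fun x c => sw (𝓗.lb.γ x) (fun a b => 𝓗.S (a * g) * b * 𝓗.S c)) := by
        simp only [mul_sw]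
        simp only [← mul_assoc, ← sw_mul, sw_S_mul_right]
    _ = sw (𝓗.lb.γ h) (fun a y => sw (𝓗.rb.γ y) (fun b c => 𝓗.S (a * g) * b * 𝓗.S c)) :=
        sw_LR hG h
    _ = sw (𝓗.lb.γ h) (fun a y => 𝓗.S (𝓗.lb.t (op (𝓗.lb.π y)) * a * g)) := by
        simp only [mul_assoc, ← mul_sw, 𝓗.sw_S_right, S_tL_mul]
    _ = 𝓗.S (h * g) := by
        rw [← map_sw, ← sw_mul, 𝓗.lb.sw_counit_right]

end HopfAlgebroid

/-! ### The antipode is anti-comultiplicative -/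

section

variable {k : Type*} [CommRing k] {X Y M N P V Z : Type*} [AddCommGroup M] [Module k M]
  [AddCommGroup N] [Module k N] [AddCommGroup P] [Module k P] [AddCommGroup V] [Module k V]
  [AddCommGroup Z] [Module k Z] {act : X → M → M} {act' : X → N → N}
  {bct : Y → P → P} {bct' : Y → Z → Z}

/-- A balanced sum over the coproduct of a Sweedler sum. -/
lemma sw_map_sw {W : Type*} [AddCommGroup W] [Module k W] {F : M → N → V} (hF : Bal k act act' F)
    (γ : W →ₗ[k] BTensor k act act') (x : BTensor k bct bct') (G : P → Z → W) :
    sw (γ (sw x G)) F = sw x (fun p z => sw (γ (G p z)) F) := by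
  rw [sw_eq_lift hF, map_sw, map_sw]
  simp only [sw_eq_lift hF]

end

namespace HopfAlgebroid

variable {k L R H V : Type*} [CommRing k] [Ring L] [Algebra k L] [Ring R] [Algebra k R]
  [Ring H] [Algebra k H] [AddCommGroup V] [Module k V] (𝓗 : HopfAlgebroid k L R H)

lemma S_sL (l : L) : 𝓗.S (𝓗.lb.s l) = 𝓗.rb.s (𝓗.rb.π (𝓗.lb.s l)) := by
  conv_lhs => rw [← 𝓗.tR_πR_sL, S_tR]

lemma S_sR (r : R) : 𝓗.S (𝓗.rb.s r) = 𝓗.lb.s (𝓗.lb.π (𝓗.rb.s r)) := by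
  conv_lhs => rw [← 𝓗.tL_πL_sR, S_tL]

variable {𝓗} {F : H → H → V}

lemma bal_S_right (hF : 𝓗.rb.IsBal F) (m n : H) :
    𝓗.lb.IsBal (fun c d => F (m * 𝓗.S d) (n * 𝓗.S c)) := by
  constructor <;> intros <;>
    try simp only [map_add, map_smul, mul_add, mul_smul_comm, hF.add_left, hF.add_right,
      hF.smul_left, hF.smul_right]
  rename_i l c d
  rw [S_tL_mul, S_mul, S_sL, ← mul_assoc, ← mul_assoc, hF.bal, 𝓗.tR_πR_sL]

/-- Balanced only after summation over the coproduct of `y`, by the Takeuchi condition. -/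
lemma bal_sw_S_left (hF : 𝓗.rb.IsBal F) (y : H) :
    𝓗.rb.IsBal (fun m n => sw (𝓗.lb.γ y) (fun c d => F (m * 𝓗.S d) (n * 𝓗.S c))) := by
  constructor <;> intros <;>
    try simp only [smul_mul_assoc, add_mul, hF.add_left, hF.add_right,
      hF.smul_left, hF.smul_right, sw_fun_add, sw_fun_smul]
  rename_i r m n
  have := 𝓗.lb.sw_takeuchi (bal_S_right hF m n) y (𝓗.lb.π (𝓗.rb.t (op r)))
  simp only [S_mul_tL, 𝓗.sL_πL_tR, S_mul_tR] at this
  simp only [mul_assoc]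
  exact this.symm

/-- `S(h₂) ⊗ S(h₁)` is a right convolution inverse of the coproduct of the right bialgebroid, in the
sense that `h₁ S(h₄) ⊗ h₂ S(h₃) = s_L(π_L(h)) ⊗ 1`; the outermost coproduct is that of the right
bialgebroid, and the coproduct of its second leg that of the left bialgebroid. -/
lemma sw_conv_right (hF : 𝓗.rb.IsBal F) (p q h : H) :
    sw (𝓗.rb.γ h) (fun x y => sw (𝓗.rb.γ x) (fun a b => sw (𝓗.lb.γ y) (fun c d =>
      F (p * a * 𝓗.S d) (q * b * 𝓗.S c)))) = F (p * 𝓗.lb.s (𝓗.lb.π h)) q := by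
  have hlin : ∀ y, 𝓗.rb.IsBal (fun a b => sw (𝓗.lb.γ y) (fun c d =>
      F (p * a * 𝓗.S d) (q * b * 𝓗.S c))) := fun y => by
    have := bal_sw_S_left hF y
    constructor <;> intros <;>
      simp only [mul_add, mul_smul_comm, this.add_left, this.add_right, this.smul_left,
        this.smul_right, ← mul_assoc, this.bal]
  have hT : Tri k (fun (r : R) (h : H) => h * 𝓗.rb.s r) (fun (r : R) (h : H) => h * 𝓗.rb.t (op r))
      (fun (r : R) (h : H) => h * 𝓗.rb.s r) (fun (r : R) (h : H) => h * 𝓗.rb.t (op r))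
      (fun a b y => sw (𝓗.lb.γ y) (fun c d => F (p * a * 𝓗.S d) (q * b * 𝓗.S c))) := by
    refine ⟨hlin, fun a => ⟨fun b b' y => (hlin y).add_right _ _ _, fun b y y' => ?_,
      fun c b y => (hlin y).smul_right _ _ _, fun c b y => ?_, fun r b y => ?_⟩⟩
    · rw [map_add, sw_add (bal_S_right hF _ _)]
    · rw [map_smul, sw_smul (bal_S_right hF _ _)]
    · rw [LeftBialgebroid.sw_mul_of_eq_right (bal_S_right hF _ _) (𝓗.γL_tR r)]
      simp only [mul_one, S_mul_tR, mul_assoc]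
  have hT' : ∀ a, 𝓗.IsTriRL (fun b c d => F (p * a * 𝓗.S d) (q * b * 𝓗.S c)) := fun a => by
    refine ⟨fun d => ?_, fun b => bal_S_right hF _ _⟩
    constructor <;> intros <;>
      simp only [map_add, map_smul, mul_add, add_mul, smul_mul_assoc, mul_smul_comm, hF.add_right,
        hF.smul_right, mul_assoc, S_mul_tR]
  have hB : ∀ a x d : H, F (p * a * 𝓗.S d) (q * 𝓗.lb.s (𝓗.lb.π x)) =
      F (p * a * 𝓗.S (𝓗.lb.s (𝓗.lb.π x) * d)) q := fun a x d => by
    conv_lhs => rw [← 𝓗.tR_πR_sL, ← hF.bal]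
    rw [S_mul, S_sL, mul_assoc]
  rw [hT.sw_coassoc _ _ _ _ (𝓗.rb.coassoc h _ (cls_repT _))]
  calc _ = sw (𝓗.rb.γ h) (fun a w => sw (𝓗.lb.γ w) (fun x d => sw (𝓗.rb.γ x) (fun b c =>
        F (p * a * 𝓗.S d) (q * b * 𝓗.S c)))) := by
        simp only [sw_RL (hT' _)]
    _ = sw (𝓗.rb.γ h) (fun a w => F (p * (a * 𝓗.S w)) q) := by
        simp only [mul_assoc q, ← hF.apply_sw_right, ← mul_sw, 𝓗.sw_S_right, hB]
        simp only [← hF.apply_sw_left, ← mul_sw, ← map_sw, 𝓗.lb.sw_counit_left, mul_assoc]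
    _ = _ := by
        rw [← hF.apply_sw_left, ← mul_sw, 𝓗.sw_S_right]

/-- `γ_R(S(h)) = S(h₂) ⊗ S(h₁)`, for the coproduct of the left bialgebroid on the right-hand
side: multiplying `γ_R(S(h₁)) γ_R(h₂) (S(h₄) ⊗ S(h₃))` out from the right gives the left-hand side,
from the left the right-hand side. -/
lemma sw_γR_S (hF : 𝓗.rb.IsBal F) (h : H) :
    sw (𝓗.rb.γ (𝓗.S h)) F = sw (𝓗.lb.γ h) (fun c d => F (𝓗.S d) (𝓗.S c)) := by
  have hT : 𝓗.IsTriLR (fun u x y => sw (𝓗.rb.γ (𝓗.S u * x)) (fun m n =>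
      sw (𝓗.lb.γ y) (fun c d => F (m * 𝓗.S d) (n * 𝓗.S c)))) := by
    have hb := bal_sw_S_left hF
    refine ⟨fun y => ?_, fun u => ⟨fun x x' y => ?_, fun x y y' => ?_, fun c x y => ?_,
      fun c x y => ?_, fun r x y => ?_⟩⟩
    · constructor <;> intros <;>
        simp only [map_add, map_smul, mul_add, add_mul, smul_mul_assoc, mul_smul_comm,
          sw_add (hb y), sw_smul (hb y), S_tL_mul, mul_assoc]
    · rw [mul_add, map_add, sw_add (hb y)]
    · simp only [map_add, sw_add (bal_S_right hF _ _), sw_fun_add]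
    · rw [mul_smul_comm, map_smul, sw_smul (hb y)]
    · simp only [map_smul, sw_smul (bal_S_right hF _ _), sw_fun_smul]
    · simp only [LeftBialgebroid.sw_mul_of_eq_right (bal_S_right hF _ _) (𝓗.γL_tR r),
        ← mul_assoc, RightBialgebroid.sw_mul_of_eq_right (hb y) (𝓗.rb.γ_s r), mul_one]
      simp only [mul_assoc, S_mul_tR]
  have hF1 : 𝓗.lb.IsBal (fun c d => F (𝓗.S d) (𝓗.S c)) := by
    simpa using bal_S_right hF 1 1
  have hE : 𝓗.lb.IsBal (fun u x => 𝓗.S u * x) := by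
    constructor <;> intros <;> simp [mul_add, add_mul, mul_assoc, S_tL_mul]
  calc sw (𝓗.rb.γ (𝓗.S h)) F
      = sw (𝓗.lb.γ h) (fun u v => sw (𝓗.rb.γ (𝓗.S u)) (fun p q =>
          F (p * 𝓗.lb.s (𝓗.lb.π v)) q)) := by
        conv_lhs => rw [← 𝓗.lb.sw_counit_right h, map_sw, sw_map_sw hF]
        simp only [S_tL_mul, RightBialgebroid.sw_mul_of_eq_right hF (𝓗.γR_sL _), mul_one]
    _ = sw (𝓗.lb.γ h) (fun u v => sw (𝓗.rb.γ v) (fun x y => sw (𝓗.rb.γ (𝓗.S u * x)) (fun m n =>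
          sw (𝓗.lb.γ y) (fun c d => F (m * 𝓗.S d) (n * 𝓗.S c))))) := by
        simp only [← sw_conv_right hF, RightBialgebroid.sw_γ_mul (bal_sw_S_left hF _)]
        congr 1
        funext u v
        rw [sw_comm]
    _ = sw (𝓗.rb.γ h) (fun w y => sw (𝓗.lb.γ w) (fun u x => sw (𝓗.rb.γ (𝓗.S u * x)) (fun m n =>
          sw (𝓗.lb.γ y) (fun c d => F (m * 𝓗.S d) (n * 𝓗.S c))))) := (sw_LR hT h).symm
    _ = sw (𝓗.rb.γ h) (fun w y => sw (𝓗.lb.γ y) (fun c d =>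
          F (𝓗.S d) (𝓗.rb.s (𝓗.rb.π w) * 𝓗.S c))) := by
        simp only [← sw_map_sw (bal_sw_S_left hF _), 𝓗.sw_S_left, 𝓗.rb.γ_s,
          sw_cls_tmul (bal_sw_S_left hF _), one_mul]
    _ = sw (𝓗.rb.γ h) (fun w y => sw (𝓗.lb.γ (y * 𝓗.rb.t (op (𝓗.rb.π w)))) (fun c d =>
          F (𝓗.S d) (𝓗.S c))) := by
        simp only [LeftBialgebroid.sw_mul_of_eq_right hF1 (𝓗.γL_tR _), mul_one, S_mul_tR]
    _ = _ := by
        rw [← sw_map_sw hF1, 𝓗.rb.sw_counit_left]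

end HopfAlgebroid

namespace HopfAlgebroid

variable {k L R H V : Type*} [CommRing k] [Ring L] [Algebra k L] [Ring R] [Algebra k R]
  [Ring H] [Algebra k H] [AddCommGroup V] [Module k V] {𝓗 : HopfAlgebroid k L R H}
  {F : H → H → V}

/-- Balanced only after summation over the coproduct of `x`, by the Takeuchi condition. -/
lemma bal_sw_S_right (hF : 𝓗.lb.IsBal F) (x : H) :
    𝓗.rb.IsBal (fun c d => sw (𝓗.lb.γ x) (fun m n => F (m * 𝓗.S d) (n * 𝓗.S c))) := by
  constructor <;> intros <;>
    try simp only [map_add, map_smul, mul_add, mul_smul_comm, hF.add_left, hF.add_right,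
      hF.smul_left, hF.smul_right, sw_fun_add, sw_fun_smul]
  rename_i r c d
  have hF' : 𝓗.lb.IsBal (fun m n => F (m * 𝓗.S d) (n * 𝓗.S c)) := by
    constructor <;> intros <;>
      simp only [add_mul, smul_mul_assoc, hF.add_left, hF.add_right, hF.smul_left, hF.smul_right,
        mul_assoc, hF.bal]
  have := 𝓗.lb.sw_takeuchi hF' x (𝓗.lb.π (𝓗.rb.s r))
  rw [𝓗.tL_πL_sR] at this
  simp only [S_mul, S_sR, S_tR, ← mul_assoc] at this ⊢
  exact this.symm

lemma bal_S_left (hF : 𝓗.lb.IsBal F) : 𝓗.rb.IsBal (fun c d => F (𝓗.S d) (𝓗.S c)) := by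
  have := bal_sw_S_right hF 1
  have h1 : ∀ c d, 𝓗.lb.IsBal (fun m n => F (m * 𝓗.S d) (n * 𝓗.S c)) := fun c d => by
    constructor <;> intros <;>
      simp only [add_mul, smul_mul_assoc, hF.add_left, hF.add_right, hF.smul_left, hF.smul_right,
        mul_assoc, hF.bal]
  simp only [𝓗.lb.γ_one, sw_cls_tmul (h1 _ _), one_mul] at this
  exact this

/-- The counterpart of `sw_conv_right` for the coproduct of the left bialgebroid:
`h₁ S(h₄) ⊗ h₂ S(h₃) = s_L(π_L(h)) ⊗ 1`, where now the coproduct of the first leg is that of the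
left bialgebroid and the other two are that of the right bialgebroid. -/
lemma sw_conv_left (hF : 𝓗.lb.IsBal F) (h : H) :
    sw (𝓗.rb.γ h) (fun x y => sw (𝓗.lb.γ x) (fun a b => sw (𝓗.rb.γ y) (fun c d =>
      F (a * 𝓗.S d) (b * 𝓗.S c)))) = F (𝓗.lb.s (𝓗.lb.π h)) 1 := by
  have hb := bal_sw_S_right hF
  have h1 : ∀ c d, 𝓗.lb.IsBal (fun m n => F (m * 𝓗.S d) (n * 𝓗.S c)) := fun c d => by
    constructor <;> intros <;>
      simp only [add_mul, smul_mul_assoc, hF.add_left, hF.add_right, hF.smul_left, hF.smul_right,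
        mul_assoc, hF.bal]
  have hT : Tri k (fun (r : R) (h : H) => h * 𝓗.rb.s r) (fun (r : R) (h : H) => h * 𝓗.rb.t (op r))
      (fun (r : R) (h : H) => h * 𝓗.rb.s r) (fun (r : R) (h : H) => h * 𝓗.rb.t (op r))
      (fun x c d => sw (𝓗.lb.γ x) (fun a b => F (a * 𝓗.S d) (b * 𝓗.S c))) := by
    refine ⟨fun d => ⟨fun x x' c => ?_, fun x c c' => (hb x).add_left _ _ _, fun l x c => ?_,
      fun l x c => (hb x).smul_left _ _ _, fun r x c => ?_⟩, hb⟩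
    · rw [map_add, sw_add (h1 _ _)]
    · rw [map_smul, sw_smul (h1 _ _)]
    · rw [LeftBialgebroid.sw_mul_of_eq_right (h1 _ _) (𝓗.γL_sR r)]
      simp only [mul_one, S_mul_tR, mul_assoc]
  have hT' : ∀ d, 𝓗.IsTriLR (fun a b c => F (a * 𝓗.S d) (b * 𝓗.S c)) := fun d => by
    refine ⟨fun c => h1 c d, fun a => ?_⟩
    constructor <;> intros <;>
      simp only [map_add, map_smul, mul_add, add_mul, smul_mul_assoc, mul_smul_comm, hF.add_right,
        hF.smul_right, mul_assoc, S_mul_tR]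
  have hB : ∀ a w d : H, F (a * 𝓗.S d) (𝓗.lb.s (𝓗.lb.π w)) =
      F (𝓗.lb.t (op (𝓗.lb.π w)) * a * 𝓗.S d) 1 := fun a w d => by
    rw [mul_assoc, hF.bal, mul_one]
  calc _ = sw (𝓗.rb.γ h) (fun x y => sw (𝓗.rb.γ y) (fun c d => sw (𝓗.lb.γ x) (fun a b =>
        F (a * 𝓗.S d) (b * 𝓗.S c)))) := by
        congr 1
        funext x y
        rw [sw_comm]
    _ = sw (𝓗.rb.γ h) (fun x d => sw (𝓗.rb.γ x) (fun x c => sw (𝓗.lb.γ x) (fun a b =>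
        F (a * 𝓗.S d) (b * 𝓗.S c)))) :=
        (hT.sw_coassoc _ _ _ _ (𝓗.rb.coassoc h _ (cls_repT _))).symm
    _ = sw (𝓗.rb.γ h) (fun x d => F (x * 𝓗.S d) 1) := by
        simp only [sw_LR (hT' _), ← hF.apply_sw_right, 𝓗.sw_S_right, hB]
        simp only [← hF.apply_sw_left, ← sw_mul, 𝓗.lb.sw_counit_right]
    _ = _ := by
        rw [← hF.apply_sw_left, 𝓗.sw_S_right]

/-- `γ_L(S(h)) = S(h₂) ⊗ S(h₁)`, for the coproduct of the right bialgebroid on the right-hand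
side. -/
lemma sw_γL_S (hF : 𝓗.lb.IsBal F) (h : H) :
    sw (𝓗.lb.γ (𝓗.S h)) F = sw (𝓗.rb.γ h) (fun c d => F (𝓗.S d) (𝓗.S c)) := by
  have hb := bal_sw_S_right hF
  have h1 : ∀ c d, 𝓗.lb.IsBal (fun m n => F (m * 𝓗.S d) (n * 𝓗.S c)) := fun c d => by
    constructor <;> intros <;>
      simp only [add_mul, smul_mul_assoc, hF.add_left, hF.add_right, hF.smul_left, hF.smul_right,
        mul_assoc, hF.bal]
  have hu : ∀ g : H, 𝓗.lb.IsBal (fun a b => sw (𝓗.lb.γ g) (fun p q => F (p * a) (q * b))) :=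
    fun g => by
    constructor <;> intros <;>
      try simp only [mul_add, mul_smul_comm, hF.add_left, hF.add_right, hF.smul_left,
        hF.smul_right, sw_fun_add, sw_fun_smul]
    rename_i l a b
    have h2 : 𝓗.lb.IsBal (fun p q => F (p * a) (q * b)) := by
      constructor <;> intros <;>
        simp only [add_mul, smul_mul_assoc, hF.add_left, hF.add_right, hF.smul_left, hF.smul_right,
          mul_assoc, hF.bal]
    simpa only [mul_assoc] using 𝓗.lb.sw_takeuchi h2 g l
  have hT : 𝓗.IsTriLR (fun u x y => sw (𝓗.rb.γ y) (fun c d => sw (𝓗.lb.γ (𝓗.S u * x)) (fun m n =>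
      F (m * 𝓗.S d) (n * 𝓗.S c)))) := by
    refine ⟨fun y => ?_, fun u => ⟨fun x x' y => ?_, fun x y y' => ?_, fun c x y => ?_,
      fun c x y => ?_, fun r x y => ?_⟩⟩
    · constructor <;> intros <;>
        simp only [map_add, map_smul, mul_add, add_mul, smul_mul_assoc, mul_smul_comm,
          sw_add (h1 _ _), sw_smul (h1 _ _), sw_fun_add, sw_fun_smul, S_tL_mul, mul_assoc]
    · simp only [mul_add, map_add, sw_add (h1 _ _), sw_fun_add]
    · rw [map_add, sw_add (hb _)]
    · simp only [mul_smul_comm, map_smul, sw_smul (h1 _ _), sw_fun_smul]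
    · rw [map_smul, sw_smul (hb _)]
    · simp only [RightBialgebroid.sw_mul_of_eq_right (hb _) (𝓗.rb.γ_t r),
        ← mul_assoc, LeftBialgebroid.sw_mul_of_eq_right (h1 _ _) (𝓗.γL_sR r), mul_one]
      simp only [mul_assoc, S_mul_tR]
  calc sw (𝓗.lb.γ (𝓗.S h)) F
      = sw (𝓗.lb.γ h) (fun u v => sw (𝓗.lb.γ (𝓗.S u)) (fun p q =>
          F (p * 𝓗.lb.s (𝓗.lb.π v)) (q * 1))) := by
        conv_lhs => rw [← 𝓗.lb.sw_counit_right h, map_sw, sw_map_sw hF]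
        simp only [S_tL_mul, LeftBialgebroid.sw_mul_of_eq_right hF (𝓗.lb.γ_s _)]
    _ = sw (𝓗.lb.γ h) (fun u v => sw (𝓗.rb.γ v) (fun x y => sw (𝓗.rb.γ y) (fun c d =>
          sw (𝓗.lb.γ (𝓗.S u * x)) (fun m n => F (m * 𝓗.S d) (n * 𝓗.S c))))) := by
        congr 1
        funext u v
        rw [← sw_conv_left (hu _)]
        congr 1
        funext x y
        rw [sw_comm]
        congr 1
        funext c d
        rw [LeftBialgebroid.sw_γ_mul (h1 _ _), sw_comm]
        simp only [mul_assoc]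
    _ = sw (𝓗.rb.γ h) (fun w y => sw (𝓗.lb.γ w) (fun u x => sw (𝓗.rb.γ y) (fun c d =>
          sw (𝓗.lb.γ (𝓗.S u * x)) (fun m n => F (m * 𝓗.S d) (n * 𝓗.S c))))) := (sw_LR hT h).symm
    _ = sw (𝓗.rb.γ h) (fun w y => sw (𝓗.rb.γ y) (fun c d =>
          F (𝓗.S d) (𝓗.rb.s (𝓗.rb.π w) * 𝓗.S c))) := by
        congr 1
        funext w y
        rw [sw_comm]
        simp only [← sw_map_sw (h1 _ _), 𝓗.sw_S_left, 𝓗.γL_sR,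
          sw_cls_tmul (h1 _ _), one_mul]
    _ = sw (𝓗.rb.γ h) (fun w y => sw (𝓗.rb.γ (y * 𝓗.rb.t (op (𝓗.rb.π w)))) (fun c d =>
          F (𝓗.S d) (𝓗.S c))) := by
        simp only [RightBialgebroid.sw_mul_of_eq_right (bal_S_left hF) (𝓗.rb.γ_t _), mul_one,
          S_mul_tR]
    _ = _ := by
        rw [← sw_map_sw (bal_S_left hF), 𝓗.rb.sw_counit_left]

/-! ### The inverse of the antipode -/

/-- The inverse of a bijective antipode. -/
def Sinv (𝓗 : HopfAlgebroid k L R H) (hS : Function.Bijective 𝓗.S) : H →ₗ[k] H :=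
  (LinearEquiv.ofBijective 𝓗.S hS).symm.toLinearMap

variable (hS : Function.Bijective 𝓗.S)

@[simp] lemma S_Sinv (h : H) : 𝓗.S (𝓗.Sinv hS h) = h :=
  (LinearEquiv.ofBijective 𝓗.S hS).apply_symm_apply h

@[simp] lemma Sinv_S (h : H) : 𝓗.Sinv hS (𝓗.S h) = h :=
  (LinearEquiv.ofBijective 𝓗.S hS).symm_apply_apply h

lemma Sinv_mul (h g : H) : 𝓗.Sinv hS (h * g) = 𝓗.Sinv hS g * 𝓗.Sinv hS h :=
  hS.1 (by simp [S_mul])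

lemma Sinv_sL (l : L) : 𝓗.Sinv hS (𝓗.lb.s l) = 𝓗.lb.t (op l) := by
  rw [← S_tL, Sinv_S]

lemma Sinv_sR (r : R) : 𝓗.Sinv hS (𝓗.rb.s r) = 𝓗.rb.t (op r) := by
  rw [← S_tR, Sinv_S]

lemma Sinv_tR (r : R) : 𝓗.Sinv hS (𝓗.rb.t (op r)) = 𝓗.lb.t (op (𝓗.lb.π (𝓗.rb.t (op r)))) := by
  conv_lhs => rw [← 𝓗.sL_πL_tR, Sinv_sL]

lemma Sinv_tL (l : L) : 𝓗.Sinv hS (𝓗.lb.t (op l)) = 𝓗.rb.t (op (𝓗.rb.π (𝓗.lb.t (op l)))) := by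
  conv_lhs => rw [← 𝓗.sR_πR_tL, Sinv_sR]

/-- `S⁻¹(h₂) h₁ = t_R(π_R(h))`, for the coproduct of the left bialgebroid. -/
lemma sw_Sinv_left (h : H) :
    sw (𝓗.lb.γ h) (fun a b => 𝓗.Sinv hS b * a) = 𝓗.rb.t (op (𝓗.rb.π h)) := by
  rw [← Sinv_sR hS, ← 𝓗.sw_S_left, map_sw]
  simp only [Sinv_mul, Sinv_S]

/-- `h₂ S⁻¹(h₁) = t_L(π_L(h))`, for the coproduct of the right bialgebroid. -/
lemma sw_Sinv_right (h : H) :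
    sw (𝓗.rb.γ h) (fun a b => b * 𝓗.Sinv hS a) = 𝓗.lb.t (op (𝓗.lb.π h)) := by
  rw [← Sinv_sL hS, ← 𝓗.sw_S_right, map_sw]
  simp only [Sinv_mul, Sinv_S]

lemma bal_Sinv_left (hF : 𝓗.lb.IsBal F) :
    𝓗.rb.IsBal (fun c d => F (𝓗.Sinv hS d) (𝓗.Sinv hS c)) := by
  constructor <;> intros <;>
    try simp only [map_add, map_smul, hF.add_left, hF.add_right, hF.smul_left, hF.smul_right]
  rw [Sinv_mul, Sinv_mul, Sinv_tR, hF.bal, 𝓗.sL_πL_tR, Sinv_sR]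

lemma bal_Sinv_right (hF : 𝓗.rb.IsBal F) :
    𝓗.lb.IsBal (fun c d => F (𝓗.Sinv hS d) (𝓗.Sinv hS c)) := by
  constructor <;> intros <;>
    try simp only [map_add, map_smul, hF.add_left, hF.add_right, hF.smul_left, hF.smul_right]
  rw [Sinv_mul, Sinv_mul, Sinv_tL, ← hF.bal, 𝓗.sR_πR_tL, Sinv_sL]

/-- `γ_L(S⁻¹(h)) = S⁻¹(h₂) ⊗ S⁻¹(h₁)`, for the coproduct of the right bialgebroid on the
right-hand side. -/
lemma sw_γL_Sinv (hF : 𝓗.lb.IsBal F) (h : H) :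
    sw (𝓗.lb.γ (𝓗.Sinv hS h)) F =
      sw (𝓗.rb.γ h) (fun c d => F (𝓗.Sinv hS d) (𝓗.Sinv hS c)) := by
  conv_rhs => rw [← S_Sinv hS h, sw_γR_S (bal_Sinv_left hS hF)]
  simp only [Sinv_S]

/-- `γ_R(S⁻¹(h)) = S⁻¹(h₂) ⊗ S⁻¹(h₁)`, for the coproduct of the left bialgebroid on the
right-hand side. -/
lemma sw_γR_Sinv (hF : 𝓗.rb.IsBal F) (h : H) :
    sw (𝓗.rb.γ (𝓗.Sinv hS h)) F =
      sw (𝓗.lb.γ h) (fun c d => F (𝓗.Sinv hS d) (𝓗.Sinv hS c)) := by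
  conv_rhs => rw [← S_Sinv hS h, sw_γL_S (bal_Sinv_right hS hF)]
  simp only [Sinv_S]

end HopfAlgebroid

/-! ### Integrals -/

namespace HopfAlgebroid

variable {k L R H V : Type*} [CommRing k] [Ring L] [Algebra k L] [Ring R] [Algebra k R]
  [Ring H] [Algebra k H] [AddCommGroup V] [Module k V] {𝓗 : HopfAlgebroid k L R H}
  {F : H → H → V}

/-- An integral on `H`: a functional `p : H → R`, together with the corresponding functional
`q : H → L` for which `t_R ∘ p = s_L ∘ q`, that satisfies `h₁ s_R(p(h₂)) = t_R(p(h))` for the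
coproduct of the right bialgebroid and `t_L(q(h₂)) h₁ = s_L(q(h))` for the one of the left
bialgebroid. -/
structure IsIntegral (𝓗 : HopfAlgebroid k L R H) (p : H →ₗ[k] R) (q : H →ₗ[k] L) : Prop where
  tR_eq_sL : ∀ h, 𝓗.rb.t (op (p h)) = 𝓗.lb.s (q h)
  mul_tR : ∀ h r, p (h * 𝓗.rb.t (op r)) = r * p h
  sL_mul : ∀ l h, q (𝓗.lb.s l * h) = l * q h
  right : ∀ h, sw (𝓗.rb.γ h) (fun a b => a * 𝓗.rb.s (p b)) = 𝓗.rb.t (op (p h))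
  left : ∀ h, sw (𝓗.lb.γ h) (fun a b => 𝓗.lb.t (op (q b)) * a) = 𝓗.lb.s (q h)

lemma bal_mul_sR {p : H →ₗ[k] R} (hp : ∀ h r, p (h * 𝓗.rb.t (op r)) = r * p h) :
    𝓗.rb.IsBal (fun a b => a * 𝓗.rb.s (p b)) := by
  constructor <;> intros <;> simp [mul_add, add_mul, mul_assoc, hp]

lemma bal_tL_mul {q : H →ₗ[k] L} (hq : ∀ l h, q (𝓗.lb.s l * h) = l * q h) :
    𝓗.lb.IsBal (fun a b => 𝓗.lb.t (op (q b)) * a) := by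
  constructor <;> intros <;> simp [mul_add, add_mul, mul_assoc, hq]

lemma bal_S_mul : 𝓗.lb.IsBal (fun a b => 𝓗.S a * b) := by
  constructor <;> intros <;> simp [mul_add, add_mul, mul_assoc, S_tL_mul]

/-- A functional with the integral property for the right bialgebroid also has the one for the left
bialgebroid. -/
lemma IsIntegral.of_right (hS : Function.Bijective 𝓗.S) {p : H →ₗ[k] R}
    (hp : ∀ h r, p (h * 𝓗.rb.t (op r)) = r * p h)
    (hr : ∀ h, sw (𝓗.rb.γ h) (fun a b => a * 𝓗.rb.s (p b)) = 𝓗.rb.t (op (p h))) :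
    ∃ q, 𝓗.IsIntegral p q := by
  have heq : ∀ h, 𝓗.rb.t (op (p h)) = 𝓗.lb.s (𝓗.lb.π (𝓗.rb.t (op (p h)))) := fun h =>
    (𝓗.sL_πL_tR _).symm
  refine ⟨𝓗.lb.π ∘ₗ 𝓗.rb.t.toLinearMap ∘ₗ (opLinearEquiv k).toLinearMap ∘ₗ p, heq, hp,
    fun l h => ?_, hr, fun h => hS.1 ?_⟩
  · change 𝓗.lb.π (𝓗.rb.t (op (p (𝓗.lb.s l * h)))) = l * 𝓗.lb.π (𝓗.rb.t (op (p h)))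
    rw [← hr, RightBialgebroid.sw_mul_of_eq_left (bal_mul_sR hp) (𝓗.γR_sL l)]
    simp only [one_mul, mul_assoc, ← mul_sw, hr, 𝓗.lb.π_s_mul']
  · change 𝓗.S (sw (𝓗.lb.γ h) (fun a b => 𝓗.lb.t (op (𝓗.lb.π (𝓗.rb.t (op (p b))))) * a)) =
      𝓗.S (𝓗.lb.s (𝓗.lb.π (𝓗.rb.t (op (p h)))))
    -- apply `S`, expand `t_R(p(h₂))` by the integral property and collapse `S(h₁) h₂`
    have hT : 𝓗.IsTriLR (fun a b c => 𝓗.S a * b * 𝓗.rb.s (p c)) := by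
      refine ⟨fun c => ?_, fun a => ?_⟩ <;> constructor <;> intros <;>
        simp [mul_add, add_mul, mul_assoc, S_tL_mul, hp]
    rw [map_sw, ← heq, S_tR]
    simp only [S_tL_mul, ← heq]
    simp only [← hr, mul_sw, ← mul_assoc]
    rw [← sw_LR hT]
    simp only [← sw_mul, sw_S_left, ← map_mul, ← hp]
    rw [← map_sw, ← map_sw, 𝓗.rb.sw_counit_left]

/-- A functional with the integral property for the left bialgebroid also has the one for the right
bialgebroid. -/
lemma IsIntegral.of_left (hS : Function.Bijective 𝓗.S) {q : H →ₗ[k] L}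
    (hq : ∀ l h, q (𝓗.lb.s l * h) = l * q h)
    (hl : ∀ h, sw (𝓗.lb.γ h) (fun a b => 𝓗.lb.t (op (q b)) * a) = 𝓗.lb.s (q h)) :
    ∃ p, 𝓗.IsIntegral p q := by
  have heq : ∀ h, 𝓗.rb.t (op (𝓗.rb.π (𝓗.lb.s (q h)))) = 𝓗.lb.s (q h) := fun h => 𝓗.tR_πR_sL _
  have hSr : ∀ l, 𝓗.Sinv hS (𝓗.rb.s (𝓗.rb.π (𝓗.lb.s l))) = 𝓗.lb.s l := fun l => by
    rw [Sinv_sR, 𝓗.tR_πR_sL]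
  refine ⟨𝓗.rb.π ∘ₗ 𝓗.lb.s.toLinearMap ∘ₗ q, heq, fun h r => ?_, hq,
    fun h => ?_, hl⟩
  · change 𝓗.rb.π (𝓗.lb.s (q (h * 𝓗.rb.t (op r)))) = r * 𝓗.rb.π (𝓗.lb.s (q h))
    rw [← hl, LeftBialgebroid.sw_mul_of_eq_right (bal_tL_mul hq) (𝓗.γL_tR r)]
    simp only [mul_one, ← mul_assoc, ← sw_mul, hl, 𝓗.rb.π_mul_t']
  · change sw (𝓗.rb.γ h) (fun a b => a * 𝓗.rb.s (𝓗.rb.π (𝓗.lb.s (q b)))) =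
      𝓗.rb.t (op (𝓗.rb.π (𝓗.lb.s (q h))))
    -- apply `S⁻¹`, expand `s_L(q(h₂))` by the integral property and collapse `h₂ S⁻¹(h₁)`
    have hT : 𝓗.IsTriRL (fun a b c => 𝓗.lb.t (op (q c)) * (b * 𝓗.Sinv hS a)) := by
      refine ⟨fun c => ?_, fun a => ?_⟩ <;> constructor <;> intros <;>
        simp [mul_add, add_mul, mul_assoc, hq, Sinv_mul, Sinv_sR]
    refine (LinearEquiv.ofBijective 𝓗.S hS).symm.injective ?_
    change 𝓗.Sinv hS _ = 𝓗.Sinv hS _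
    rw [map_sw, heq, Sinv_sL]
    simp only [Sinv_mul, hSr]
    simp only [← hl, sw_mul, mul_assoc]
    rw [← sw_RL hT]
    simp only [← mul_sw, sw_Sinv_right, ← map_mul, ← op_mul, ← hq]
    conv_rhs => rw [← 𝓗.lb.sw_counit_left h]
    exact (map_sw (𝓗.lb.t.toLinearMap ∘ₗ (opLinearEquiv k).toLinearMap ∘ₗ q) _ _).symm

end HopfAlgebroid

namespace HopfAlgebroid

variable {k L R H V : Type*} [CommRing k] [Ring L] [Algebra k L] [Ring R] [Algebra k R]
  [Ring H] [Algebra k H] [AddCommGroup V] [Module k V] {𝓗 : HopfAlgebroid k L R H}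
  {F : H → H → V}

/-- `t_R ∘ π_R ∘ S = s_L ∘ π_L` -/
lemma tR_πR_S (h : H) : 𝓗.rb.t (op (𝓗.rb.π (𝓗.S h))) = 𝓗.lb.s (𝓗.lb.π h) := by
  rw [← 𝓗.tR_πR_sL, ← 𝓗.sw_S_right, map_sw]
  have h1 : ∀ a b, 𝓗.rb.π (a * 𝓗.S b) = 𝓗.rb.π (𝓗.S (b * 𝓗.rb.t (op (𝓗.rb.π a)))) := fun a b => by
    rw [S_mul_tR, 𝓗.rb.π_s_mul]
  simp only [h1]
  rw [← map_sw, ← map_sw, 𝓗.rb.sw_counit_left]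

/-- `π_R(S(x s_R(r))) = π_R(S(x S(s_R(r))))` -/
lemma πR_S_mul_sR (x : H) (r : R) :
    𝓗.rb.π (𝓗.S (x * 𝓗.rb.s r)) = 𝓗.rb.π (𝓗.S (x * 𝓗.S (𝓗.rb.s r))) := by
  rw [S_mul, S_sR, ← 𝓗.tR_πR_sL, S_mul_tR, 𝓗.rb.π_s_mul_eq]

/-- `π_L(x S(s_R(r))) = π_L(x s_R(r))` -/
lemma πL_mul_S_sR (x : H) (r : R) :
    𝓗.lb.π (x * 𝓗.S (𝓗.rb.s r)) = 𝓗.lb.π (x * 𝓗.rb.s r) := by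
  rw [S_sR, 𝓗.lb.π_mul_s]

/-- `s_R(π_R(S(x))) = S(S(x₂)) S(x₁)`, for the coproduct of the right bialgebroid. -/
lemma sR_πR_S (x : H) : 𝓗.rb.s (𝓗.rb.π (𝓗.S x)) =
    sw (𝓗.rb.γ x) (fun a b => 𝓗.S (𝓗.S b) * 𝓗.S a) := by
  rw [← 𝓗.sw_S_left, sw_γL_S bal_S_mul]

variable (𝓗) in
/-- The automorphism of `R` through which `S ∘ S` acts on `t_R`. -/
def ν (r : R) : R := 𝓗.rb.π (𝓗.lb.s (𝓗.lb.π (𝓗.rb.s r)))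

lemma S_sR_eq (r : R) : 𝓗.S (𝓗.rb.s r) = 𝓗.rb.t (op (𝓗.ν r)) := by
  rw [S_sR, ν, 𝓗.tR_πR_sL]

lemma SS_mul_tR (x : H) (r : R) :
    𝓗.S (𝓗.S (x * 𝓗.rb.t (op r))) = 𝓗.S (𝓗.S x) * 𝓗.rb.t (op (𝓗.ν r)) := by
  rw [S_mul_tR, S_mul, S_sR_eq]

lemma tR_eq_S_sR (r : R) : 𝓗.rb.t (op r) =
    𝓗.S (𝓗.rb.s (𝓗.rb.π (𝓗.lb.t (op (𝓗.lb.π (𝓗.rb.t (op r))))))) := by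
  rw [𝓗.sR_πR_tL, S_tL, 𝓗.sL_πL_tR]

/-! ### Integrals from dual bases, for the left counit -/

section Construction

/-- `φ` is linear for the left `R`-module structure `r · h = h t_R(r)`. -/
def TRLinear (𝓗 : HopfAlgebroid k L R H) (φ : H →ₗ[k] R) : Prop :=
  ∀ h r, φ (h * 𝓗.rb.t (op r)) = r * φ h

/-- `φ` is linear for the left `L`-module structure `l · h = s_L(l) h`. -/
def SLLinear (𝓗 : HopfAlgebroid k L R H) (φ : H →ₗ[k] L) : Prop :=
  ∀ l h, φ (𝓗.lb.s l * h) = l * φ h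

lemma tR_apply_SS {φ : H →ₗ[k] R} (hφ : 𝓗.TRLinear φ) (h x : H) (r : R) :
    𝓗.rb.t (op (φ (h * 𝓗.S (𝓗.S (x * 𝓗.rb.t (op r)))))) =
      𝓗.rb.t (op (φ (h * 𝓗.S (𝓗.S x)))) * 𝓗.S (𝓗.rb.s r) := by
  rw [SS_mul_tR, ← mul_assoc, hφ, op_mul, map_mul, S_sR_eq]

/-- The action `h ↦ h₁ s_R(φ(h₂))` of a functional on `H`. -/
def actR {φ : H →ₗ[k] R} (hφ : 𝓗.TRLinear φ) : H →ₗ[k] H := (bal_mul_sR hφ).lift ∘ₗ 𝓗.rb.γ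

/-- The action `h ↦ t_L(φ(h₂)) h₁` of a functional on `H`. -/
def actL {φ : H →ₗ[k] L} (hφ : 𝓗.SLLinear φ) : H →ₗ[k] H := (bal_tL_mul hφ).lift ∘ₗ 𝓗.lb.γ

lemma actR_apply {φ : H →ₗ[k] R} (hφ : 𝓗.TRLinear φ) (h : H) :
    actR hφ h = sw (𝓗.rb.γ h) (fun a b => a * 𝓗.rb.s (φ b)) :=
  (sw_eq_lift (bal_mul_sR hφ) _).symm

lemma actL_apply {φ : H →ₗ[k] L} (hφ : 𝓗.SLLinear φ) (h : H) :
    actL hφ h = sw (𝓗.lb.γ h) (fun a b => 𝓗.lb.t (op (φ b)) * a) :=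
  (sw_eq_lift (bal_tL_mul hφ) _).symm

lemma actR_mul_tR {φ : H →ₗ[k] R} (hφ : 𝓗.TRLinear φ) (h : H) (r : R) :
    actR hφ (h * 𝓗.rb.t (op r)) = actR hφ h * 𝓗.rb.t (op r) := by
  rw [actR_apply, actR_apply, RightBialgebroid.sw_mul_of_eq_right (bal_mul_sR hφ) (𝓗.rb.γ_t r),
    sw_mul]
  simp only [mul_one, mul_assoc, 𝓗.rb.st_comm]

lemma actL_mul_tR {φ : H →ₗ[k] L} (hφ : 𝓗.SLLinear φ) (h : H) (r : R) :
    actL hφ (h * 𝓗.rb.t (op r)) = actL hφ h * 𝓗.rb.t (op r) := by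
  rw [actL_apply, actL_apply, LeftBialgebroid.sw_mul_of_eq_right (bal_tL_mul hφ) (𝓗.γL_tR r),
    sw_mul]
  simp only [mul_one, mul_assoc]

lemma actL_tR_mul {φ : H →ₗ[k] L} (hφ : 𝓗.SLLinear φ) (h : H) (r : R) :
    actL hφ (𝓗.rb.t (op r) * h) = 𝓗.rb.t (op r) * actL hφ h := by
  rw [actL_apply, actL_apply, LeftBialgebroid.sw_mul_of_eq_left (bal_tL_mul hφ) (𝓗.γL_tR r),
    mul_sw]
  simp only [one_mul, ← mul_assoc, 𝓗.tL_tR_comm]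

/-- `h ↦ t_L(φ(h₂)) h₁` is colinear for the right bialgebroid. -/
lemma sw_γR_actL {φ : H →ₗ[k] L} (hφ : 𝓗.SLLinear φ) (hF : 𝓗.rb.IsBal F) (h : H) :
    sw (𝓗.rb.γ (actL hφ h)) F = sw (𝓗.rb.γ h) (fun a b => F a (actL hφ b)) := by
  have hT : 𝓗.IsTriRL (fun a b c => F a (𝓗.lb.t (op (φ c)) * b)) := by
    refine ⟨fun c => ?_, fun a => ?_⟩
    · constructor <;> intros <;>
        simp only [mul_add, mul_smul_comm, hF.add_left, hF.add_right, hF.smul_left, hF.smul_right,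
          hF.bal, mul_assoc]
    · constructor <;> intros <;>
        simp only [mul_add, add_mul, mul_smul_comm, smul_mul_assoc, hF.add_right, hF.smul_right,
          mul_assoc, map_add, map_smul, op_add, op_smul, hφ _ _, op_mul, map_mul]
  rw [actL_apply, sw_map_sw hF]
  simp only [RightBialgebroid.sw_mul_of_eq_left hF (𝓗.γR_tL _), one_mul, actL_apply,
    hF.apply_sw_right]
  exact sw_RL hT h

/-- `γ_R(S(S(h))) = S(S(h₁)) ⊗ S(S(h₂))` -/
lemma sw_γR_SS (hF : 𝓗.rb.IsBal F) (h : H) : sw (𝓗.rb.γ (𝓗.S (𝓗.S h))) F =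
    sw (𝓗.rb.γ h) (fun a b => F (𝓗.S (𝓗.S a)) (𝓗.S (𝓗.S b))) := by
  have := bal_S_right hF 1 1
  simp only [one_mul] at this
  rw [sw_γR_S hF, sw_γL_S this]

variable {ι : Type*} [Fintype ι] {e : ι → H} {ε : ι → H →ₗ[k] R} (hε : ∀ i, 𝓗.TRLinear (ε i))
  (he : ∀ h, ∑ i, e i * 𝓗.rb.t (op (ε i h)) = h) {g : H →ₗ[k] L} (hg : 𝓗.SLLinear g)

/-- The integral `p(h) = ∑ᵢ π_R(S(eᵢ₁ t_R(εᵢ(h S²(z(eᵢ₂))))))` with `z(e) = t_L(g(e₂)) e₁`,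
obtained from a dual basis `(eᵢ, εᵢ)` of `H` and a functional `g`. -/
def leftTrace (e : ι → H) (ε : ι → H →ₗ[k] R) (hg : 𝓗.SLLinear g) : H →ₗ[k] R where
  toFun h := ∑ i, sw (𝓗.rb.γ (e i)) (fun a b =>
    𝓗.rb.π (𝓗.S (a * 𝓗.rb.t (op (ε i (h * 𝓗.S (𝓗.S (actL hg b))))))))
  map_add' h h' := by
    simp only [add_mul, map_add, op_add, mul_add, sw_fun_add, Finset.sum_add_distrib]
  map_smul' c h := by
    simp only [smul_mul_assoc, map_smul, op_smul, mul_smul_comm, sw_fun_smul, Finset.smul_sum,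
      RingHom.id_apply]

lemma leftTrace_apply (h : H) : leftTrace e ε hg h = ∑ i, sw (𝓗.rb.γ (e i)) (fun a b =>
    𝓗.rb.π (𝓗.S (a * 𝓗.rb.t (op (ε i (h * 𝓗.S (𝓗.S (actL hg b)))))))) := rfl

lemma tR_leftTrace (h : H) : 𝓗.rb.t (op (leftTrace e ε hg h)) =
    ∑ i, sw (𝓗.rb.γ (e i)) (fun a b =>
      𝓗.lb.s (𝓗.lb.π (a * 𝓗.rb.t (op (ε i (h * 𝓗.S (𝓗.S (actL hg b)))))))) := by
  simp only [← tR_πR_S]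
  change (𝓗.rb.t.toLinearMap ∘ₗ (opLinearEquiv k).toLinearMap) (leftTrace e ε hg h) = _
  rw [leftTrace_apply, map_sum]
  exact Finset.sum_congr rfl fun i _ => map_sw _ _ _

include hε

lemma leftTrace_mul_tR : 𝓗.TRLinear (leftTrace e ε hg) := fun h r => by
  have hb : ∀ i, 𝓗.rb.IsBal (fun a b =>
      𝓗.rb.π (𝓗.S (a * 𝓗.rb.t (op (ε i (h * 𝓗.S (𝓗.S (actL hg b)))))))) := fun i => by
    constructor <;> intros <;>
      try simp only [map_add, map_smul, mul_add, add_mul, smul_mul_assoc, mul_smul_comm, op_add,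
        op_smul]
    rw [actL_mul_tR, tR_apply_SS (hε i), ← mul_assoc, ← πR_S_mul_sR, mul_assoc, 𝓗.rb.st_comm,
      mul_assoc]
  rw [leftTrace_apply, leftTrace_apply, Finset.mul_sum]
  refine Finset.sum_congr rfl fun i _ => ?_
  -- `t_R(r)` is moved to the left of `S(S(w))`, and then across the coproduct of `eᵢ`
  set r' := 𝓗.rb.π (𝓗.lb.t (op (𝓗.lb.π (𝓗.rb.t (op r))))) with hr'
  have hr : 𝓗.S (𝓗.rb.s r') = 𝓗.rb.t (op r) := (tR_eq_S_sR r).symm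
  have h1 : ∀ w, h * 𝓗.rb.t (op r) * 𝓗.S (𝓗.S w) = h * 𝓗.S (𝓗.S (𝓗.rb.t (op r') * w)) :=
    fun w => by rw [S_tR_mul, S_mul, hr, mul_assoc]
  simp only [h1, ← actL_tR_mul]
  rw [← 𝓗.rb.sw_takeuchi (hb i), mul_sw]
  simp only [mul_assoc, 𝓗.S_mul (𝓗.rb.s r'), hr, 𝓗.rb.π_mul_t']

omit hε [Fintype ι] in
lemma bal_actR_S {φ : H →ₗ[k] R} (hφ : 𝓗.TRLinear φ) :
    𝓗.rb.IsBal (fun a b => a * 𝓗.S (actR hφ b)) := by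
  constructor <;> intros <;> simp [mul_add, add_mul, mul_assoc, actR_mul_tR, S_mul_tR]

include he in
omit hε in
/-- `∑ᵢ y₁ s_R(εᵢ(y₂)) ⊗ eᵢ = ∑ᵢ eᵢ₁ t_R(εᵢ(y)) ⊗ eᵢ₂`, since both sides are `γ_R(y)`. -/
lemma sum_actR_dualBasis (hε : ∀ i, 𝓗.TRLinear (ε i)) (hF : 𝓗.rb.IsBal F) (y : H) :
    ∑ i, F (actR (hε i) y) (e i) =
      ∑ i, sw (𝓗.rb.γ (e i)) (fun a b => F (a * 𝓗.rb.t (op (ε i y))) b) := by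
  trans sw (𝓗.rb.γ y) F
  · simp only [actR_apply, hF.apply_sw_left, hF.bal, ← sw_fun_sum, ← hF.apply_sum_right, he]
  · conv_lhs => rw [← he y, map_sum, sw_eq_lift hF, map_sum]
    simp only [← sw_eq_lift hF, RightBialgebroid.sw_mul_of_eq_right hF (𝓗.rb.γ_t _), mul_one]

include he in
/-- The functional `leftTrace` has the integral property for the right bialgebroid. -/
lemma leftTrace_right (h : H) : sw (𝓗.rb.γ h) (fun a b => a * 𝓗.rb.s (leftTrace e ε hg b)) =
    𝓗.rb.t (op (leftTrace e ε hg h)) := by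
  -- the multiple of `h` at which the dual basis is evaluated
  set Y : H → H := fun w => h * 𝓗.S (𝓗.S (actL hg w)) with hY
  -- write `π_R(S(x))` as `S(S(x₂)) S(x₁)` and multiply `h₁ ⊗ h₂` with the coproduct of the
  -- argument of `εᵢ`
  have hconv : ∀ i, sw (𝓗.rb.γ h) (fun c d => c * 𝓗.rb.s (sw (𝓗.rb.γ (e i)) (fun a b =>
      𝓗.rb.π (𝓗.S (a * 𝓗.rb.t (op (ε i (d * 𝓗.S (𝓗.S (actL hg b)))))))))) =
      sw (𝓗.rb.γ (e i)) (fun m w => actR (hε i) (Y w) * 𝓗.S m) := fun i => by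
    have hK : 𝓗.rb.IsBal (fun a b => a * 𝓗.rb.s (ε i b)) := bal_mul_sR (hε i)
    have hE : 𝓗.rb.IsBal (fun a b => 𝓗.S (𝓗.S b) * 𝓗.S a) := bal_S_left bal_S_mul
    have hF : 𝓗.rb.IsBal (fun n b => sw (𝓗.rb.γ h) (fun c d => c * n * 𝓗.rb.s (ε i (d * b)))) := by
      refine Bal.sw _ fun c d => ?_
      constructor <;> intros <;>
        try simp only [mul_add, add_mul, map_add, map_smul, smul_mul_assoc, mul_smul_comm]
      rw [← mul_assoc d, hε i, map_mul 𝓗.rb.s]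
      simp only [mul_assoc]
    have hFS : 𝓗.rb.IsBal (fun n b => sw (𝓗.rb.γ h) (fun c d =>
        c * 𝓗.S (𝓗.S n) * 𝓗.rb.s (ε i (d * 𝓗.S (𝓗.S b))))) := by
      have h1 := bal_S_right hF 1 1
      simp only [one_mul] at h1
      exact bal_S_left h1
    have hw : ∀ m w, sw (𝓗.rb.γ w) (fun n b => sw (𝓗.rb.γ h) (fun c d =>
        c * (𝓗.S (𝓗.S n) * 𝓗.S (m * 𝓗.rb.t (op (ε i (d * 𝓗.S (𝓗.S (actL hg b))))))))) =
        actR (hε i) (Y w) * 𝓗.S m := fun m w => by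
      conv_rhs => rw [actR_apply, RightBialgebroid.sw_γ_mul hK, sw_comm, sw_γR_SS hF,
        sw_γR_actL hg hFS]
      simp only [sw_mul, S_mul_tR, mul_assoc]
    have hT : Tri k (fun (r : R) (h : H) => h * 𝓗.rb.s r)
        (fun (r : R) (h : H) => h * 𝓗.rb.t (op r)) (fun (r : R) (h : H) => h * 𝓗.rb.s r)
        (fun (r : R) (h : H) => h * 𝓗.rb.t (op r))
        (fun m n b => sw (𝓗.rb.γ h) (fun c d =>
          c * (𝓗.S (𝓗.S n) * 𝓗.S (m * 𝓗.rb.t (op (ε i (d * 𝓗.S (𝓗.S (actL hg b))))))))) := by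
      refine ⟨fun b => Bal.sw _ fun c d => ?_, fun m => Bal.sw _ fun c d => ?_⟩
      · constructor <;> intros <;>
          try simp only [mul_add, add_mul, map_add, map_smul, smul_mul_assoc, mul_smul_comm]
        rw [SS_mul_tR, ← S_sR_eq, S_mul_tR, S_mul_tR, S_mul, S_sR, ← mul_assoc (𝓗.rb.s _),
          ← 𝓗.sL_sR_comm]
        simp only [mul_assoc]
      · constructor <;> intros <;>
          try simp only [mul_add, add_mul, map_add, map_smul, smul_mul_assoc, mul_smul_comm,
            op_add, op_smul]
        rename_i r n b
        rw [S_mul, S_mul, S_sR_eq, S_tR, actL_mul_tR, SS_mul_tR, ← mul_assoc d, hε i, S_mul_tR,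
          S_mul_tR, map_mul 𝓗.rb.s]
        simp only [mul_assoc]
    simp only [map_sw, sR_πR_S, RightBialgebroid.sw_mul_of_eq_right hE (𝓗.rb.γ_t _), mul_one]
    simp only [mul_sw, sw_comm (𝓗.rb.γ h)]
    rw [hT.sw_coassoc _ _ _ _ (𝓗.rb.coassoc (e i) _ (cls_repT _))]
    simp only [hw]
  -- expand `w` in the dual basis, and regroup the double sum by `sum_actR_dualBasis`
  have hexpand : ∑ i, sw (𝓗.rb.γ (e i)) (fun m w => actR (hε i) (Y w) * 𝓗.S m) =
      ∑ i, ∑ j, sw (𝓗.rb.γ (e i)) (fun a b =>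
        a * 𝓗.rb.t (op (ε i (Y (e j)))) * 𝓗.S (actR (hε j) b)) := by
    have hG : ∀ i, 𝓗.rb.IsBal (fun m w => actR (hε i) (Y w) * 𝓗.S m) := fun i => by
      constructor <;> intros <;>
        try simp only [hY, map_add, map_smul, mul_add, add_mul, smul_mul_assoc, mul_smul_comm]
      rw [actL_mul_tR, SS_mul_tR, ← mul_assoc, actR_mul_tR, S_mul, S_sR_eq, mul_assoc]
    have hexp : ∀ i, sw (𝓗.rb.γ (e i)) (fun m w => actR (hε i) (Y w) * 𝓗.S m) =
        ∑ j, actR (hε i) (Y (e j)) * 𝓗.S (actR (hε j) (e i)) := fun i => by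
      have h1 : ∀ m w, actR (hε i) (Y w) * 𝓗.S m =
          ∑ j, actR (hε i) (Y (e j)) * 𝓗.S (m * 𝓗.rb.s (ε j w)) := fun m w => by
        have h2 := (hG i).apply_sum_right m Finset.univ (fun j => e j * 𝓗.rb.t (op (ε j w)))
        simp only [(hG i).bal, he] at h2 ⊢
        exact h2
      refine (congrArg _ (funext₂ h1)).trans ?_
      simp only [sw_fun_sum, actR_apply (hε _) (e i), map_sw, mul_sw]
    simp only [hexp]
    rw [Finset.sum_comm, Finset.sum_comm (f := fun i j => sw _ _)]
    exact Finset.sum_congr rfl fun j _ => sum_actR_dualBasis he hε (bal_actR_S (hε j)) _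
  -- undo the expansion, and collapse `a₁ t_R(r) S(a₂)` to `s_L(π_L(a t_R(r)))`
  have hcollapse : ∀ i, ∑ j, sw (𝓗.rb.γ (e i)) (fun a b =>
        a * 𝓗.rb.t (op (ε i (Y (e j)))) * 𝓗.S (actR (hε j) b)) =
      sw (𝓗.rb.γ (e i)) (fun a b => 𝓗.lb.s (𝓗.lb.π (a * 𝓗.rb.t (op (ε i (Y b)))))) := fun i => by
    have hM : 𝓗.rb.IsBal (fun c d => 𝓗.rb.t (op (ε i (Y d))) * 𝓗.S c) := by
      constructor <;> intros <;>
        try simp only [hY, map_add, map_smul, mul_add, add_mul, smul_mul_assoc, mul_smul_comm,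
          op_add, op_smul]
      rw [actL_mul_tR, tR_apply_SS (hε i), S_mul, mul_assoc]
    have hT : Tri k (fun (r : R) (h : H) => h * 𝓗.rb.s r)
        (fun (r : R) (h : H) => h * 𝓗.rb.t (op r)) (fun (r : R) (h : H) => h * 𝓗.rb.s r)
        (fun (r : R) (h : H) => h * 𝓗.rb.t (op r))
        (fun a c d => a * (𝓗.rb.t (op (ε i (Y d))) * 𝓗.S c)) := by
      refine ⟨fun d => ?_, fun a => ?_⟩
      · constructor <;> intros <;>
          try simp only [map_add, map_smul, mul_add, add_mul, smul_mul_assoc, mul_smul_comm]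
        rw [S_mul_tR, ← mul_assoc (𝓗.rb.t _), ← 𝓗.rb.st_comm]
        simp only [mul_assoc]
      · exact hM.map (LinearMap.mulLeft k a)
    have hE : 𝓗.rb.IsBal (fun a c => a * 𝓗.S c) := by
      constructor <;> intros <;> simp [mul_add, add_mul, mul_assoc, S_mul_tR]
    have hexp : ∀ b, ∑ j, 𝓗.rb.t (op (ε i (Y (e j)))) * 𝓗.S (actR (hε j) b) =
        sw (𝓗.rb.γ b) (fun c d => 𝓗.rb.t (op (ε i (Y d))) * 𝓗.S c) := fun b => by
      have h1 : ∀ c d, 𝓗.rb.t (op (ε i (Y d))) * 𝓗.S c =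
          ∑ j, 𝓗.rb.t (op (ε i (Y (e j)))) * 𝓗.S (c * 𝓗.rb.s (ε j d)) := fun c d => by
        have h2 := hM.apply_sum_right c Finset.univ (fun j => e j * 𝓗.rb.t (op (ε j d)))
        simp only [hM.bal, he] at h2 ⊢
        exact h2
      refine Eq.symm ((congrArg _ (funext₂ h1)).trans ?_)
      simp only [sw_fun_sum, actR_apply, map_sw, mul_sw]
    rw [← sw_fun_sum]
    simp only [mul_assoc, ← Finset.mul_sum, hexp, mul_sw]
    rw [← hT.sw_coassoc _ _ _ _ (𝓗.rb.coassoc (e i) _ (cls_repT _))]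
    simp only [← 𝓗.sw_S_right, RightBialgebroid.sw_mul_of_eq_right hE (𝓗.rb.γ_t _), mul_one,
      mul_assoc]
  calc _ = ∑ i, sw (𝓗.rb.γ (e i)) (fun m w => actR (hε i) (Y w) * 𝓗.S m) := by
        simp only [← hconv, leftTrace_apply, map_sum, Finset.mul_sum, sw_fun_sum]
    _ = _ := by
        rw [hexpand, tR_leftTrace]
        exact Finset.sum_congr rfl fun i _ => hcollapse i

end Construction

end HopfAlgebroid

namespace HopfAlgebroid

variable {k L R H V : Type*} [CommRing k] [Ring L] [Algebra k L] [Ring R] [Algebra k R]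
  [Ring H] [Algebra k H] {𝓗 : HopfAlgebroid k L R H}

lemma exists_dualBasis_tR (hfg : 𝓗.IsFGProjective) :
    ∃ (n : ℕ) (e : Fin n → H) (ε : Fin n → H →ₗ[k] R), (∀ i, 𝓗.TRLinear (ε i)) ∧
      ∀ h, ∑ i, e i * 𝓗.rb.t (op (ε i h)) = h := by
  obtain ⟨n, e, φ, h1, h2⟩ := hfg.2.1.exists_dualBasis
  exact ⟨n, e, φ, fun i h r => h1 i r h, h2⟩

lemma exists_dualBasis_sL (hfg : 𝓗.IsFGProjective) :
    ∃ (n : ℕ) (x : Fin n → H) (g : Fin n → H →ₗ[k] L), (∀ i, 𝓗.SLLinear (g i)) ∧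
      ∀ h, ∑ i, 𝓗.lb.s (g i h) * x i = h := by
  obtain ⟨n, e, φ, h1, h2⟩ := hfg.2.2.2.exists_dualBasis
  exact ⟨n, e, φ, fun i l h => h1 i l h, h2⟩

/-- There are integrals `(pⱼ, qⱼ)` and elements `yⱼ` with `π_L = ∑ⱼ qⱼ(- yⱼ)`. -/
theorem exists_integrals_left (hfg : 𝓗.IsFGProjective) (hS : Function.Bijective 𝓗.S) :
    ∃ (n : ℕ) (p : Fin n → H →ₗ[k] R) (q : Fin n → H →ₗ[k] L) (y : Fin n → H),
      (∀ j, 𝓗.IsIntegral (p j) (q j)) ∧ ∀ h, ∑ j, q j (h * y j) = 𝓗.lb.π h := by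
  obtain ⟨m, e, ε, hε, he⟩ := exists_dualBasis_tR hfg
  obtain ⟨n, x, g, hg, hx⟩ := exists_dualBasis_sL hfg
  choose q hq using fun j =>
    IsIntegral.of_right hS (leftTrace_mul_tR (e := e) hε (hg j)) (leftTrace_right hε he (hg j))
  refine ⟨n, fun j => leftTrace e ε (hg j), q, fun j => 𝓗.S (x j), hq, fun h => ?_⟩
  -- summed over the dual basis `(xⱼ, gⱼ)`, the antipode of the action of `gⱼ` cancels against `xⱼ`
  have h1 : ∀ b, ∑ j, 𝓗.S (actL (hg j) b) * x j = 𝓗.rb.s (𝓗.rb.π b) := fun b => by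
    simp only [actL_apply, map_sw, S_tL_mul, sw_mul, ← sw_fun_sum, mul_assoc, ← Finset.mul_sum, hx,
      𝓗.sw_S_left]
  have h2 : ∀ i b, ∑ j, ε i (h * 𝓗.S (x j) * 𝓗.S (𝓗.S (actL (hg j) b))) =
      𝓗.ν (𝓗.rb.π b) * ε i h := fun i b => by
    simp only [mul_assoc, ← S_mul]
    rw [← map_sum, ← Finset.mul_sum, ← map_sum, h1, S_sR_eq, hε]
  have h3 : ∀ a b i, ∑ j, 𝓗.lb.π (a * 𝓗.rb.t (op (ε i (h * 𝓗.S (x j) *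
      𝓗.S (𝓗.S (actL (hg j) b)))))) =
      𝓗.lb.π (a * 𝓗.rb.s (𝓗.rb.π b) * 𝓗.rb.t (op (ε i h))) := fun a b i => by
    rw [← map_sum, ← Finset.mul_sum, ← map_sum, ← Finset.op_sum, h2, op_mul, map_mul 𝓗.rb.t,
      ← S_sR_eq, ← mul_assoc, πL_mul_S_sR, mul_assoc, mul_assoc, 𝓗.rb.st_comm]
  apply 𝓗.lb.s_injective
  simp only [map_sum, ← (hq _).tR_eq_sL, tR_leftTrace]
  rw [Finset.sum_comm]
  simp only [← sw_fun_sum, ← map_sum, h3]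
  simp only [← map_sw, ← sw_mul, 𝓗.rb.sw_counit_right, ← map_sum, he]

end HopfAlgebroid

namespace HopfAlgebroid

variable {k L R H V : Type*} [CommRing k] [Ring L] [Algebra k L] [Ring R] [Algebra k R]
  [Ring H] [Algebra k H] [AddCommGroup V] [Module k V] {𝓗 : HopfAlgebroid k L R H}
  {F : H → H → V} (hS : Function.Bijective 𝓗.S)

/-! ### Integrals from dual bases, for the right counit

This is the mirror image of the construction for the left counit, with the left and the right
bialgebroid exchanged, the multiplication reversed and `S` replaced by `S⁻¹`. -/

/-- `s_L ∘ π_L ∘ S⁻¹ = t_R ∘ π_R` -/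
lemma sL_πL_Sinv (h : H) : 𝓗.lb.s (𝓗.lb.π (𝓗.Sinv hS h)) = 𝓗.rb.t (op (𝓗.rb.π h)) := by
  rw [← tR_πR_S, S_Sinv]

variable (𝓗) in
/-- The automorphism of `L` through which `S⁻¹ ∘ S⁻¹` acts on `s_L`. -/
def νL (l : L) : L := 𝓗.lb.π (𝓗.rb.t (op (𝓗.rb.π (𝓗.lb.t (op l)))))

lemma Sinv_tL_eq (l : L) : 𝓗.Sinv hS (𝓗.lb.t (op l)) = 𝓗.lb.s (𝓗.νL l) := by
  rw [Sinv_tL, νL, 𝓗.sL_πL_tR]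

/-- `π_L(S⁻¹(t_L(l) x)) = π_L(S⁻¹(S⁻¹(t_L(l)) x))` -/
lemma πL_Sinv_tL_mul (x : H) (l : L) :
    𝓗.lb.π (𝓗.Sinv hS (𝓗.lb.t (op l) * x)) =
      𝓗.lb.π (𝓗.Sinv hS (𝓗.Sinv hS (𝓗.lb.t (op l)) * x)) := by
  rw [Sinv_mul, Sinv_mul, Sinv_tL_eq, Sinv_sL, 𝓗.lb.π_mul_s_eq]

/-- `π_R(S⁻¹(t_L(l)) x) = π_R(t_L(l) x)` -/
lemma πR_Sinv_tL_mul (x : H) (l : L) :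
    𝓗.rb.π (𝓗.Sinv hS (𝓗.lb.t (op l)) * x) = 𝓗.rb.π (𝓗.lb.t (op l) * x) := by
  rw [Sinv_tL, 𝓗.rb.π_t_mul]

lemma bal_mul_Sinv : 𝓗.rb.IsBal (fun a b => b * 𝓗.Sinv hS a) := by
  constructor <;> intros <;> simp [mul_add, add_mul, mul_assoc, Sinv_mul, Sinv_sR]

/-- `t_L(π_L(S⁻¹(x))) = S⁻¹(x₁) S⁻¹(S⁻¹(x₂))`, for the coproduct of the left bialgebroid. -/
lemma tL_πL_Sinv (x : H) : 𝓗.lb.t (op (𝓗.lb.π (𝓗.Sinv hS x))) =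
    sw (𝓗.lb.γ x) (fun a b => 𝓗.Sinv hS a * 𝓗.Sinv hS (𝓗.Sinv hS b)) := by
  rw [← sw_Sinv_right hS, sw_γR_Sinv hS (bal_mul_Sinv hS)]

lemma SinvSinv_sL_mul (x : H) (l : L) : 𝓗.Sinv hS (𝓗.Sinv hS (𝓗.lb.s l * x)) =
    𝓗.lb.s (𝓗.νL l) * 𝓗.Sinv hS (𝓗.Sinv hS x) := by
  rw [Sinv_mul, Sinv_sL, Sinv_mul, Sinv_tL_eq]

lemma sL_eq_Sinv_tL (l : L) : 𝓗.lb.s l =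
    𝓗.Sinv hS (𝓗.lb.t (op (𝓗.lb.π (𝓗.rb.s (𝓗.rb.π (𝓗.lb.s l)))))) := by
  rw [𝓗.tL_πL_sR, Sinv_sR, 𝓗.tR_πR_sL]

lemma sL_apply_SinvSinv {φ : H →ₗ[k] L} (hφ : 𝓗.SLLinear φ) (h x : H) (l : L) :
    𝓗.lb.s (φ (𝓗.Sinv hS (𝓗.Sinv hS (𝓗.lb.s l * x)) * h)) =
      𝓗.Sinv hS (𝓗.lb.t (op l)) * 𝓗.lb.s (φ (𝓗.Sinv hS (𝓗.Sinv hS x) * h)) := by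
  rw [SinvSinv_sL_mul, mul_assoc, hφ, map_mul, Sinv_tL_eq]

lemma actL_sL_mul {φ : H →ₗ[k] L} (hφ : 𝓗.SLLinear φ) (h : H) (l : L) :
    actL hφ (𝓗.lb.s l * h) = 𝓗.lb.s l * actL hφ h := by
  rw [actL_apply, actL_apply, LeftBialgebroid.sw_mul_of_eq_left (bal_tL_mul hφ) (𝓗.lb.γ_s l),
    mul_sw]
  simp only [one_mul, ← mul_assoc, 𝓗.lb.st_comm]

lemma actR_sL_mul {φ : H →ₗ[k] R} (hφ : 𝓗.TRLinear φ) (h : H) (l : L) :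
    actR hφ (𝓗.lb.s l * h) = 𝓗.lb.s l * actR hφ h := by
  rw [actR_apply, actR_apply, RightBialgebroid.sw_mul_of_eq_left (bal_mul_sR hφ) (𝓗.γR_sL l),
    mul_sw]
  simp only [one_mul, mul_assoc]

lemma actR_mul_sL {φ : H →ₗ[k] R} (hφ : 𝓗.TRLinear φ) (h : H) (l : L) :
    actR hφ (h * 𝓗.lb.s l) = actR hφ h * 𝓗.lb.s l := by
  rw [actR_apply, actR_apply, RightBialgebroid.sw_mul_of_eq_right (bal_mul_sR hφ) (𝓗.γR_sL l),
    sw_mul]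
  simp only [mul_one, mul_assoc, 𝓗.sL_sR_comm]

/-- `h ↦ h₁ s_R(φ(h₂))` is colinear for the left bialgebroid. -/
lemma sw_γL_actR {φ : H →ₗ[k] R} (hφ : 𝓗.TRLinear φ) (hF : 𝓗.lb.IsBal F) (h : H) :
    sw (𝓗.lb.γ (actR hφ h)) F = sw (𝓗.lb.γ h) (fun a b => F a (actR hφ b)) := by
  have hT : 𝓗.IsTriLR (fun a b c => F a (b * 𝓗.rb.s (φ c))) := by
    refine ⟨fun c => ?_, fun a => ?_⟩
    · constructor <;> intros <;>
        simp only [add_mul, smul_mul_assoc, hF.add_left, hF.add_right, hF.smul_left, hF.smul_right,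
          hF.bal, mul_assoc]
    · constructor <;> intros <;>
        simp only [mul_add, add_mul, mul_smul_comm, smul_mul_assoc, hF.add_right, hF.smul_right,
          mul_assoc, map_add, map_smul, hφ _ _, map_mul]
  rw [actR_apply, sw_map_sw hF]
  simp only [LeftBialgebroid.sw_mul_of_eq_right hF (𝓗.γL_sR _), mul_one, actR_apply,
    hF.apply_sw_right]
  exact sw_LR hT h

/-- `γ_L(S⁻¹(S⁻¹(h))) = S⁻¹(S⁻¹(h₁)) ⊗ S⁻¹(S⁻¹(h₂))` -/
lemma sw_γL_SinvSinv (hF : 𝓗.lb.IsBal F) (h : H) : sw (𝓗.lb.γ (𝓗.Sinv hS (𝓗.Sinv hS h))) F =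
    sw (𝓗.lb.γ h) (fun a b => F (𝓗.Sinv hS (𝓗.Sinv hS a)) (𝓗.Sinv hS (𝓗.Sinv hS b))) := by
  rw [sw_γL_Sinv hS hF, sw_γR_Sinv hS (bal_Sinv_left hS hF)]

section Construction

variable {ι : Type*} [Fintype ι] {e : ι → H} {ε : ι → H →ₗ[k] L} (hε : ∀ i, 𝓗.SLLinear (ε i))
  (he : ∀ h, ∑ i, 𝓗.lb.s (ε i h) * e i = h) {g : H →ₗ[k] R} (hg : 𝓗.TRLinear g)

/-- The integral `q(h) = ∑ᵢ π_L(S⁻¹(s_L(εᵢ(S⁻²(z(eᵢ₂)) h)) eᵢ₁))` with `z(e) = e₁ s_R(g(e₂))`,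
obtained from a dual basis `(eᵢ, εᵢ)` of `H` and a functional `g`. -/
def rightTrace (e : ι → H) (ε : ι → H →ₗ[k] L) (hg : 𝓗.TRLinear g) : H →ₗ[k] L where
  toFun h := ∑ i, sw (𝓗.lb.γ (e i)) (fun a b =>
    𝓗.lb.π (𝓗.Sinv hS (𝓗.lb.s (ε i (𝓗.Sinv hS (𝓗.Sinv hS (actR hg b)) * h)) * a)))
  map_add' h h' := by
    simp only [add_mul, map_add, mul_add, sw_fun_add, Finset.sum_add_distrib]
  map_smul' c h := by
    simp only [smul_mul_assoc, map_smul, mul_smul_comm, sw_fun_smul, Finset.smul_sum,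
      RingHom.id_apply]

lemma rightTrace_apply (h : H) : rightTrace hS e ε hg h = ∑ i, sw (𝓗.lb.γ (e i)) (fun a b =>
    𝓗.lb.π (𝓗.Sinv hS (𝓗.lb.s (ε i (𝓗.Sinv hS (𝓗.Sinv hS (actR hg b)) * h)) * a))) := rfl

lemma sL_rightTrace (h : H) : 𝓗.lb.s (rightTrace hS e ε hg h) =
    ∑ i, sw (𝓗.lb.γ (e i)) (fun a b =>
      𝓗.rb.t (op (𝓗.rb.π (𝓗.lb.s (ε i (𝓗.Sinv hS (𝓗.Sinv hS (actR hg b)) * h)) * a)))) := by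
  simp only [← sL_πL_Sinv hS]
  rw [rightTrace_apply, map_sum]
  exact Finset.sum_congr rfl fun i _ => map_sw _ _ _

include hε

lemma rightTrace_sL_mul : 𝓗.SLLinear (rightTrace hS e ε hg) := fun l h => by
  have hb : ∀ i, 𝓗.lb.IsBal (fun a b => 𝓗.lb.π (𝓗.Sinv hS
      (𝓗.lb.s (ε i (𝓗.Sinv hS (𝓗.Sinv hS (actR hg b)) * h)) * a))) := fun i => by
    constructor <;> intros <;>
      try simp only [map_add, map_smul, mul_add, add_mul, smul_mul_assoc, mul_smul_comm]
    rw [actR_sL_mul, sL_apply_SinvSinv hS (hε i), mul_assoc, ← πL_Sinv_tL_mul, ← mul_assoc,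
      𝓗.lb.st_comm, mul_assoc]
  rw [rightTrace_apply, rightTrace_apply, Finset.mul_sum]
  refine Finset.sum_congr rfl fun i _ => ?_
  -- `s_L(l)` is moved to the right of `S⁻²(w)`, and then across the coproduct of `eᵢ`
  set l' := 𝓗.lb.π (𝓗.rb.s (𝓗.rb.π (𝓗.lb.s l))) with hl'
  have hl : 𝓗.Sinv hS (𝓗.lb.t (op l')) = 𝓗.lb.s l := (sL_eq_Sinv_tL hS l).symm
  have h1 : ∀ w, 𝓗.Sinv hS (𝓗.Sinv hS w) * (𝓗.lb.s l * h) =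
      𝓗.Sinv hS (𝓗.Sinv hS (w * 𝓗.lb.s l')) * h := fun w => by
    rw [Sinv_mul, Sinv_sL, Sinv_mul, hl, mul_assoc]
  simp only [h1, ← actR_mul_sL]
  rw [← 𝓗.lb.sw_takeuchi (hb i), mul_sw]
  simp only [← mul_assoc, Sinv_mul hS _ (𝓗.lb.t (op l')), hl, 𝓗.lb.π_s_mul']

omit hε [Fintype ι] in
lemma bal_Sinv_actL {φ : H →ₗ[k] L} (hφ : 𝓗.SLLinear φ) :
    𝓗.lb.IsBal (fun a b => 𝓗.Sinv hS (actL hφ b) * a) := by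
  constructor <;> intros <;>
    simp [mul_add, add_mul, mul_assoc, actL_sL_mul, Sinv_mul, Sinv_sL]

include he in
omit hε in
/-- `∑ᵢ t_L(εᵢ(y₂)) y₁ ⊗ eᵢ = ∑ᵢ s_L(εᵢ(y)) eᵢ₁ ⊗ eᵢ₂`, since both sides are `γ_L(y)`. -/
lemma sum_actL_dualBasis (hε : ∀ i, 𝓗.SLLinear (ε i)) (hF : 𝓗.lb.IsBal F) (y : H) :
    ∑ i, F (actL (hε i) y) (e i) =
      ∑ i, sw (𝓗.lb.γ (e i)) (fun a b => F (𝓗.lb.s (ε i y) * a) b) := by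
  trans sw (𝓗.lb.γ y) F
  · simp only [actL_apply, hF.apply_sw_left, hF.bal, ← sw_fun_sum, ← hF.apply_sum_right, he]
  · conv_lhs => rw [← he y, map_sum, sw_eq_lift hF, map_sum]
    simp only [← sw_eq_lift hF, LeftBialgebroid.sw_mul_of_eq_left hF (𝓗.lb.γ_s _), one_mul]

include he in
/-- The functional `rightTrace` has the integral property for the left bialgebroid. -/
lemma rightTrace_left (h : H) :
    sw (𝓗.lb.γ h) (fun a b => 𝓗.lb.t (op (rightTrace hS e ε hg b)) * a) =
      𝓗.lb.s (rightTrace hS e ε hg h) := by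
  -- the multiple of `h` at which the dual basis is evaluated
  set Y : H → H := fun w => 𝓗.Sinv hS (𝓗.Sinv hS (actR hg w)) * h with hY
  -- write `t_L(π_L(S⁻¹(x)))` as `S⁻¹(x₁) S⁻¹(S⁻¹(x₂))` and multiply the coproduct of the argument
  -- of `εᵢ` with `h₁ ⊗ h₂`
  have hconv : ∀ i, sw (𝓗.lb.γ h) (fun c d => 𝓗.lb.t (op (sw (𝓗.lb.γ (e i)) (fun a b =>
      𝓗.lb.π (𝓗.Sinv hS (𝓗.lb.s (ε i (𝓗.Sinv hS (𝓗.Sinv hS (actR hg b)) * d)) * a))))) * c) =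
      sw (𝓗.lb.γ (e i)) (fun m w => 𝓗.Sinv hS m * actL (hε i) (Y w)) := fun i => by
    have hK : 𝓗.lb.IsBal (fun a b => 𝓗.lb.t (op (ε i b)) * a) := bal_tL_mul (hε i)
    have hE : 𝓗.lb.IsBal (fun a b => 𝓗.Sinv hS a * 𝓗.Sinv hS (𝓗.Sinv hS b)) :=
      bal_Sinv_right hS (bal_mul_Sinv hS)
    have hF : 𝓗.lb.IsBal (fun n b => sw (𝓗.lb.γ h) (fun c d =>
        𝓗.lb.t (op (ε i (b * d))) * (n * c))) := by
      refine Bal.sw _ fun c d => ?_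
      constructor <;> intros <;>
        try simp only [mul_add, add_mul, map_add, map_smul, smul_mul_assoc, mul_smul_comm, op_add,
          op_smul]
      rw [mul_assoc (𝓗.lb.s _), hε i, op_mul, map_mul 𝓗.lb.t]
      simp only [mul_assoc]
    have hFS : 𝓗.lb.IsBal (fun n b => sw (𝓗.lb.γ h) (fun c d =>
        𝓗.lb.t (op (ε i (𝓗.Sinv hS (𝓗.Sinv hS b) * d))) * (𝓗.Sinv hS (𝓗.Sinv hS n) * c))) :=
      bal_Sinv_right hS (bal_Sinv_left hS hF)
    have hw : ∀ m w, sw (𝓗.lb.γ w) (fun n b => sw (𝓗.lb.γ h) (fun c d =>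
        𝓗.Sinv hS (𝓗.lb.s (ε i (𝓗.Sinv hS (𝓗.Sinv hS (actR hg b)) * d)) * m) *
          𝓗.Sinv hS (𝓗.Sinv hS n) * c)) =
        𝓗.Sinv hS m * actL (hε i) (Y w) := fun m w => by
      conv_rhs => rw [actL_apply, LeftBialgebroid.sw_γ_mul hK, sw_γL_SinvSinv hS hF,
        sw_γL_actR hg hFS]
      simp only [mul_sw, Sinv_mul, Sinv_sL, mul_assoc]
    have hT : Tri k (fun (l : L) (h : H) => 𝓗.lb.t (op l) * h)
        (fun (l : L) (h : H) => 𝓗.lb.s l * h) (fun (l : L) (h : H) => 𝓗.lb.t (op l) * h)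
        (fun (l : L) (h : H) => 𝓗.lb.s l * h)
        (fun m n b => sw (𝓗.lb.γ h) (fun c d =>
          𝓗.Sinv hS (𝓗.lb.s (ε i (𝓗.Sinv hS (𝓗.Sinv hS (actR hg b)) * d)) * m) *
            𝓗.Sinv hS (𝓗.Sinv hS n) * c)) := by
      refine ⟨fun b => Bal.sw _ fun c d => ?_, fun m => Bal.sw _ fun c d => ?_⟩
      · constructor <;> intros <;>
          try simp only [mul_add, add_mul, map_add, map_smul, smul_mul_assoc, mul_smul_comm]
        rw [SinvSinv_sL_mul, Sinv_mul, Sinv_mul, Sinv_mul, Sinv_tL_eq, Sinv_sL,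
          mul_assoc (𝓗.Sinv hS _), 𝓗.lb.st_comm]
        simp only [mul_assoc]
      · constructor <;> intros <;>
          try simp only [mul_add, add_mul, map_add, map_smul, smul_mul_assoc, mul_smul_comm]
        rename_i l n b
        rw [Sinv_mul hS (𝓗.lb.t _), Sinv_mul hS _ (𝓗.Sinv hS _), Sinv_tL_eq, Sinv_sL, actR_sL_mul,
          SinvSinv_sL_mul, mul_assoc (𝓗.lb.s _) _ d, hε i, map_mul 𝓗.lb.s]
        simp only [Sinv_mul, Sinv_sL, mul_assoc]
    have hop : ∀ (x : H) (G : H → H → L), 𝓗.lb.t (op (sw (𝓗.lb.γ x) G)) =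
        sw (𝓗.lb.γ x) (fun a b => 𝓗.lb.t (op (G a b))) := fun x G =>
      map_sw (𝓗.lb.t.toLinearMap ∘ₗ (opLinearEquiv k).toLinearMap) _ _
    simp only [hop, tL_πL_Sinv, LeftBialgebroid.sw_mul_of_eq_left hE (𝓗.lb.γ_s _), one_mul]
    simp only [sw_mul, sw_comm (𝓗.lb.γ h)]
    rw [hT.sw_coassoc _ _ _ _ (𝓗.lb.coassoc (e i) _ (cls_repT _))]
    simp only [hw]
  -- expand `w` in the dual basis, and regroup the double sum by `sum_actL_dualBasis`
  have hexpand : ∑ i, sw (𝓗.lb.γ (e i)) (fun m w => 𝓗.Sinv hS m * actL (hε i) (Y w)) =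
      ∑ i, ∑ j, sw (𝓗.lb.γ (e i)) (fun a b =>
        𝓗.Sinv hS (actL (hε j) b) * (𝓗.lb.s (ε i (Y (e j))) * a)) := by
    have hG : ∀ i, 𝓗.lb.IsBal (fun m w => 𝓗.Sinv hS m * actL (hε i) (Y w)) := fun i => by
      constructor <;> intros <;>
        try simp only [hY, map_add, map_smul, mul_add, add_mul, smul_mul_assoc, mul_smul_comm]
      rw [actR_sL_mul, SinvSinv_sL_mul, mul_assoc (𝓗.lb.s _), actL_sL_mul, Sinv_mul, Sinv_tL_eq,
        mul_assoc]
    have hexp : ∀ i, sw (𝓗.lb.γ (e i)) (fun m w => 𝓗.Sinv hS m * actL (hε i) (Y w)) =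
        ∑ j, 𝓗.Sinv hS (actL (hε j) (e i)) * actL (hε i) (Y (e j)) := fun i => by
      have h1 : ∀ m w, 𝓗.Sinv hS m * actL (hε i) (Y w) =
          ∑ j, 𝓗.Sinv hS (𝓗.lb.t (op (ε j w)) * m) * actL (hε i) (Y (e j)) := fun m w => by
        have h2 := (hG i).apply_sum_right m Finset.univ (fun j => 𝓗.lb.s (ε j w) * e j)
        simp only [(hG i).bal, he] at h2 ⊢
        exact h2
      refine (congrArg _ (funext₂ h1)).trans ?_
      simp only [sw_fun_sum, actL_apply (hε _) (e i), map_sw, sw_mul]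
    simp only [hexp]
    rw [Finset.sum_comm, Finset.sum_comm (f := fun i j => sw _ _)]
    exact Finset.sum_congr rfl fun j _ => sum_actL_dualBasis he hε (bal_Sinv_actL hS (hε j)) _
  -- undo the expansion, and collapse `S⁻¹(a₂) s_L(l) a₁` to `t_R(π_R(s_L(l) a))`
  have hcollapse : ∀ i, ∑ j, sw (𝓗.lb.γ (e i)) (fun a b =>
        𝓗.Sinv hS (actL (hε j) b) * (𝓗.lb.s (ε i (Y (e j))) * a)) =
      sw (𝓗.lb.γ (e i)) (fun a b => 𝓗.rb.t (op (𝓗.rb.π (𝓗.lb.s (ε i (Y b)) * a)))) := fun i => by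
    have hM : 𝓗.lb.IsBal (fun c d => 𝓗.Sinv hS c * 𝓗.lb.s (ε i (Y d))) := by
      constructor <;> intros <;>
        try simp only [hY, map_add, map_smul, mul_add, add_mul, smul_mul_assoc, mul_smul_comm]
      rw [actR_sL_mul, sL_apply_SinvSinv hS (hε i), Sinv_mul, mul_assoc]
    have hT : Tri k (fun (l : L) (h : H) => 𝓗.lb.t (op l) * h)
        (fun (l : L) (h : H) => 𝓗.lb.s l * h) (fun (l : L) (h : H) => 𝓗.lb.t (op l) * h)
        (fun (l : L) (h : H) => 𝓗.lb.s l * h)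
        (fun a c d => 𝓗.Sinv hS c * 𝓗.lb.s (ε i (Y d)) * a) := by
      refine ⟨fun d => ?_, fun a => ?_⟩
      · constructor <;> intros <;>
          try simp only [map_add, map_smul, mul_add, add_mul, smul_mul_assoc, mul_smul_comm]
        rw [Sinv_mul, Sinv_sL, ← mul_assoc, mul_assoc _ (𝓗.lb.s _) (𝓗.lb.t _), 𝓗.lb.st_comm]
        simp only [mul_assoc]
      · exact hM.map (LinearMap.mulRight k a)
    have hE : 𝓗.lb.IsBal (fun a c => 𝓗.Sinv hS c * a) := by
      constructor <;> intros <;> simp [mul_add, add_mul, mul_assoc, Sinv_mul, Sinv_sL]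
    have hexp : ∀ b, ∑ j, 𝓗.Sinv hS (actL (hε j) b) * 𝓗.lb.s (ε i (Y (e j))) =
        sw (𝓗.lb.γ b) (fun c d => 𝓗.Sinv hS c * 𝓗.lb.s (ε i (Y d))) := fun b => by
      have h1 : ∀ c d, 𝓗.Sinv hS c * 𝓗.lb.s (ε i (Y d)) =
          ∑ j, 𝓗.Sinv hS (𝓗.lb.t (op (ε j d)) * c) * 𝓗.lb.s (ε i (Y (e j))) := fun c d => by
        have h2 := hM.apply_sum_right c Finset.univ (fun j => 𝓗.lb.s (ε j d) * e j)
        simp only [hM.bal, he] at h2 ⊢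
        exact h2
      refine Eq.symm ((congrArg _ (funext₂ h1)).trans ?_)
      simp only [sw_fun_sum, actL_apply, map_sw, sw_mul]
    rw [← sw_fun_sum]
    simp only [← mul_assoc, ← Finset.sum_mul, hexp, sw_mul]
    rw [← hT.sw_coassoc _ _ _ _ (𝓗.lb.coassoc (e i) _ (cls_repT _))]
    simp only [← sw_Sinv_left hS, LeftBialgebroid.sw_mul_of_eq_left hE (𝓗.lb.γ_s _), one_mul,
      mul_assoc]
  calc _ = ∑ i, sw (𝓗.lb.γ (e i)) (fun m w => 𝓗.Sinv hS m * actL (hε i) (Y w)) := by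
        simp only [← hconv, rightTrace_apply, Finset.op_sum, map_sum, Finset.sum_mul, sw_fun_sum]
    _ = _ := by
        rw [hexpand, sL_rightTrace]
        exact Finset.sum_congr rfl fun i _ => hcollapse i

end Construction

include hS in
/-- There are integrals `(pⱼ, qⱼ)` and elements `yⱼ` with `π_R = ∑ⱼ pⱼ(yⱼ -)`. -/
theorem exists_integrals_right (hfg : 𝓗.IsFGProjective) :
    ∃ (n : ℕ) (p : Fin n → H →ₗ[k] R) (q : Fin n → H →ₗ[k] L) (y : Fin n → H),
      (∀ j, 𝓗.IsIntegral (p j) (q j)) ∧ ∀ h, ∑ j, p j (y j * h) = 𝓗.rb.π h := by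
  obtain ⟨m, e, ε, hε, he⟩ := exists_dualBasis_sL hfg
  obtain ⟨n, x, g, hg, hx⟩ := exists_dualBasis_tR hfg
  choose p hp using fun j =>
    IsIntegral.of_left hS (rightTrace_sL_mul (e := e) hS hε (hg j))
      (rightTrace_left hS hε he (hg j))
  refine ⟨n, p, fun j => rightTrace hS e ε (hg j), fun j => 𝓗.Sinv hS (x j), hp, fun h => ?_⟩
  -- summed over the dual basis `(xⱼ, gⱼ)`, the action of `gⱼ` cancels against `xⱼ`
  have h1 : ∀ b, ∑ j, x j * 𝓗.Sinv hS (actR (hg j) b) = 𝓗.lb.t (op (𝓗.lb.π b)) := fun b => by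
    simp only [actR_apply, map_sw, Sinv_mul, Sinv_sR, mul_sw, ← sw_fun_sum, ← mul_assoc,
      ← Finset.sum_mul, hx, sw_Sinv_right]
  have h2 : ∀ i b, ∑ j, ε i (𝓗.Sinv hS (𝓗.Sinv hS (actR (hg j) b)) * (𝓗.Sinv hS (x j) * h)) =
      𝓗.νL (𝓗.lb.π b) * ε i h := fun i b => by
    simp only [← mul_assoc, ← Sinv_mul]
    rw [← map_sum, ← Finset.sum_mul, ← map_sum, h1, Sinv_tL_eq, hε]
  have h3 : ∀ a b i, ∑ j, 𝓗.rb.π (𝓗.lb.s (ε i (𝓗.Sinv hS (𝓗.Sinv hS (actR (hg j) b)) *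
      (𝓗.Sinv hS (x j) * h))) * a) =
      𝓗.rb.π (𝓗.lb.s (ε i h) * (𝓗.lb.t (op (𝓗.lb.π b)) * a)) := fun a b i => by
    rw [← map_sum, ← Finset.sum_mul, ← map_sum, h2, map_mul 𝓗.lb.s, ← Sinv_tL_eq hS,
      mul_assoc, πR_Sinv_tL_mul, ← mul_assoc, ← mul_assoc, 𝓗.lb.st_comm]
  apply 𝓗.rb.t_op_injective
  simp only [Finset.op_sum, map_sum, (hp _).tR_eq_sL, sL_rightTrace]
  rw [Finset.sum_comm]
  simp only [← sw_fun_sum, ← map_sum, ← Finset.op_sum, h3]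
  have hop : ∀ (x : H) (G : H → H → R), 𝓗.rb.t (op (sw (𝓗.lb.γ x) G)) =
      sw (𝓗.lb.γ x) (fun a b => 𝓗.rb.t (op (G a b))) := fun x G =>
    map_sw (𝓗.rb.t.toLinearMap ∘ₗ (opLinearEquiv k).toLinearMap) _ _
  simp only [← hop, ← map_sw, ← mul_sw, 𝓗.lb.sw_counit_right, ← map_sum, ← Finset.op_sum, he]

end HopfAlgebroid

/-! ### Comodule algebras in terms of Sweedler sums -/

namespace RightBialgebroid.ComoduleAlgebra

variable {k R H A V : Type*} [CommRing k] [Ring R] [Algebra k R] [Ring H] [Algebra k H]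
  [Ring A] [Algebra k A] [AddCommGroup V] [Module k V] {rb : RightBialgebroid k R H}
  (C : rb.ComoduleAlgebra A)

/-- `F : A → H → V` is bilinear and balanced for the tensor product `A ⊗_R H`. -/
abbrev IsBal (F : A → H → V) : Prop :=
  Bal k (fun (r : R) (a : A) => a * C.η r) (fun (r : R) (h : H) => h * rb.t (op r)) F

variable {C} {F : A → H → V}

lemma sw_τ_mul (hF : C.IsBal F) (a a' : A) : sw (C.τ (a * a')) F =
    sw (C.τ a) (fun b h => sw (C.τ a') (fun b' h' => F (b * b') (h * h'))) := by
  rw [C.τ_mul a a' _ _ (cls_repT _) (cls_repT _), sw_cls_repT_mul_repT hF]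

lemma sw_τ_mul_η (hF : C.IsBal F) (a : A) (r : R) : sw (C.τ (a * C.η r)) F =
    sw (C.τ a) (fun b h => F b (h * rb.s r)) := by
  rw [C.τ_right r a _ (cls_repT _), sw_cls_repT_mul hF]
  simp only [mul_one]

lemma sw_τ_η_mul (hF : C.IsBal F) (a : A) (r : R) : sw (C.τ (C.η r * a)) F =
    sw (C.τ a) (fun b h => F b (rb.s r * h)) := by
  rw [C.τ_left r a _ (cls_repT _), sw_cls_mul_repT hF]
  simp only [one_mul]

/-- The Takeuchi condition `η(r) a₀ ⊗ a₁ = a₀ ⊗ t(r) a₁`. -/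
lemma sw_takeuchi (hF : C.IsBal F) (a : A) (r : R) :
    sw (C.τ a) (fun b h => F (C.η r * b) h) = sw (C.τ a) (fun b h => F b (rb.t (op r) * h)) := by
  have := congrArg hF.lift (C.takeuchi r a _ (cls_repT _))
  rw [← sw_eq_lift, ← sw_eq_lift, sw_cls_mul_repT hF, sw_cls_mul_repT hF] at this
  simpa using this

variable (C) in
lemma sw_counit (a : A) : sw (C.τ a) (fun b h => b * C.η (rb.π h)) = a := by
  have := C.counit a _ (cls_repT _)
  simp only [repT, map_sum, TensorProduct.map_tmul, LinearMap.mul'_apply] at this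
  exact this

lemma bal_mul_η {p : H →ₗ[k] R} (hp : ∀ h r, p (h * rb.t (op r)) = r * p h) :
    C.IsBal (fun a h => a * C.η (p h)) := by
  constructor <;> intros <;> simp [mul_add, add_mul, mul_assoc, hp]

lemma τ_of_mem {a : A} (ha : a ∈ C.coinv) : C.τ a = cls _ _ (a ⊗ₜ[k] 1) := ha

lemma sw_τ_coinv_mul (hF : C.IsBal F) {b : A} (hb : b ∈ C.coinv) (a : A) :
    sw (C.τ (b * a)) F = sw (C.τ a) (fun c h => F (b * c) h) := by
  rw [C.τ_mul b a _ _ (τ_of_mem hb).symm (cls_repT _), sw_cls_mul_repT hF]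
  simp only [one_mul]

lemma leftMul_τ (a a' : A) :
    C.leftMul a (C.τ a') = sw (C.τ a') (fun b h => cls _ _ ((a * b) ⊗ₜ[k] h)) := by
  conv_lhs => rw [← sw_cls (C.τ a'), map_sw]
  refine congrArg _ (funext₂ fun b h => ?_)
  change cls _ _ ((a ⊗ₜ[k] (1 : H)) * (b ⊗ₜ[k] h)) = _
  rw [Algebra.TensorProduct.tmul_mul_tmul, one_mul]

lemma can_tmul (B : Subalgebra k A) (hB : B ≤ C.coinv) (a a' : A) :
    C.can B hB (cls _ _ (a ⊗ₜ[k] a')) =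
      sw (C.τ a') (fun b h => cls _ _ ((a * b) ⊗ₜ[k] h)) := by
  rw [← leftMul_τ, can]
  exact (Submodule.liftQ_apply _ _ _).trans (TensorProduct.lift.tmul _ _)

/-- If `A` is flat over `k`, the coinvariants of `A ⊗_k A` are `A ⊗_k B`, because the coinvariants
of `A` are a kernel. -/
lemma tensorCoinv_of_flat [Module.Flat k A] :
    C.tensorCoinv = LinearMap.range (C.coinv.val.toLinearMap.lTensor A) := by
  have h : Function.Exact C.coinv.val.toLinearMap (C.τ - C.ι) := fun a => by
    rw [LinearMap.sub_apply, sub_eq_zero]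
    exact ⟨fun h => ⟨⟨a, h⟩, rfl⟩, fun ⟨b, hb⟩ => hb ▸ b.2⟩
  rw [← (Module.Flat.lTensor_exact A h).linearMap_ker_eq, LinearMap.lTensor_sub]
  ext x
  rw [LinearMap.mem_ker, LinearMap.sub_apply, sub_eq_zero]
  rfl

end RightBialgebroid.ComoduleAlgebra

namespace LeftBialgebroid.ComoduleAlgebra

variable {k L H A V : Type*} [CommRing k] [Ring L] [Algebra k L] [Ring H] [Algebra k H]
  [Ring A] [Algebra k A] [AddCommGroup V] [Module k V] {lb : LeftBialgebroid k L H}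
  (C : lb.ComoduleAlgebra A)

/-- `F : A → H → V` is bilinear and balanced for the tensor product `A ⊗_L H`. -/
abbrev IsBal (F : A → H → V) : Prop :=
  Bal k (fun (l : L) (a : A) => C.η (op l) * a) (fun (l : L) (h : H) => lb.s l * h) F

variable {C} {F : A → H → V}

lemma sw_τ_mul (hF : C.IsBal F) (a a' : A) : sw (C.τ (a * a')) F =
    sw (C.τ a) (fun b h => sw (C.τ a') (fun b' h' => F (b * b') (h * h'))) := by
  rw [C.τ_mul a a' _ _ (cls_repT _) (cls_repT _), sw_cls_repT_mul_repT hF]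

lemma sw_τ_mul_η (hF : C.IsBal F) (a : A) (l : L) : sw (C.τ (a * C.η (op l))) F =
    sw (C.τ a) (fun b h => F b (h * lb.t (op l))) := by
  rw [C.τ_left l a _ (cls_repT _), sw_cls_repT_mul hF]
  simp only [mul_one]

/-- The Takeuchi condition `a₀ η(l) ⊗ a₁ = a₀ ⊗ a₁ s(l)`. -/
lemma sw_takeuchi (hF : C.IsBal F) (a : A) (l : L) :
    sw (C.τ a) (fun b h => F (b * C.η (op l)) h) = sw (C.τ a) (fun b h => F b (h * lb.s l)) := by
  have := congrArg hF.lift (C.takeuchi l a _ (cls_repT _))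
  rw [← sw_eq_lift, ← sw_eq_lift, sw_cls_repT_mul hF, sw_cls_repT_mul hF] at this
  simpa using this

variable (C) in
lemma sw_counit (a : A) : sw (C.τ a) (fun b h => C.η (op (lb.π h)) * b) = a := by
  have := C.counit a _ (cls_repT _)
  simp only [repT, map_sum, TensorProduct.map_tmul, LinearMap.mul'_apply,
    TensorProduct.comm_tmul] at this
  exact this

lemma bal_η_mul {q : H →ₗ[k] L} (hq : ∀ l h, q (lb.s l * h) = l * q h) :
    C.IsBal (fun a h => C.η (op (q h)) * a) := by
  constructor <;> intros <;> simp [mul_add, add_mul, mul_assoc, hq]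

lemma τ_of_mem {a : A} (ha : a ∈ C.coinv) : C.τ a = cls _ _ (a ⊗ₜ[k] 1) := ha

lemma sw_τ_mul_coinv (hF : C.IsBal F) {b : A} (hb : b ∈ C.coinv) (a : A) :
    sw (C.τ (a * b)) F = sw (C.τ a) (fun c h => F (c * b) h) := by
  rw [C.τ_mul a b _ _ (cls_repT _) (τ_of_mem hb).symm, sw_cls_repT_mul hF]
  simp only [mul_one]

lemma rightMul_τ (a a' : A) :
    C.rightMul a' (C.τ a) = sw (C.τ a) (fun b h => cls _ _ ((b * a') ⊗ₜ[k] h)) := by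
  conv_lhs => rw [← sw_cls (C.τ a), map_sw]
  refine congrArg _ (funext₂ fun b h => ?_)
  change cls _ _ ((b ⊗ₜ[k] h) * (a' ⊗ₜ[k] (1 : H))) = _
  rw [Algebra.TensorProduct.tmul_mul_tmul, mul_one]

lemma can_tmul (B : Subalgebra k A) (hB : B ≤ C.coinv) (a a' : A) :
    C.can B hB (cls _ _ (a ⊗ₜ[k] a')) =
      sw (C.τ a) (fun b h => cls _ _ ((b * a') ⊗ₜ[k] h)) := by
  rw [← rightMul_τ, can]
  exact (Submodule.liftQ_apply _ _ _).trans (TensorProduct.lift.tmul _ _)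

end LeftBialgebroid.ComoduleAlgebra

/-! ### Comparison of the two Galois conditions -/

namespace HopfAlgebroid.ComoduleAlgebra

variable {k L R H A V : Type*} [CommRing k] [Ring L] [Algebra k L] [Ring R] [Algebra k R]
  [Ring H] [Algebra k H] [Ring A] [Algebra k A] [AddCommGroup V] [Module k V]
  {𝓗 : HopfAlgebroid k L R H} (C : 𝓗.ComoduleAlgebra A)

lemma ηL_eq (l : L) : C.lc.η (op l) = C.rc.η (𝓗.rb.π (𝓗.lb.t (op l))) := by
  simpa [𝓗.rb.π_one] using C.bimod 1 l 1

lemma ηR_eq (r : R) : C.rc.η r = C.lc.η (op (𝓗.lb.π (𝓗.rb.s r))) := by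
  rw [ηL_eq, 𝓗.tL_πL_sR, 𝓗.rb.π_s]

variable {C}

/-- `(τ_R ⊗ H) τ_L = (A ⊗ γ_L) τ_R` for Sweedler sums. -/
lemma sw_RL {G : A → H → H → V}
    (hG : Tri k (fun (r : R) (a : A) => a * C.rc.η r) (fun (r : R) (h : H) => h * 𝓗.rb.t (op r))
      (fun (l : L) (h : H) => 𝓗.lb.t (op l) * h) (fun (l : L) (h : H) => 𝓗.lb.s l * h) G) (a : A) :
    sw (C.lc.τ a) (fun b h => sw (C.rc.τ b) (fun b' g => G b' g h)) =
      sw (C.rc.τ a) (fun b h => sw (𝓗.lb.γ h) (fun g g' => G b g g')) :=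
  hG.sw_coassoc _ _ _ _ (C.τR_τL a _ _ (cls_repT _) (cls_repT _))

/-- `(τ_L ⊗ H) τ_R = (A ⊗ γ_R) τ_L` for Sweedler sums. -/
lemma sw_LR {G : A → H → H → V}
    (hG : Tri k (fun (l : L) (a : A) => C.lc.η (op l) * a) (fun (l : L) (h : H) => 𝓗.lb.s l * h)
      (fun (r : R) (h : H) => h * 𝓗.rb.s r) (fun (r : R) (h : H) => h * 𝓗.rb.t (op r)) G) (a : A) :
    sw (C.rc.τ a) (fun b h => sw (C.lc.τ b) (fun b' g => G b' g h)) =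
      sw (C.lc.τ a) (fun b h => sw (𝓗.rb.γ h) (fun g g' => G b g g')) :=
  hG.sw_coassoc _ _ _ _ (C.τL_τR a _ _ (cls_repT _) (cls_repT _))

variable {F : A → H → V}

lemma sw_τR_ηL_mul (hF : C.rc.IsBal F) (a : A) (l : L) : sw (C.rc.τ (C.lc.η (op l) * a)) F =
    sw (C.rc.τ a) (fun b h => F b (𝓗.lb.t (op l) * h)) := by
  rw [ηL_eq, RightBialgebroid.ComoduleAlgebra.sw_τ_η_mul hF, 𝓗.sR_πR_tL]

lemma sw_τL_mul_ηR (hF : C.lc.IsBal F) (a : A) (r : R) : sw (C.lc.τ (a * C.rc.η r)) F =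
    sw (C.lc.τ a) (fun b h => F b (h * 𝓗.rb.s r)) := by
  rw [ηR_eq, LeftBialgebroid.ComoduleAlgebra.sw_τ_mul_η hF, 𝓗.tL_πL_sR]

/-- `a₀ ⊗ a₁ S(a₂) h = a ⊗ h`, with the first coproduct from `τ_L` and the second from `τ_R`. -/
lemma sw_τL_S (hF : C.lc.IsBal F) (a : A) (h : H) :
    sw (C.rc.τ a) (fun b g => sw (C.lc.τ b) (fun b' g' => F b' (g' * 𝓗.S g * h))) = F a h := by
  rw [sw_LR (G := fun b g' g => F b (g' * 𝓗.S g * h))]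
  · simp only [← hF.apply_sw_right, ← sw_mul, 𝓗.sw_S_right, ← hF.bal, ← hF.apply_sw_left,
      C.lc.sw_counit]
  · refine ⟨fun g => ?_, fun b => ?_⟩ <;> constructor <;> intros <;>
      simp only [map_add, map_smul, add_mul, mul_add, smul_mul_assoc, mul_smul_comm, hF.add_left,
        hF.add_right, hF.smul_left, hF.smul_right, mul_assoc, hF.bal, S_mul_tR]

/-- `a₀ ⊗ h S⁻¹(a₂) a₁ = a ⊗ h`, with the first coproduct from `τ_R` and the second from `τ_L`. -/
lemma sw_τR_Sinv (hS : Function.Bijective 𝓗.S) (hF : C.rc.IsBal F) (a : A) (h : H) :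
    sw (C.lc.τ a) (fun b g => sw (C.rc.τ b) (fun b' g' => F b' (h * (𝓗.Sinv hS g * g')))) =
      F a h := by
  rw [sw_RL (G := fun b g' g => F b (h * (𝓗.Sinv hS g * g')))]
  · simp only [← hF.apply_sw_right, ← mul_sw, sw_Sinv_left, ← hF.bal, ← hF.apply_sw_left,
      C.rc.sw_counit]
  · refine ⟨fun g => ?_, fun b => ?_⟩ <;> constructor <;> intros <;>
      simp only [map_add, map_smul, add_mul, mul_add, smul_mul_assoc, mul_smul_comm, hF.add_left,
        hF.add_right, hF.smul_left, hF.smul_right, mul_assoc, hF.bal, Sinv_mul, Sinv_sL]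

lemma bal_sw_τL_S (hF : C.lc.IsBal F) :
    C.rc.IsBal (fun a h => sw (C.lc.τ a) (fun b g => F b (g * 𝓗.S h))) := by
  have h1 : ∀ h, C.lc.IsBal (fun b g => F b (g * 𝓗.S h)) := fun h => by
    constructor <;> intros <;>
      simp only [add_mul, smul_mul_assoc, hF.add_left, hF.add_right, hF.smul_left,
        hF.smul_right, mul_assoc, hF.bal]
  constructor <;> intros <;>
    try simp only [map_add, map_smul, mul_add, mul_smul_comm, hF.add_right,
      hF.smul_right, sw_fun_add, sw_fun_smul, sw_add (h1 _), sw_smul (h1 _)]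
  simp only [sw_τL_mul_ηR (h1 _), mul_assoc, S_mul_tR]

lemma bal_sw_τR_Sinv (hS : Function.Bijective 𝓗.S) (hF : C.rc.IsBal F) :
    C.lc.IsBal (fun a h => sw (C.rc.τ a) (fun b g => F b (𝓗.Sinv hS h * g))) := by
  have h1 : ∀ h, C.rc.IsBal (fun b g => F b (h * g)) := fun h => by
    constructor <;> intros <;>
      simp only [mul_add, mul_smul_comm, hF.add_left, hF.add_right, hF.smul_left,
        hF.smul_right, ← mul_assoc, hF.bal]
  constructor <;> intros <;>
    try simp only [map_add, map_smul, add_mul, smul_mul_assoc, hF.add_right,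
      hF.smul_right, sw_fun_add, sw_fun_smul, sw_add (h1 _), sw_smul (h1 _)]
  simp only [sw_τR_ηL_mul (h1 _), Sinv_mul, Sinv_sL, mul_assoc]

/-- Coinvariants are the same for the two bialgebroids: apply `sw_τL_S` and `sw_τR_Sinv` to a
coinvariant element. -/
lemma coinv_eq (hS : Function.Bijective 𝓗.S) : C.rc.coinv = C.lc.coinv := by
  ext a
  refine ⟨fun ha => ?_, fun ha => ?_⟩
  · have h := sw_τL_S (C := C) bal_cls a 1
    rw [RightBialgebroid.ComoduleAlgebra.τ_of_mem ha] at h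
    simp only [mul_one] at h
    rw [sw_cls_tmul (bal_sw_τL_S bal_cls)] at h
    change C.lc.τ a = cls _ _ (a ⊗ₜ[k] 1)
    simpa only [S_one, mul_one, sw_cls] using h
  · have h := sw_τR_Sinv (C := C) hS bal_cls a 1
    rw [LeftBialgebroid.ComoduleAlgebra.τ_of_mem ha] at h
    simp only [one_mul] at h
    rw [sw_cls_tmul (bal_sw_τR_Sinv hS bal_cls)] at h
    have h1 : 𝓗.Sinv hS 1 = 1 := by conv_lhs => rw [← 𝓗.S_one, Sinv_S]
    change C.rc.τ a = cls _ _ (a ⊗ₜ[k] 1)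
    simpa only [h1, one_mul, sw_cls] using h

variable (C)

/-- The map `A ⊗_R H → A ⊗_L H`, `a ⊗ h ↦ a₀ ⊗ a₁ S(h)`, bijective if `S` is. -/
def twist : C.rc.AH →ₗ[k] C.lc.AH := (bal_sw_τL_S (C := C) bal_cls).lift

lemma twist_tmul (a : A) (h : H) : C.twist (cls _ _ (a ⊗ₜ[k] h)) =
    sw (C.lc.τ a) (fun b g => cls _ _ (b ⊗ₜ[k] (g * 𝓗.S h))) := Bal.lift_cls_tmul _ _ _

lemma twist_bijective (hS : Function.Bijective 𝓗.S) : Function.Bijective C.twist := by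
  have hb := bal_sw_τR_Sinv (C := C) hS bal_cls
  have h1 : hb.lift ∘ₗ C.twist = LinearMap.id := btensor_hom_ext fun a h => by
    simp only [LinearMap.comp_apply, twist_tmul, map_sw, hb.lift_cls_tmul, Sinv_mul, Sinv_S,
      mul_assoc, LinearMap.id_apply]
    exact sw_τR_Sinv hS bal_cls a h
  have h2 : C.twist ∘ₗ hb.lift = LinearMap.id := btensor_hom_ext fun a h => by
    simp only [LinearMap.comp_apply, hb.lift_cls_tmul, map_sw, twist_tmul, S_mul, S_Sinv,
      ← mul_assoc, LinearMap.id_apply]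
    exact sw_τL_S bal_cls a h
  exact Function.bijective_iff_has_inverse.2
    ⟨hb.lift, fun x => LinearMap.congr_fun h1 x, fun x => LinearMap.congr_fun h2 x⟩

/-- The twist carries `can_R` to `can_L`. -/
lemma twist_can (B : Subalgebra k A) (hR : B ≤ C.rc.coinv) (hL : B ≤ C.lc.coinv) :
    C.twist ∘ₗ C.rc.can B hR = C.lc.can B hL := btensor_hom_ext fun a a' => by
  have hF := bal_cls (k := k) (act := fun (l : L) (a : A) => C.lc.η (op l) * a)
    (act' := fun (l : L) (h : H) => 𝓗.lb.s l * h)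
  have h1 : ∀ h : H, C.lc.IsBal (fun b g => cls (k := k) (fun (l : L) (a : A) => C.lc.η (op l) * a)
      (fun (l : L) (h : H) => 𝓗.lb.s l * h) (b ⊗ₜ[k] (g * 𝓗.S h))) := fun h => by
    constructor <;> intros <;>
      simp only [add_mul, smul_mul_assoc, hF.add_left, hF.add_right, hF.smul_left,
        hF.smul_right, mul_assoc, hF.bal]
  -- balanced by the Takeuchi condition for `a`, although the summands are not
  have h2 : C.lc.IsBal (fun x y => sw (C.lc.τ a) (fun c g => cls (k := k)
      (fun (l : L) (a : A) => C.lc.η (op l) * a) (fun (l : L) (h : H) => 𝓗.lb.s l * h)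
      ((c * x) ⊗ₜ[k] (g * y)))) := by
    constructor <;> intros <;>
      try simp only [mul_add, mul_smul_comm, hF.add_left, hF.add_right, hF.smul_left,
        hF.smul_right, sw_fun_add, sw_fun_smul]
    rename_i l x y
    have h3 : C.lc.IsBal (fun c g => cls (k := k) (fun (l : L) (a : A) => C.lc.η (op l) * a)
        (fun (l : L) (h : H) => 𝓗.lb.s l * h) ((c * x) ⊗ₜ[k] (g * y))) := by
      constructor <;> intros <;>
        simp only [add_mul, smul_mul_assoc, hF.add_left, hF.add_right, hF.smul_left,
          hF.smul_right, mul_assoc, hF.bal]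
    simpa only [mul_assoc] using LeftBialgebroid.ComoduleAlgebra.sw_takeuchi h3 a l
  have h4 := sw_τL_S h2 a' 1
  simp only [mul_one] at h4
  rw [LinearMap.comp_apply, RightBialgebroid.ComoduleAlgebra.can_tmul,
    LeftBialgebroid.ComoduleAlgebra.can_tmul, map_sw, ← h4]
  refine congrArg _ (funext₂ fun b h => ?_)
  rw [twist_tmul, LeftBialgebroid.ComoduleAlgebra.sw_τ_mul (h1 h), sw_comm]
  simp only [mul_assoc]

end HopfAlgebroid.ComoduleAlgebra

/-! ### Trace maps onto the coinvariants -/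

namespace HopfAlgebroid.ComoduleAlgebra

open RightBialgebroid.ComoduleAlgebra (bal_mul_η sw_τ_mul_η sw_τ_coinv_mul)
open LeftBialgebroid.ComoduleAlgebra (bal_η_mul sw_τ_mul_coinv)

variable {k L R H A V : Type*} [CommRing k] [Ring L] [Algebra k L] [Ring R] [Algebra k R]
  [Ring H] [Algebra k H] [Ring A] [Algebra k A] [AddCommGroup V] [Module k V]
  {𝓗 : HopfAlgebroid k L R H} {C : 𝓗.ComoduleAlgebra A} {p : H →ₗ[k] R} {q : H →ₗ[k] L}

/-- The trace map `a ↦ a₀ η_R(p(a₁))` of a functional `p` on `H`, for the coaction `τ_R`. -/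
def trace (C : 𝓗.ComoduleAlgebra A) (p : H →ₗ[k] R) (a : A) : A :=
  sw (C.rc.τ a) (fun b h => b * C.rc.η (p h))

lemma trace_add (hp : 𝓗.IsIntegral p q) (a a' : A) :
    trace C p (a + a') = trace C p a + trace C p a' := by
  rw [trace, map_add, sw_add (bal_mul_η hp.mul_tR)]
  rfl

/-- The trace map of an integral, in terms of the coaction `τ_L`: this makes it right linear over
the coinvariants. -/
lemma trace_eq_left (hp : 𝓗.IsIntegral p q) (a : A) :
    trace C p a = sw (C.lc.τ a) (fun b h => C.lc.η (op (q h)) * b) := by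
  have hπ : C.rc.IsBal (fun a h => a * C.rc.η (𝓗.rb.π h)) :=
    bal_mul_η fun h r => 𝓗.rb.π_mul_t' r h
  -- by the integral property for `γ_L`, since `p = π_R ∘ t_R ∘ p = π_R ∘ s_L ∘ q`
  have h1 : ∀ h, p h = sw (𝓗.lb.γ h) (fun g g' => 𝓗.rb.π (𝓗.lb.t (op (q g')) * g)) := fun h => by
    rw [← map_sw, hp.left, ← hp.tR_eq_sL, 𝓗.rb.π_t]
  have h2 : Tri k (fun (r : R) (a : A) => a * C.rc.η r) (fun (r : R) (h : H) => h * 𝓗.rb.t (op r))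
      (fun (l : L) (h : H) => 𝓗.lb.t (op l) * h) (fun (l : L) (h : H) => 𝓗.lb.s l * h)
      (fun b g g' => b * C.rc.η (𝓗.rb.π (𝓗.lb.t (op (q g')) * g))) := by
    have h3 : ∀ x y r, 𝓗.rb.π (x * (y * 𝓗.rb.t (op r))) = r * 𝓗.rb.π (x * y) := fun x y r => by
      rw [← mul_assoc, 𝓗.rb.π_mul_t']
    refine ⟨fun g => ?_, fun b => ?_⟩ <;> constructor <;> intros <;>
      simp [mul_add, add_mul, mul_assoc, hp.sL_mul, h3]
  simp only [trace, h1, map_sw, mul_sw]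
  rw [← sw_RL h2]
  simp only [← sw_τR_ηL_mul hπ, C.rc.sw_counit]

lemma trace_mem (hp : 𝓗.IsIntegral p q) (a : A) : trace C p a ∈ C.rc.coinv := by
  have hF := bal_cls (k := k) (act := fun (r : R) (a : A) => a * C.rc.η r)
    (act' := fun (r : R) (h : H) => h * 𝓗.rb.t (op r))
  have hT : Tri k (fun (r : R) (a : A) => a * C.rc.η r) (fun (r : R) (h : H) => h * 𝓗.rb.t (op r))
      (fun (r : R) (h : H) => h * 𝓗.rb.s r) (fun (r : R) (h : H) => h * 𝓗.rb.t (op r))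
      (fun b g g' => cls (k := k) (fun (r : R) (a : A) => a * C.rc.η r)
        (fun (r : R) (h : H) => h * 𝓗.rb.t (op r)) (b ⊗ₜ[k] (g * 𝓗.rb.s (p g')))) := by
    refine ⟨fun g => ?_, fun b => ?_⟩ <;> constructor <;> intros <;>
      simp only [map_add, map_smul, map_mul, add_mul, mul_add, smul_mul_assoc, mul_smul_comm,
        hF.add_left, hF.add_right, hF.smul_left, hF.smul_right, mul_assoc, hF.bal, hp.mul_tR,
        𝓗.rb.st_comm]
  have h1 := hT.sw_coassoc _ _ _ _ (C.rc.coassoc a _ (cls_repT _))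
  simp only [← hF.apply_sw_right, hp.right, ← sw_τ_mul_η hF] at h1
  change C.rc.τ (trace C p a) = cls _ _ (trace C p a ⊗ₜ[k] 1)
  rw [trace, map_sw, hF.apply_sw_left]
  simpa only [hF.bal, one_mul, sw_cls] using h1

lemma trace_coinv_mul (hp : 𝓗.IsIntegral p q) {b : A} (hb : b ∈ C.rc.coinv) (a : A) :
    trace C p (b * a) = b * trace C p a := by
  rw [trace, sw_τ_coinv_mul (bal_mul_η hp.mul_tR) hb, trace, mul_sw]
  simp only [mul_assoc]

lemma trace_mul_coinv (hp : 𝓗.IsIntegral p q) {b : A} (hb : b ∈ C.lc.coinv) (a : A) :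
    trace C p (a * b) = trace C p a * b := by
  rw [trace_eq_left hp, sw_τ_mul_coinv (bal_η_mul hp.sL_mul) hb, trace_eq_left hp, sw_mul]
  simp only [mul_assoc]

/-- The sum `x a₀ η_R(p(h a₁))` is balanced in `x` and `h`, by the Takeuchi condition for `a`. -/
lemma bal_sw_mul_η (hp : 𝓗.IsIntegral p q) (a : A) :
    C.rc.IsBal (fun x h => sw (C.rc.τ a) (fun b g => x * (b * C.rc.η (p (h * g))))) := by
  have h1 : ∀ x h, C.rc.IsBal (fun b g => x * (b * C.rc.η (p (h * g)))) := fun x h => by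
    have h3 : ∀ y r, p (h * (y * 𝓗.rb.t (op r))) = r * p (h * y) := fun y r => by
      rw [← mul_assoc, hp.mul_tR]
    constructor <;> intros <;> simp [mul_add, add_mul, mul_assoc, h3]
  constructor <;> intros <;>
    try simp only [mul_add, add_mul, map_add, map_smul, mul_smul_comm, smul_mul_assoc, sw_fun_add,
      sw_fun_smul]
  rename_i r x h
  simpa only [mul_assoc] using RightBialgebroid.ComoduleAlgebra.sw_takeuchi (h1 x h) a r

lemma mul_trace_mul (hp : 𝓗.IsIntegral p q) (x a' a : A) :
    x * trace C p (a' * a) = sw (C.rc.τ a') (fun b h => sw (C.rc.τ a) (fun b' g =>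
      (x * b) * (b' * C.rc.η (p (h * g))))) := by
  rw [trace, RightBialgebroid.ComoduleAlgebra.sw_τ_mul (bal_mul_η hp.mul_tR)]
  simp only [mul_sw, mul_assoc]

end HopfAlgebroid.ComoduleAlgebra

/-! ### Dual bases from preimages under the canonical maps -/

/-- Sums over an element of `A ⊗_B A` that factor through `can_R`. -/
lemma RightBialgebroid.ComoduleAlgebra.lift_can {k R H A V : Type*} [CommRing k] [Ring R]
    [Algebra k R] [Ring H] [Algebra k H] [Ring A] [Algebra k A] [AddCommGroup V] [Module k V]
    {rb : RightBialgebroid k R H} {C : rb.ComoduleAlgebra A} {F : A → H → V} (hF : C.IsBal F)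
    (B : Subalgebra k A) (hB : B ≤ C.coinv) (z : TensorOver B) :
    hF.lift (C.can B hB z) = sw z (fun u v => sw (C.τ v) (fun b h => F (u * b) h)) := by
  conv_lhs => rw [← sw_cls z]
  simp only [map_sw, can_tmul, hF.lift_cls_tmul]

/-- Sums over an element of `A ⊗_B A` that factor through `can_L`. -/
lemma LeftBialgebroid.ComoduleAlgebra.lift_can {k L H A V : Type*} [CommRing k] [Ring L]
    [Algebra k L] [Ring H] [Algebra k H] [Ring A] [Algebra k A] [AddCommGroup V] [Module k V]
    {lb : LeftBialgebroid k L H} {C : lb.ComoduleAlgebra A} {F : A → H → V} (hF : C.IsBal F)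
    (B : Subalgebra k A) (hB : B ≤ C.coinv) (z : TensorOver B) :
    hF.lift (C.can B hB z) = sw z (fun u v => sw (C.τ u) (fun b h => F (b * v) h)) := by
  conv_lhs => rw [← sw_cls z]
  simp only [map_sw, can_tmul, hF.lift_cls_tmul]

namespace HopfAlgebroid.ComoduleAlgebra

variable {k L R H A V : Type*} [CommRing k] [Ring L] [Algebra k L] [Ring R] [Algebra k R]
  [Ring H] [Algebra k H] [Ring A] [Algebra k A] [AddCommGroup V] [Module k V]
  {𝓗 : HopfAlgebroid k L R H} {C : 𝓗.ComoduleAlgebra A} {B : Subalgebra k A} {n : ℕ}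
  {p : Fin n → H →ₗ[k] R} {q : Fin n → H →ₗ[k] L} {y : Fin n → H} {z : Fin n → TensorOver B}

/-- The sum `η_L(q(a₁ h)) a₀ x` is balanced in `x` and `h`, by the Takeuchi condition for `a`. -/
lemma bal_sw_η_mul (q : H →ₗ[k] L) (hq : ∀ l h, q (𝓗.lb.s l * h) = l * q h) (a : A) :
    C.lc.IsBal (fun x h => sw (C.lc.τ a) (fun b g => C.lc.η (op (q (g * h))) * (b * x))) := by
  have h1 : ∀ x h, C.lc.IsBal (fun b g => C.lc.η (op (q (g * h))) * (b * x)) := fun x h => by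
    constructor <;> intros <;> simp [mul_add, add_mul, mul_assoc, hq]
  constructor <;> intros <;>
    try simp only [mul_add, add_mul, map_add, map_smul, mul_smul_comm, smul_mul_assoc, sw_fun_add,
      sw_fun_smul, op_add, op_smul]
  rename_i l x h
  simpa only [mul_assoc] using LeftBialgebroid.ComoduleAlgebra.sw_takeuchi (h1 x h) a l

/-- If `∑ u ⊗ v` is a preimage of `1 ⊗ yⱼ` under `can_L` and `∑ⱼ qⱼ(- yⱼ) = π_L`, then
`a = ∑ Tⱼ(a u) v` for the traces `Tⱼ`. -/
lemma sum_trace_mul (hL : B ≤ C.lc.coinv) (hpq : ∀ j, 𝓗.IsIntegral (p j) (q j))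
    (hy : ∀ h, ∑ j, q j (h * y j) = 𝓗.lb.π h)
    (hz : ∀ j, C.lc.can B hL (z j) = cls _ _ (1 ⊗ₜ[k] y j)) (a : A) :
    ∑ j, sw (z j) (fun u v => trace C (p j) (a * u) * v) = a := by
  have h1 : ∀ j u v, trace C (p j) (a * u) * v = sw (C.lc.τ u) (fun b h =>
      sw (C.lc.τ a) (fun b' g => C.lc.η (op (q j (g * h))) * (b' * (b * v)))) := fun j u v => by
    rw [trace_eq_left (hpq j), LeftBialgebroid.ComoduleAlgebra.sw_τ_mul
      (LeftBialgebroid.ComoduleAlgebra.bal_η_mul (hpq j).sL_mul), sw_comm]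
    simp only [sw_mul, mul_assoc]
  have h2 : ∀ j, sw (z j) (fun u v => trace C (p j) (a * u) * v) =
      sw (C.lc.τ a) (fun b g => C.lc.η (op (q j (g * y j))) * b) := fun j => by
    simp only [h1]
    rw [← LeftBialgebroid.ComoduleAlgebra.lift_can (bal_sw_η_mul (q j) (hpq j).sL_mul a) B hL,
      hz, Bal.lift_cls_tmul]
    simp only [mul_one]
  simp only [h2, ← sw_fun_sum, ← Finset.sum_mul, ← map_sum, ← Finset.op_sum, hy, C.lc.sw_counit]

/-- If `∑ u ⊗ v` is a preimage of `1 ⊗ yⱼ` under `can_R` and `∑ⱼ pⱼ(yⱼ -) = π_R`, then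
`a = ∑ u Tⱼ(v a)` for the traces `Tⱼ`. -/
lemma sum_mul_trace (hR : B ≤ C.rc.coinv) (hpq : ∀ j, 𝓗.IsIntegral (p j) (q j))
    (hy : ∀ h, ∑ j, p j (y j * h) = 𝓗.rb.π h)
    (hz : ∀ j, C.rc.can B hR (z j) = cls _ _ (1 ⊗ₜ[k] y j)) (a : A) :
    ∑ j, sw (z j) (fun u v => u * trace C (p j) (v * a)) = a := by
  have h2 : ∀ j, sw (z j) (fun u v => u * trace C (p j) (v * a)) =
      sw (C.rc.τ a) (fun b g => b * C.rc.η (p j (y j * g))) := fun j => by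
    simp only [mul_trace_mul (hpq j)]
    rw [← RightBialgebroid.ComoduleAlgebra.lift_can (bal_sw_mul_η (hpq j) a) B hR,
      hz, Bal.lift_cls_tmul]
    simp only [one_mul]
  simp only [h2, ← sw_fun_sum, ← Finset.mul_sum, ← map_sum, hy, C.rc.sw_counit]

/-- `A` is a projective left module over the coinvariants: the functionals `a ↦ Tⱼ(a u)` and the
elements `v` of `sum_trace_mul` are a dual basis. -/
lemma projective_left (hL : B ≤ C.lc.coinv) (hB : C.rc.coinv = B)
    (hpq : ∀ j, 𝓗.IsIntegral (p j) (q j)) (hy : ∀ h, ∑ j, q j (h * y j) = 𝓗.lb.π h)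
    (hz : ∀ j, C.lc.can B hL (z j) = cls _ _ (1 ⊗ₜ[k] y j)) : Module.Projective B A := by
  refine projective_of_dualBasis (ι := Σ j, rep (z j)) (fun i => i.2.1.2)
    (fun i =>
      { toFun := fun a => ⟨trace C (p i.1) (a * i.2.1.1), hB.le (trace_mem (hpq _) _)⟩
        map_add' := fun a a' => Subtype.ext (by simp [add_mul, trace_add (hpq _)])
        map_smul' := fun b a => Subtype.ext (by
          simp [Subalgebra.smul_def, mul_assoc, trace_coinv_mul (hpq _) (hB.ge b.2)]) })
    fun a => ?_
  conv_rhs => rw [← sum_trace_mul hL hpq hy hz a]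
  rw [Fintype.sum_sigma]
  exact Finset.sum_congr rfl fun j _ =>
    Finset.sum_coe_sort (rep (z j)) (fun i => trace C (p j) (a * i.1) * i.2)

/-- `A` is a projective right module over the coinvariants: the elements `u` and the functionals
`a ↦ Tⱼ(v a)` of `sum_mul_trace` are a dual basis. -/
lemma projective_right (hR : B ≤ C.rc.coinv) (hL : B ≤ C.lc.coinv) (hB : C.rc.coinv = B)
    (hpq : ∀ j, 𝓗.IsIntegral (p j) (q j)) (hy : ∀ h, ∑ j, p j (y j * h) = 𝓗.rb.π h)
    (hz : ∀ j, C.rc.can B hR (z j) = cls _ _ (1 ⊗ₜ[k] y j)) :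
    ProjectiveVia A (AlgHom.op B.val).toRingHom := by
  let _ : Module Bᵐᵒᵖ A := Module.compHom A (AlgHom.op B.val).toRingHom
  have hsmul : ∀ (b : Bᵐᵒᵖ) (a : A), b • a = a * (b.unop : A) := fun b a => rfl
  refine projective_of_dualBasis (X := Bᵐᵒᵖ) (M := A) (ι := Σ j, rep (z j)) (fun i => i.2.1.1)
    (fun i =>
      { toFun := fun a => op ⟨trace C (p i.1) (i.2.1.2 * a), hB.le (trace_mem (hpq _) _)⟩
        map_add' := fun a a' => by
          refine unop_injective (Subtype.ext ?_)
          simp [mul_add, trace_add (hpq _)]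
        map_smul' := fun b a => by
          refine unop_injective (Subtype.ext ?_)
          simp [hsmul, ← mul_assoc, trace_mul_coinv (hpq _) (hL b.unop.2)] })
    fun a => ?_
  conv_rhs => rw [← sum_mul_trace hR hpq hy hz a]
  rw [Fintype.sum_sigma]
  exact Finset.sum_congr rfl fun j _ =>
    Finset.sum_coe_sort (rep (z j)) (fun i => i.1 * trace C (p j) (i.2 * a))

/-- The trace identity `a' = ∑ Tⱼ(a' u) v` writes `a ⊗ a' = ∑ a Tⱼ(a' u) ⊗ v` as a function of
`can_R(a ⊗ a')`. -/
lemma can_injective (hR : B ≤ C.rc.coinv) (hL : B ≤ C.lc.coinv) (hB : C.rc.coinv = B)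
    (hpq : ∀ j, 𝓗.IsIntegral (p j) (q j)) (hy : ∀ h, ∑ j, q j (h * y j) = 𝓗.lb.π h)
    (hz : ∀ j, C.lc.can B hL (z j) = cls _ _ (1 ⊗ₜ[k] y j)) :
    Function.Injective (C.rc.can B hR) := by
  have hF := bal_cls (k := k) (act := fun (b : B) (a : A) => a * (b : A))
    (act' := fun (b : B) (a : A) => (b : A) * a)
  have hθ : C.rc.IsBal (fun x h => ∑ j, sw (z j) (fun u v =>
      cls (k := k) (fun (b : B) (a : A) => a * (b : A)) (fun (b : B) (a : A) => (b : A) * a)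
        (sw (C.rc.τ u) (fun b g => x * (b * C.rc.η (p j (h * g)))) ⊗ₜ[k] v))) :=
    Bal.sum _ fun j => Bal.sw _ fun u v => (bal_sw_mul_η (hpq j) u).map
      (cls (k := k) (fun (b : B) (a : A) => a * (b : A)) (fun (b : B) (a : A) => (b : A) * a) ∘ₗ
        (TensorProduct.mk k A A).flip v)
  have h1 : hθ.lift ∘ₗ C.rc.can B hR = LinearMap.id := btensor_hom_ext fun a a' => by
    have h2 : ∀ j u v, cls (k := k) (fun (b : B) (a : A) => a * (b : A))
        (fun (b : B) (a : A) => (b : A) * a) ((a * trace C (p j) (a' * u)) ⊗ₜ[k] v) =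
        cls _ _ (a ⊗ₜ[k] (trace C (p j) (a' * u) * v)) := fun j u v =>
      hF.bal ⟨trace C (p j) (a' * u), hB.le (trace_mem (hpq j) _)⟩ a v
    rw [LinearMap.comp_apply, RightBialgebroid.ComoduleAlgebra.can_tmul, map_sw]
    simp only [hθ.lift_cls_tmul, sw_fun_sum]
    conv_rhs => rw [← sum_trace_mul hL hpq hy hz a', LinearMap.id_apply, hF.apply_sum_right]
    refine Finset.sum_congr rfl fun j _ => ?_
    rw [sw_comm, hF.apply_sw_right]
    simp only [← h2, ← hF.apply_sw_left, mul_trace_mul (hpq j)]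
  exact Function.LeftInverse.injective (g := hθ.lift) fun x => LinearMap.congr_fun h1 x

end HopfAlgebroid.ComoduleAlgebra

end

end HopfAlgebroidGalois

theorem corollary3p3 {k L R H A : Type*} [CommRing k] [Ring L] [Algebra k L] [Ring R] [Algebra k R]
    [Ring H] [Algebra k H] [Ring A] [Algebra k A]
    (𝓗 : HopfAlgebroidGalois.HopfAlgebroid k L R H)
    (hfg : 𝓗.IsFGProjective) (hS : Function.Bijective 𝓗.S)
    (C : 𝓗.ComoduleAlgebra A) (B : Subalgebra k A) (hB : B = C.rc.coinv) :
    (C.rc.IsGalois B ↔ C.lc.IsGalois B) ∧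
    (Module.Flat k A →
      C.rc.tensorCoinv = LinearMap.range (B.val.toLinearMap.lTensor A)) ∧
    (C.rc.tensorCoinv = LinearMap.range (B.val.toLinearMap.lTensor A) →
      Function.Surjective (C.rc.can B hB.le) → C.rc.IsGalois B ∧ C.lc.IsGalois B) ∧
    (C.IsGalois B →
      Module.Projective B A ∧
      HopfAlgebroidGalois.ProjectiveVia A (AlgHom.op B.val).toRingHom) := by
  have hL : B = C.lc.coinv :=
    hB.trans (HopfAlgebroidGalois.HopfAlgebroid.ComoduleAlgebra.coinv_eq hS)
  have htw : C.lc.can B hL.le = C.twist ∘ C.rc.can B hB.le := by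
    rw [← C.twist_can B hB.le hL.le, LinearMap.coe_comp]
  have hiff : C.rc.IsGalois B ↔ C.lc.IsGalois B := by
    have h := (C.twist_bijective hS).of_comp_iff' (C.rc.can B hB.le)
    rw [← htw] at h
    exact ⟨fun ⟨_, h1⟩ => ⟨hL, h.2 h1⟩, fun ⟨_, h1⟩ => ⟨hB, h.1 h1⟩⟩
  refine ⟨hiff, fun _ => ?_, fun _ hsurj => ?_, fun hG => ⟨?_, ?_⟩⟩
  · subst hB
    exact HopfAlgebroidGalois.RightBialgebroid.ComoduleAlgebra.tensorCoinv_of_flat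
  · have hsurjL : Function.Surjective (C.lc.can B hL.le) :=
      htw ▸ (C.twist_bijective hS).2.comp hsurj
    obtain ⟨n, p, q, y, hpq, hy⟩ := HopfAlgebroidGalois.HopfAlgebroid.exists_integrals_left hfg hS
    choose z hz using fun j => hsurjL (HopfAlgebroidGalois.cls _ _ (1 ⊗ₜ[k] y j))
    have hgal : C.rc.IsGalois B := ⟨hB,
      HopfAlgebroidGalois.HopfAlgebroid.ComoduleAlgebra.can_injective hB.le hL.le hB.symm hpq hy hz,
      hsurj⟩
    exact ⟨hgal, hiff.1 hgal⟩
  · obtain ⟨n, p, q, y, hpq, hy⟩ := HopfAlgebroidGalois.HopfAlgebroid.exists_integrals_left hfg hS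
    choose z hz using fun j => hG.2.2.2 (HopfAlgebroidGalois.cls _ _ (1 ⊗ₜ[k] y j))
    exact HopfAlgebroidGalois.HopfAlgebroid.ComoduleAlgebra.projective_left hL.le hB.symm hpq hy hz
  · obtain ⟨n, p, q, y, hpq, hy⟩ := HopfAlgebroidGalois.HopfAlgebroid.exists_integrals_right hS hfg
    choose z hz using fun j => hG.1.2.2 (HopfAlgebroidGalois.cls _ _ (1 ⊗ₜ[k] y j))
    exact HopfAlgebroidGalois.HopfAlgebroid.ComoduleAlgebra.projective_right hB.le hL.le hB.symm
      hpq hy hz
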